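/- **Conventions.** A weight is a measurable function $v\ge 0$ on $(0,\infty)$ with $0<\int_0^x v(t)\,dt<\infty$ for all $x>0$. Put $0\cdot\infty=0$, $\infty/\infty=0$, $0/0=0$. For $1<p,q<\infty$ let $1/p+1/p'=1$, $1/q+1/q'=1$, and, when $q<p$, $1/r=1/q-1/p$. The symbol $X\approx Y$ means $C^{-1}X\le Y\le C X$ with a constant $C\in(0,\infty)$ depending only on $p$ and $q$ (both sides may be infinite). **Theorem.** Let $1<p,q<\infty$, let $a,b,v,w$ be weights on $(0,\infty)$ with $b(t)>0$ for a.e. $t>0$, and let $u$ be a continuous (finite-valued) weight on $(0,\infty)$. Put $$A(t)=\int_0^t a(s)\,ds,\qquad B(t)=\int_0^t b(s)\,ds,\qquad \rho(t)=\frac{u(t)}{B(t)},\qquad \sigma(t)=b(t)^{p'}v(t)^{1-p'},\qquad t>0.$$ Assume that $0<\int_0^x v(t)^{1-p'}\,dt<\infty$ for all $x>0$. Put $$\varphi(t)=\sup_{\tau\ge t}\rho(\tau)^{p'}\int_0^\tau\sigma(s)\,ds,\qquad t>0,$$ and let $d(-\varphi)$ be the Lebesgue–Stieltjes measure on $(0,\infty)$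 of the non-increasing function $\varphi:(0,\infty)\to[0,\infty]$ (if $\varphi$ takes the value $\infty$, $d(-\varphi)$ is defined as the supremum over $n\in\mathbb N$ of the Lebesgue–Stieltjes measures $d(-\min(\varphi,n))$). Let $$N=\sup_{h\ge 0}\frac{\Big(\int_0^\infty\Big(\int_0^x\Big(\sup_{\tau\ge t}\frac{u(\tau)}{B(\tau)}\int_0^\tau h(y)b(y)\,dy\Big)a(t)\,dt\Big)^q w(x)\,dx\Big)^{1/q}}{\Big(\int_0^\infty h(s)^p v(s)\,ds\Big)^{1/p}},$$ the supremum being over all non-negative measurable $h$ on $(0,\infty)$. (i) If $p\le q$, then $$\begin{aligned} N\approx{}&\sup_{t>0}\Big(\int_0^t\sigma(x)\Big(\int_x^t\Big(\sup_{\tau\ge s}\rho(\tau)\Big)a(s)\,ds\Big)^{p'}dx\Big)^{1/p'}\Big(\int_t^\infty w\Big)^{1/q}\\ &+\sup_{t>0}\Big(\int_0^t\sigma\Big)^{1/p'}\Big(\int_t^\infty\Big(\int_t^y\Big(\sup_{\tau\ge s}\rho(\tau)\Big)a(s)\,ds\Big)^q w(y)\,dy\Big)^{1/q}\\ &+\sup_{x>0}\Big(\int_{[x,\infty)}d(-\varphi)\Big)^{1/p'}\Big(\int_0^x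 A^q w\Big)^{1/q}\\ &+\sup_{x>0}\Big(\int_{(0,x]}A(t)^{p'}\,d(-\varphi)(t)\Big)^{1/p'}\Big(\int_x^\infty w\Big)^{1/q}\\ &+\Big(\int_0^\infty A^q w\Big)^{1/q}\lim_{t\to\infty}\sup_{\tau\ge t}\rho(\tau)\Big(\int_0^\tau\sigma\Big)^{1/p'}. \end{aligned}$$ (ii) If $q<p$, then $$\begin{aligned} N\approx{}&\Big(\int_0^\infty\Big(\int_0^t\sigma\Big)^{r/q'}\sigma(t)\Big(\int_t^\infty\Big(\int_t^z\Big(\sup_{y\ge s}\rho(y)\Big)a(s)\,ds\Big)^q w(z)\,dz\Big)^{r/q}dt\Big)^{1/r}\\ &+\Big(\int_0^\infty\Big(\int_0^t\sigma(x)\Big(\int_x^t\Big(\sup_{y\ge s}\rho(y)\Big)a(s)\,ds\Big)^{p'}dx\Big)^{r/p'}\Big(\int_t^\infty w\Big)^{r/p}w(t)\,dt\Big)^{1/r}\\ &+\Big(\int_0^\infty\Big(\int_{[x,\infty)}d(-\varphi)\Big)^{r/p'}\Big(\int_0^x A^q w\Big)^{r/p}A(x)^q w(x)\,dx\Big)^{1/r}\\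 &+\Big(\int_0^\infty\Big(\int_{(0,x]}A(t)^{p'}\,d(-\varphi)(t)\Big)^{r/p'}\Big(\int_x^\infty w\Big)^{r/p}w(x)\,dx\Big)^{1/r}\\ &+\Big(\int_0^\infty A^q w\Big)^{1/q}\lim_{t\to\infty}\sup_{\tau\ge t}\rho(\tau)\Big(\int_0^\tau\sigma\Big)^{1/p'}. \end{aligned}$$ -/

import Mathlib

open Set Filter Topology MeasureTheory
open scoped NNReal ENNReal

namespace Cesaro

noncomputable section

/-- A weight on `(0, ∞)`: a (Lebesgue) measurable function `v : (0, ∞) → [0, ∞]` with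
`0 < ∫₀ˣ v < ∞` for every `x > 0`. Values outside `(0, ∞)` are irrelevant. -/
structure IsWeight (v : ℝ → ℝ≥0∞) : Prop where
  aemeasurable : AEMeasurable v (volume.restrict (Ioi 0))
  pos : ∀ x : ℝ, 0 < x → 0 < ∫⁻ t in Ioc 0 x, v t
  lt_top : ∀ x : ℝ, 0 < x → ∫⁻ t in Ioc 0 x, v t < ∞

/-- The primitive `F(t) = ∫₀ᵗ f`. -/
def prim (f : ℝ → ℝ≥0∞) (t : ℝ) : ℝ≥0∞ := ∫⁻ s in Ioc 0 t, f s

/-- `t ↦ sup_{τ ≥ t} f(τ)`, the supremum being taken over `τ ∈ (0, ∞)` with `t ≤ τ`. -/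
def tailSup (f : ℝ → ℝ≥0∞) (t : ℝ) : ℝ≥0∞ := ⨆ (τ : ℝ) (_ : 0 < τ) (_ : t ≤ τ), f τ

theorem tailSup_antitone (f : ℝ → ℝ≥0∞) : Antitone (tailSup f) := by
  intro s t hst
  refine iSup_mono fun τ => iSup_mono fun _ => ?_
  exact iSup_le fun h => le_iSup (fun _ : s ≤ τ => f τ) (hst.trans h)

/-- The limit at `∞` of `t ↦ sup_{τ ≥ t} f(τ)`. -/
def limTailSup (f : ℝ → ℝ≥0∞) : ℝ≥0∞ := limUnder atTop (tailSup f)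

/-- The limit in the previous definition always exists. -/
theorem tendsto_tailSup (f : ℝ → ℝ≥0∞) :
    Tendsto (tailSup f) atTop (𝓝 (limTailSup f)) :=
  tendsto_nhds_limUnder ⟨_, tendsto_atTop_iInf (tailSup_antitone f)⟩

/-! ### The Lebesgue–Stieltjes measure `d(-φ)` of a non-increasing `φ : (0, ∞) → [0, ∞]`

Mathlib has the Stieltjes measure of a monotone real function. To allow the value `∞`,
`φ` is cut into the layers `φ = ∑ₙ min ((φ - n)⁺, 1)`, each of which is non-increasing with
values in `[0, 1]`, and the measures of the layers are added. If `φ` is finite and right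
continuous on `(0, ∞)`, this is the usual measure, with
`d(-φ) (x, y] = φ(x) - φ(y)` (see `negStieltjes_Ioc`). -/

/-- The `n`-th layer of `-φ`. -/
def negLayer (φ : ℝ → ℝ≥0∞) (n : ℕ) (t : ℝ) : ℝ := -(min (φ t - n) 1).toReal

theorem negLayer_monotone {φ : ℝ → ℝ≥0∞} (hφ : Antitone φ) (n : ℕ) :
    Monotone (negLayer φ n) := by
  intro s t hst
  refine neg_le_neg (ENNReal.toReal_mono ?_ ?_)
  · exact (min_le_right _ _).trans_lt ENNReal.one_lt_top |>.ne
  · exact min_le_min_right _ (tsub_le_tsub_right (hφ hst) _)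

/-- The measure `d(-φ)` on `(0, ∞)`. -/
def negStieltjes (φ : ℝ → ℝ≥0∞) (hφ : Antitone φ) : Measure ℝ :=
  (Measure.sum fun n : ℕ => (negLayer_monotone hφ n).stieltjesFunction.measure).restrict (Ioi 0)

/-- The layers of `z ∈ [0, ∞]` add up to `z`; partial sums are truncations. -/
theorem sum_layers (z : ℝ≥0∞) (N : ℕ) :
    ∑ n ∈ Finset.range N, min (z - n) 1 = min z N := by
  induction N with
  | zero => simp
  | succ N ih =>
    rw [Finset.sum_range_succ, ih]
    push_cast
    rcases le_total z N with h | h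
    · rw [min_eq_left h, tsub_eq_zero_of_le h, min_eq_left (h.trans le_self_add)]
      simp
    · rw [min_eq_right h, ← min_add_add_left, add_tsub_cancel_of_le h]

theorem tsum_layers (z : ℝ≥0∞) (hz : z ≠ ∞) : ∑' n : ℕ, min (z - n) 1 = z := by
  refine HasSum.tsum_eq ?_
  rw [ENNReal.summable.hasSum_iff_tendsto_nat]
  obtain ⟨N, hN⟩ := ENNReal.exists_nat_gt hz
  refine tendsto_const_nhds.congr' ?_
  filter_upwards [eventually_ge_atTop N] with n hn
  rw [sum_layers, min_eq_left]
  exact hN.le.trans (by exact_mod_cast hn)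

/-- At points where `φ` is finite and right continuous, `d(-φ) (x, y] = φ(x) - φ(y)`. -/
theorem negStieltjes_Ioc {φ : ℝ → ℝ≥0∞} (hφ : Antitone φ) {x y : ℝ} (hx : 0 < x) (hxy : x ≤ y)
    (hfin : φ x ≠ ∞) (hcx : ContinuousWithinAt φ (Ici x) x)
    (hcy : ContinuousWithinAt φ (Ici y) y) :
    negStieltjes φ hφ (Ioc x y) = φ x - φ y := by
  have hle : ∀ (n : ℕ) (z : ℝ≥0∞), min (z - n) 1 ≠ ∞ := fun n z =>
    (min_le_right _ _).trans_lt ENNReal.one_lt_top |>.ne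
  have key : ∀ z, ContinuousWithinAt φ (Ici z) z → ∀ n : ℕ,
      (negLayer_monotone hφ n).stieltjesFunction z = negLayer φ n z := by
    intro z hz n
    rw [Monotone.stieltjesFunction_eq]
    refine ContinuousWithinAt.rightLim_eq ?_
    have h1 : Tendsto (fun t => φ t - (n : ℝ≥0∞)) (𝓝[Ici z] z) (𝓝 (φ z - n)) :=
      ENNReal.Tendsto.sub hz tendsto_const_nhds (Or.inr (ENNReal.natCast_ne_top n))
    have h2 := (ENNReal.tendsto_toReal (hle n (φ z))).comp (h1.min tendsto_const_nhds)
    exact h2.neg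
  have hyx : φ y ≤ φ x := hφ hxy
  have hfy : φ y ≠ ∞ := (hyx.trans_lt hfin.lt_top).ne
  have hterm : ∀ n : ℕ, (negLayer_monotone hφ n).stieltjesFunction.measure (Ioc x y)
      = min (φ x - n) 1 - min (φ y - n) 1 := by
    intro n
    rw [StieltjesFunction.measure_Ioc, key x hcx, key y hcy, negLayer, negLayer,
      neg_sub_neg, ENNReal.ofReal_sub _ ENNReal.toReal_nonneg, ENNReal.ofReal_toReal (hle _ _),
      ENNReal.ofReal_toReal (hle _ _)]
  have hsub : Ioc x y ∩ Ioi 0 = Ioc x y :=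
    inter_eq_left.2 fun t ht => hx.trans ht.1
  rw [negStieltjes, Measure.restrict_apply measurableSet_Ioc, hsub,
    Measure.sum_apply _ measurableSet_Ioc]
  simp_rw [hterm]
  rw [ENNReal.tsum_sub, tsum_layers _ hfin, tsum_layers _ hfy]
  · rwa [tsum_layers _ hfy]
  · exact fun n => min_le_min_right _ (tsub_le_tsub_right hyx _)

/-! ### The operator and its norm

In `[0, ∞]` the conventions are `0 * ∞ = 0`, `0 / 0 = 0`, `∞ / ∞ = 0`. -/

/-- `u / B`, where `B(t) = ∫₀ᵗ b`. -/
def ratio (u : ℝ → ℝ≥0) (b : ℝ → ℝ≥0∞) (t : ℝ) : ℝ≥0∞ := (u t : ℝ≥0∞) / prim b t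

/-- The operator `(T_{u,b} h)(t) = sup_{τ ≥ t} (u(τ) / B(τ)) ∫₀^τ h(y) b(y) dy`. -/
def supHardy (u : ℝ → ℝ≥0) (b h : ℝ → ℝ≥0∞) : ℝ → ℝ≥0∞ :=
  tailSup fun τ => ratio u b τ * ∫⁻ y in Ioc 0 τ, h y * b y

/-- The weighted Lebesgue norm `‖f‖_{L^p(v)}` on `(0, ∞)`. -/
def lebNorm (p : ℝ) (v f : ℝ → ℝ≥0∞) : ℝ≥0∞ :=
  (∫⁻ s in Ioi 0, f s ^ p * v s) ^ (1 / p)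

/-- The weighted Cesàro norm `(∫₀^∞ (∫₀ˣ f(t) a(t) dt)^q w(x) dx)^{1/q}`. -/
def cesNorm (q : ℝ) (w a f : ℝ → ℝ≥0∞) : ℝ≥0∞ :=
  (∫⁻ x in Ioi 0, (∫⁻ t in Ioc 0 x, f t * a t) ^ q * w x) ^ (1 / q)

/-- The norm of `T_{u,b}` from `L^p(v)` to `Ces_q(w, a)`: the supremum, over all measurable
`h ≥ 0` on `(0, ∞)`, of the quotient of the norms. -/
def opNorm (p q : ℝ) (u : ℝ → ℝ≥0) (b a v w : ℝ → ℝ≥0∞) : ℝ≥0∞ :=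
  ⨆ (h : ℝ → ℝ≥0∞) (_ : AEMeasurable h (volume.restrict (Ioi 0))),
    cesNorm q w a (supHardy u b h) / lebNorm p v h

/-! ### The characterizing quantities

Below `ρ` stands for `u / B`, `σ` for `b^{p'} v^{1-p'}`, `p'` for the conjugate exponent of `p`,
and `r` for the number with `1 / r = 1 / q - 1 / p`. -/

/-- `b^{p'} v^{1-p'}`. -/
def dualWeight (p' : ℝ) (b v : ℝ → ℝ≥0∞) (t : ℝ) : ℝ≥0∞ := b t ^ p' * v t ^ (1 - p')

/-- `∫_x^y (sup_{τ ≥ s} ρ(τ)) a(s) ds`. -/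
def kern (ρ a : ℝ → ℝ≥0∞) (x y : ℝ) : ℝ≥0∞ := ∫⁻ s in Ioc x y, tailSup ρ s * a s

/-- `φ(t) = sup_{τ ≥ t} ρ(τ)^{p'} ∫₀^τ σ`. -/
def phi (p' : ℝ) (ρ σ : ℝ → ℝ≥0∞) : ℝ → ℝ≥0∞ := tailSup fun τ => ρ τ ^ p' * prim σ τ

/-- The measure `d(-φ)`. -/
def dPhi (p' : ℝ) (ρ σ : ℝ → ℝ≥0∞) : Measure ℝ :=
  negStieltjes (phi p' ρ σ) (tailSup_antitone _)

/-- `sup_t (∫₀ᵗ σ(x) (∫_x^t (sup_{τ ≥ s} ρ(τ)) a(s) ds)^{p'} dx)^{1/p'} (∫_t^∞ w)^{1/q}`. -/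
def I₁ (p' q : ℝ) (ρ σ a w : ℝ → ℝ≥0∞) : ℝ≥0∞ :=
  ⨆ t ∈ Ioi (0 : ℝ), (∫⁻ x in Ioc 0 t, σ x * kern ρ a x t ^ p') ^ (1 / p') *
    (∫⁻ y in Ioi t, w y) ^ (1 / q)

/-- `sup_t (∫₀ᵗ σ)^{1/p'} (∫_t^∞ (∫_t^y (sup_{τ ≥ s} ρ(τ)) a(s) ds)^q w(y) dy)^{1/q}`. -/
def I₂ (p' q : ℝ) (ρ σ a w : ℝ → ℝ≥0∞) : ℝ≥0∞ :=
  ⨆ t ∈ Ioi (0 : ℝ), (∫⁻ x in Ioc 0 t, σ x) ^ (1 / p') *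
    (∫⁻ y in Ioi t, kern ρ a t y ^ q * w y) ^ (1 / q)

/-- `sup_x (∫_{[x,∞)} d(-φ))^{1/p'} (∫₀ˣ A^q w)^{1/q}`. -/
def I₃ (p' q : ℝ) (ρ σ a w : ℝ → ℝ≥0∞) : ℝ≥0∞ :=
  ⨆ x ∈ Ioi (0 : ℝ), (dPhi p' ρ σ (Ici x)) ^ (1 / p') *
    (∫⁻ y in Ioc 0 x, prim a y ^ q * w y) ^ (1 / q)

/-- `sup_x (∫_{(0,x]} A(t)^{p'} d(-φ)(t))^{1/p'} (∫_x^∞ w)^{1/q}`. -/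
def I₄ (p' q : ℝ) (ρ σ a w : ℝ → ℝ≥0∞) : ℝ≥0∞ :=
  ⨆ x ∈ Ioi (0 : ℝ), (∫⁻ t in Ioc 0 x, prim a t ^ p' ∂(dPhi p' ρ σ)) ^ (1 / p') *
    (∫⁻ y in Ioi x, w y) ^ (1 / q)

/-- `(∫₀^∞ A^q w)^{1/q} lim_{t → ∞} sup_{τ ≥ t} ρ(τ) (∫₀^τ σ)^{1/p'}`. -/
def I₅ (p' q : ℝ) (ρ σ a w : ℝ → ℝ≥0∞) : ℝ≥0∞ :=
  (∫⁻ y in Ioi 0, prim a y ^ q * w y) ^ (1 / q) *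
    limTailSup fun τ => ρ τ * prim σ τ ^ (1 / p')

/-- `(∫₀^∞ (∫₀ᵗ σ)^{r/q'} σ(t) (∫_t^∞ (∫_t^z (sup_{y ≥ s} ρ(y)) a(s) ds)^q w(z) dz)^{r/q} dt)^{1/r}`. -/
def J₁ (q q' r : ℝ) (ρ σ a w : ℝ → ℝ≥0∞) : ℝ≥0∞ :=
  (∫⁻ t in Ioi 0, (∫⁻ x in Ioc 0 t, σ x) ^ (r / q') * σ t *
    (∫⁻ z in Ioi t, kern ρ a t z ^ q * w z) ^ (r / q)) ^ (1 / r)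

/-- `(∫₀^∞ (∫₀ᵗ σ(x) (∫_x^t (sup_{y ≥ s} ρ(y)) a(s) ds)^{p'} dx)^{r/p'} (∫_t^∞ w)^{r/p} w(t) dt)^{1/r}`. -/
def J₂ (p p' r : ℝ) (ρ σ a w : ℝ → ℝ≥0∞) : ℝ≥0∞ :=
  (∫⁻ t in Ioi 0, (∫⁻ x in Ioc 0 t, σ x * kern ρ a x t ^ p') ^ (r / p') *
    (∫⁻ s in Ioi t, w s) ^ (r / p) * w t) ^ (1 / r)

/-- `(∫₀^∞ (∫_{[x,∞)} d(-φ))^{r/p'} (∫₀ˣ A^q w)^{r/p} A(x)^q w(x) dx)^{1/r}`. -/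
def J₃ (p q p' r : ℝ) (ρ σ a w : ℝ → ℝ≥0∞) : ℝ≥0∞ :=
  (∫⁻ x in Ioi 0, (dPhi p' ρ σ (Ici x)) ^ (r / p') *
    (∫⁻ y in Ioc 0 x, prim a y ^ q * w y) ^ (r / p) * (prim a x ^ q * w x)) ^ (1 / r)

/-- `(∫₀^∞ (∫_{(0,x]} A(t)^{p'} d(-φ)(t))^{r/p'} (∫_x^∞ w)^{r/p} w(x) dx)^{1/r}`. -/
def J₄ (p p' r : ℝ) (ρ σ a w : ℝ → ℝ≥0∞) : ℝ≥0∞ :=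
  (∫⁻ x in Ioi 0, (∫⁻ t in Ioc 0 x, prim a t ^ p' ∂(dPhi p' ρ σ)) ^ (r / p') *
    (∫⁻ y in Ioi x, w y) ^ (r / p) * w x) ^ (1 / r)

end

end Cesaro

/-!
The substitution `h b = f σ` turns `N` into the best constant in
`‖x ↦ ∫_{t ≤ x} (sup_{τ ≥ t} ρ(τ) ∫_{y ≤ τ} f dσ) dα(t)‖_{L^q(ω)} ≤ N ‖f‖_{L^p(σ)}`, where `σ`, `α`
and `ω` are the measures on `(0, ∞)` with the densities `b ^ p' v ^ (1 - p')`, `a` and `w`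
(`isSupOpBound_opNorm`, `opNorm_le_of_isSupOpBound`).

**Upper bound.** The integral up to `τ` is split at `t` (`tailSup_mul_le_add`). The part up to `t`
gives the operator with the kernel `k(y, x) = ∫_y^x (sup_{τ ≥ s} ρ(τ)) dα(s)`, which is an Oinarov
kernel and accounts for the first two quantities. In the part beyond `t`, Hölder's inequality
replaces the supremum by `(∫_{y > t} f ^ p Φ ^ (p - 1) dσ) ^ (1 / p)` for every majorant `Φ` of
`φ`. The choice `Φ(y) = d(-φ)[y, ∞) + φ(∞)`, which differs from `φ` only at jumps
(`le_negStieltjes_Ici_add`, `negStieltjes_Ici_add_le`), allows Minkowski's inequality to turn this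
into `∫_{τ > t} g d(-φ)` plus a multiple of `φ(∞) ^ (1 / p') ‖f‖`, with a function `g` whose norm in
`L^p(d(-φ))` is at most that of `f` (`scaleTransfer`, `rpow_setLIntegral_Ioi_le`). Integration over
`t ≤ x` leads to a Hardy operator and a dual Hardy operator in the measure `d(-φ)`, that is, to the
third and the fourth quantity, while the multiple of the norm is the fifth.

**Lower bound.** The operator dominates the kernel operator pointwise. For the Hardy operators, let
`g` be given. On the layer `2 ^ k < φ ≤ 2 ^ (k + 1)` the tail `∫_{τ > t} g d(-φ)` is bounded by a
constant `h k`, and the definition of `φ` as a supremum provides a function of norm about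
`2 ^ (-k / p')` whose image is at least `1` on as much of the layer as desired (`exists_one_le_supOp`). The
supremum over `k` of these functions, multiplied by `h k`, has norm at most a constant times that of
`g`, because the bounds `h k` can be chosen such that their contributions form geometric series
(`exists_setLIntegral_Ioi_le_supOp`). The fifth quantity comes from multiples of indicator functions
of intervals `(0, τ]` and the limit `τ → ∞`. If `φ` takes the value `∞`, both sides are infinite.

**Kernel operators.** There remain the criteria for Hardy operators and for operators with Oinarov
kernels. The measure `d(-φ)` may have atoms, so they are proved for measures on a linear order, with
inequalities for distribution functions (`rpow_measure_univ_le`, `exists_setLIntegral_rpow_neg_le`)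
in place of integration by parts. Sufficiency rests on Hardy's inequality for averages and, for
kernels, on the decomposition of the line into the dyadic levels of the image function
(`kernelOp_le_add`). Necessity for `q < p` uses products of powers of the quantities involved as
test functions; the dual operators are the same operators on the reversed order. The functionals are
collected in `IsHardyFunctional` and `IsOinarovFunctional`, so that the reduction above is carried
out once for both ranges of exponents.
-/

namespace Cesaro

/-! ### Sums and integrals over initial segments -/

/-- Every set in a second countable linear order has a countable subset which is cofinal in it. -/
theorem exists_countable_cofinal {α : Type*} [LinearOrder α] [TopologicalSpace α]
    [OrderTopology α] [SecondCountableTopology α] (E : Set α) :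
    ∃ T ⊆ E, T.Countable ∧ ∀ e ∈ E, ∃ t ∈ T, e ≤ t := by
  obtain ⟨T, hT, hTc, hU⟩ := TopologicalSpace.isOpen_biUnion_countable E (fun e : α => Iio e)
    (fun e _ => isOpen_Iio)
  by_cases hmax : ∃ m ∈ E, ∀ e ∈ E, e ≤ m
  · obtain ⟨m, hm, hm'⟩ := hmax
    exact ⟨{m}, by simpa using hm, countable_singleton m, fun e he => ⟨m, rfl, hm' e he⟩⟩
  · push Not at hmax
    refine ⟨T, hT, hTc, fun e he => ?_⟩
    obtain ⟨e', he', hlt⟩ := hmax e he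
    have : e ∈ ⋃ i ∈ E, Iio i := mem_iUnion₂.2 ⟨e', he', hlt⟩
    rw [← hU] at this
    obtain ⟨t, ht, hlt'⟩ := mem_iUnion₂.1 this
    exact ⟨t, ht, le_of_lt hlt'⟩

theorem monotone_measure_Iic {α : Type*} [Preorder α] [MeasurableSpace α] (μ : Measure α) :
    Monotone fun x => μ (Iic x) :=
  fun _ _ h => measure_mono (Iic_subset_Iic.2 h)

theorem measurable_measure_Iic {α : Type*} [LinearOrder α] [TopologicalSpace α] [OrderTopology α]
    [SecondCountableTopology α] [MeasurableSpace α] [BorelSpace α] (μ : Measure α) :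
    Measurable fun x => μ (Iic x) :=
  (monotone_measure_Iic μ).measurable

/-- A measure which is at most `c` on each initial segment with endpoint in `E` is at most `c`
on `E`. -/
theorem measure_le_of_forall_Iic_le {α : Type*} [LinearOrder α] [TopologicalSpace α]
    [OrderTopology α] [SecondCountableTopology α] [MeasurableSpace α] (μ : Measure α) (E : Set α)
    (c : ℝ≥0∞) (h : ∀ e ∈ E, μ (Iic e) ≤ c) : μ E ≤ c := by
  obtain ⟨T, hT, hTc, hcof⟩ := exists_countable_cofinal E
  have hsub : E ⊆ ⋃ t ∈ T, Iic t := fun e he => by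
    obtain ⟨t, ht, hle⟩ := hcof e he
    exact mem_iUnion₂.2 ⟨t, ht, hle⟩
  refine (measure_mono hsub).trans ?_
  rw [measure_biUnion_eq_iSup hTc]
  · exact iSup₂_le fun t ht => h t (hT ht)
  · intro a ha b hb
    rcases le_total a b with hab | hab
    · exact ⟨b, hb, Iic_subset_Iic.2 hab, Iic_subset_Iic.2 le_rfl⟩
    · exact ⟨a, ha, Iic_subset_Iic.2 le_rfl, Iic_subset_Iic.2 hab⟩

theorem ae_measure_Iic_ne_zero {α : Type*} [LinearOrder α] [TopologicalSpace α] [OrderTopology α]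
    [SecondCountableTopology α] [MeasurableSpace α] (μ : Measure α) : ∀ᵐ x ∂μ, μ (Iic x) ≠ 0 := by
  rw [ae_iff]
  refine le_antisymm (measure_le_of_forall_Iic_le μ _ 0 fun e he => ?_) (zero_le)
  simpa using he

section Order

variable {α : Type*} [LinearOrder α] [TopologicalSpace α] [OrderTopology α]
  [SecondCountableTopology α] [MeasurableSpace α] [BorelSpace α]

/-- A substitute, for measures with atoms, of `L ^ β = β ∫₀ᴸ s ^ (β - 1) ds`: half of the mass
sits where the distribution function is at least half of the total mass. -/
theorem rpow_measure_univ_le (μ : Measure α) {β : ℝ} (hβ : 1 ≤ β) :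
    μ univ ^ β ≤ 2 ^ β * ∫⁻ x, μ (Iic x) ^ (β - 1) ∂μ := by
  have hsplit : ∀ s : ℝ≥0∞, μ univ ≤ s + μ {x | s ≤ μ (Iic x)} := fun s => by
    have h1 : μ {x | μ (Iic x) < s} ≤ s :=
      measure_le_of_forall_Iic_le μ _ s fun e he => le_of_lt he
    have h2 : (univ : Set α) ⊆ {x | μ (Iic x) < s} ∪ {x | s ≤ μ (Iic x)} := fun x _ =>
      lt_or_ge (μ (Iic x)) s
    exact (measure_mono h2).trans ((measure_union_le _ _).trans (add_le_add_left h1 _))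
  have hlow : ∀ s : ℝ≥0∞, s ^ (β - 1) * μ {x | s ≤ μ (Iic x)} ≤
      ∫⁻ x, μ (Iic x) ^ (β - 1) ∂μ := fun s => by
    have hm : MeasurableSet {x | s ≤ μ (Iic x)} :=
      measurableSet_le measurable_const (measurable_measure_Iic μ)
    rw [← setLIntegral_const]
    refine (setLIntegral_mono' hm fun x hx => ?_).trans (setLIntegral_le_lintegral _ _)
    exact ENNReal.rpow_le_rpow hx (by linarith)
  -- for infinite total mass the level `1` is used, otherwise the level `μ univ / 2`
  by_cases htop : μ univ = ∞
  · have h1 := hsplit 1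
    rw [htop, top_le_iff, ENNReal.add_eq_top] at h1
    have h2 : μ {x | 1 ≤ μ (Iic x)} = ∞ := by simpa using h1
    have h3 := hlow 1
    rw [h2, ENNReal.one_rpow, one_mul, top_le_iff] at h3
    rw [h3, ENNReal.mul_top]
    · exact le_top
    · exact (ENNReal.rpow_pos (by norm_num) (by norm_num)).ne'
  · by_cases h0 : μ univ = 0
    · rw [h0, ENNReal.zero_rpow_of_pos (by linarith)]; exact zero_le
    have h1 := hsplit (μ univ / 2)
    have h2 : μ univ / 2 ≤ μ {x | μ univ / 2 ≤ μ (Iic x)} := by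
      have hne : μ univ / 2 ≠ ∞ := by
        simpa [ENNReal.div_eq_top] using htop
      refine (ENNReal.add_le_add_iff_left hne).1 ?_
      rwa [ENNReal.add_halves]
    have hne0 : μ univ / 2 ≠ 0 := by simp [h0]
    have hneT : μ univ / 2 ≠ ∞ := by simpa [ENNReal.div_eq_top] using htop
    have h3 : (μ univ / 2) ^ β ≤ ∫⁻ x, μ (Iic x) ^ (β - 1) ∂μ := by
      refine le_trans ?_ (hlow (μ univ / 2))
      refine le_trans ?_ (mul_le_mul_right h2 _)
      conv_rhs => rw [← ENNReal.rpow_one (μ univ / 2), ← ENNReal.rpow_mul, one_mul,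
        ← ENNReal.rpow_add _ _ hne0 hneT]
      simp
    calc μ univ ^ β = (2 * (μ univ / 2)) ^ β := by
          rw [ENNReal.mul_div_cancel (by norm_num) (by norm_num)]
      _ = 2 ^ β * (μ univ / 2) ^ β := ENNReal.mul_rpow_of_nonneg _ _ (by linarith)
      _ ≤ _ := mul_le_mul_right h3 _

/-- The form of `rpow_measure_univ_le` for the distribution function of `f dμ` on a set `E`. -/
theorem rpow_setLIntegral_le (μ : Measure α) (E : Set α) {f : α → ℝ≥0∞}
    (hf : Measurable f) {β : ℝ} (hβ : 1 ≤ β) :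
    (∫⁻ y in E, f y ∂μ) ^ β ≤
      2 ^ β * ∫⁻ x in E, f x * (∫⁻ y in Iic x, f y ∂μ) ^ (β - 1) ∂μ := by
  have h := rpow_measure_univ_le ((μ.restrict E).withDensity f) hβ
  rw [withDensity_apply _ MeasurableSet.univ, setLIntegral_univ,
    lintegral_withDensity_eq_lintegral_mul _ hf
      ((measurable_measure_Iic _).pow_const _)] at h
  refine h.trans (mul_le_mul_right (lintegral_mono fun x => ?_) _)
  refine mul_le_mul_right (ENNReal.rpow_le_rpow ?_ (by linarith)) _
  rw [withDensity_apply _ measurableSet_Iic, Measure.restrict_restrict measurableSet_Iic]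
  exact lintegral_mono_set inter_subset_left

/-- The dyadic block, counted upwards from `m`, in which `z ≥ m` lies. -/
theorem exists_two_pow_mul_le {m z : ℝ≥0∞} (hm : m ≠ 0) (hz : z ≠ ∞) (hmz : m ≤ z) :
    ∃ j : ℕ, 2 ^ j * m ≤ z ∧ z ≤ 2 ^ (j + 1) * m := by
  have hmt : m ≠ ∞ := (hmz.trans_lt hz.lt_top).ne
  have h1 : 1 ≤ z / m := by rwa [ENNReal.le_div_iff_mul_le (Or.inl hm) (Or.inl hmt), one_mul]
  have hne : z / m ≠ 0 := (zero_lt_one.trans_le h1).ne'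
  have hnt : z / m ≠ ∞ := ENNReal.div_ne_top hz hm
  obtain ⟨n, hn⟩ := ENNReal.exists_mem_Ico_zpow hne hnt (y := 2) (by norm_num) (by norm_num)
  have hn0 : 0 ≤ n := by
    by_contra hcon
    have h2 : n + 1 ≤ 0 := by omega
    have h3 := ENNReal.zpow_le_of_le (x := 2) (by norm_num) h2
    rw [zpow_zero] at h3
    exact absurd (hn.2.trans_le h3) (not_lt.2 h1)
  lift n to ℕ using hn0
  refine ⟨n, ?_, ?_⟩
  · rw [← ENNReal.le_div_iff_mul_le (Or.inl hm) (Or.inl hmt)]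
    simpa using hn.1
  · rw [← ENNReal.div_le_iff_le_mul (Or.inl hm) (Or.inl hmt)]
    have := hn.2.le
    exact_mod_cast this

theorem two_pow_rpow (j : ℕ) (s : ℝ) : ((2 : ℝ≥0∞) ^ j) ^ s = ((2 : ℝ≥0∞) ^ s) ^ j := by
  rw [← ENNReal.rpow_natCast, ← ENNReal.rpow_mul, mul_comm, ENNReal.rpow_mul, ENNReal.rpow_natCast]

theorem two_rpow_lt_one {s : ℝ} (hs : s < 0) : (2 : ℝ≥0∞) ^ s < 1 :=
  ENNReal.rpow_lt_one_of_one_lt_of_neg (by norm_num) hs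

theorem tsum_geometric_ne_top {c : ℝ≥0∞} (hc : c < 1) : ∑' j : ℕ, c ^ j ≠ ∞ := by
  rw [ENNReal.tsum_geometric]
  exact ENNReal.inv_ne_top.2 (tsub_pos_of_lt hc).ne'

theorem two_rpow_ne_top (s : ℝ) : (2 : ℝ≥0∞) ^ s ≠ ∞ :=
  ENNReal.rpow_ne_top_of_ne_zero (by norm_num) (by norm_num)

/-- A substitute, for measures with atoms, of `∫₀ᴸ s ^ (-γ) ds = L ^ (1 - γ) / (1 - γ)`. -/
theorem exists_setLIntegral_rpow_neg_le {γ : ℝ} (hγ0 : 0 < γ) (hγ1 : γ < 1) :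
    ∃ C : ℝ≥0∞, C ≠ ∞ ∧ ∀ (μ : Measure α) (E : Set α),
      ∫⁻ x in E, μ (Iic x) ^ (-γ) ∂μ ≤ C * μ E ^ (1 - γ) := by
  refine ⟨1 + 2 ^ γ * ∑' j : ℕ, ((2 : ℝ≥0∞) ^ (γ - 1)) ^ j, ?_, fun μ E => ?_⟩
  · exact ENNReal.add_ne_top.2 ⟨ENNReal.one_ne_top, ENNReal.mul_ne_top (two_rpow_ne_top _)
      (tsum_geometric_ne_top (two_rpow_lt_one (by linarith)))⟩
  set L := μ E with hL
  by_cases hLt : L = ∞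
  · rw [hLt, ENNReal.top_rpow_of_pos (by linarith), ENNReal.mul_top (by simp)]
    exact le_top
  by_cases hL0 : L = 0
  · rw [setLIntegral_measure_zero _ _ hL0]; exact zero_le
  -- `z ^ (-γ)` is comparable to a constant on each block `2 ^ (-j - 1) L ≤ z ≤ 2 ^ (-j) L`, and
  -- the set where the distribution function is at most `2 ^ (-j) L` has mass at most `2 ^ (-j) L`
  have hpt : ∀ z : ℝ≥0∞, z ≠ 0 → z ^ (-γ) ≤ L ^ (-γ) + ∑' j : ℕ,
      {z : ℝ≥0∞ | 2 ^ j * z ≤ L}.indicator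
        (fun _ => 2 ^ γ * ((2 : ℝ≥0∞) ^ γ) ^ j * L ^ (-γ)) z := by
    intro z hz
    rcases le_total L z with h | h
    · refine le_add_right ?_
      rw [ENNReal.rpow_neg, ENNReal.rpow_neg]
      exact ENNReal.inv_le_inv.2 (ENNReal.rpow_le_rpow h hγ0.le)
    · obtain ⟨j, hj1, hj2⟩ := exists_two_pow_mul_le hz hLt h
      refine le_add_left (le_trans ?_ (ENNReal.le_tsum j))
      have hj1' : z ∈ {z : ℝ≥0∞ | 2 ^ j * z ≤ L} := hj1
      rw [indicator_of_mem hj1']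
      have h1 := ENNReal.rpow_le_rpow hj2 hγ0.le
      rw [ENNReal.mul_rpow_of_nonneg _ _ hγ0.le, two_pow_rpow, pow_succ'] at h1
      have hLγ0 : L ^ γ ≠ 0 := (ENNReal.rpow_pos (pos_iff_ne_zero.2 hL0) hLt).ne'
      have hLγt : L ^ γ ≠ ∞ := ENNReal.rpow_ne_top_of_nonneg hγ0.le hLt
      have hzt : z ≠ ∞ := (h.trans_lt (lt_top_iff_ne_top.2 hLt)).ne
      have hzγ0 : z ^ γ ≠ 0 := (ENNReal.rpow_pos (pos_iff_ne_zero.2 hz) hzt).ne'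
      have hzγt : z ^ γ ≠ ∞ := ENNReal.rpow_ne_top_of_nonneg hγ0.le hzt
      rw [ENNReal.rpow_neg, ENNReal.rpow_neg, ← div_eq_mul_inv,
        ENNReal.le_div_iff_mul_le (Or.inl hLγ0) (Or.inl hLγt), mul_comm, ← div_eq_mul_inv,
        ENNReal.div_le_iff_le_mul (Or.inl hzγ0) (Or.inl hzγt)]
      exact h1
  have hms : ∀ j : ℕ, MeasurableSet {x : α | 2 ^ j * μ (Iic x) ≤ L} := fun j =>
    measurableSet_le ((measurable_measure_Iic μ).const_mul _) measurable_const
  have hmeas : ∀ j : ℕ, μ.restrict E {x | 2 ^ j * μ (Iic x) ≤ L} ≤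
      ((2 : ℝ≥0∞) ^ (-1 : ℝ)) ^ j * L := by
    intro j
    refine (Measure.restrict_apply_le _ _).trans ?_
    refine measure_le_of_forall_Iic_le μ _ _ fun e he => ?_
    have he' : 2 ^ j * μ (Iic e) ≤ L := he
    rw [ENNReal.rpow_neg_one, ← ENNReal.inv_pow, mul_comm, ← div_eq_mul_inv,
      ENNReal.le_div_iff_mul_le (Or.inl (by simp)) (Or.inl (by simp)), mul_comm]
    exact he'
  calc ∫⁻ x in E, μ (Iic x) ^ (-γ) ∂μ
      ≤ ∫⁻ x in E, (L ^ (-γ) + ∑' j : ℕ, {x : α | 2 ^ j * μ (Iic x) ≤ L}.indicator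
          (fun _ => 2 ^ γ * ((2 : ℝ≥0∞) ^ γ) ^ j * L ^ (-γ)) x) ∂μ := by
        refine lintegral_mono_ae ?_
        filter_upwards [ae_restrict_of_ae (ae_measure_Iic_ne_zero μ)] with x hx
        exact hpt _ hx
    _ = L ^ (-γ) * L + ∑' j : ℕ, (2 ^ γ * ((2 : ℝ≥0∞) ^ γ) ^ j * L ^ (-γ)) *
          μ.restrict E {x | 2 ^ j * μ (Iic x) ≤ L} := by
        rw [lintegral_add_left measurable_const, setLIntegral_const, lintegral_tsum]
        · congr 1
          refine tsum_congr fun j => ?_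
          rw [lintegral_indicator_const (hms j)]
        · exact fun j => (measurable_const.indicator (hms j)).aemeasurable
    _ ≤ L ^ (-γ) * L + ∑' j : ℕ, (2 ^ γ * ((2 : ℝ≥0∞) ^ γ) ^ j * L ^ (-γ)) *
          (((2 : ℝ≥0∞) ^ (-1 : ℝ)) ^ j * L) := by
        gcongr with j
        exact hmeas j
    _ = (1 + 2 ^ γ * ∑' j : ℕ, ((2 : ℝ≥0∞) ^ (γ - 1)) ^ j) * L ^ (1 - γ) := by
        have hLL : L ^ (-γ) * L = L ^ (1 - γ) := by
          conv_lhs => rw [← ENNReal.rpow_one L, ← ENNReal.rpow_mul, one_mul,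
            ← ENNReal.rpow_add _ _ hL0 hLt]
          congr 1; ring
        rw [add_mul, one_mul, hLL, mul_assoc (2 ^ γ), ← ENNReal.tsum_mul_right,
          ← ENNReal.tsum_mul_left]
        congr 1
        refine tsum_congr fun j => ?_
        rw [sub_eq_add_neg γ 1, ENNReal.rpow_add _ _ (by norm_num) (by norm_num), mul_pow, ← hLL]
        ring

/-- A substitute, for measures with atoms, of `∫ₘ^∞ s ^ (-1 - δ) ds = m ^ (-δ) / δ`. -/
theorem exists_setLIntegral_Ici_rpow_le {δ : ℝ} (hδ : 0 < δ) :
    ∃ C : ℝ≥0∞, C ≠ ∞ ∧ ∀ (μ : Measure α) (y : α),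
      ∫⁻ x in Ici y, μ (Iic x) ^ (-1 - δ) ∂μ ≤ C * μ (Iic y) ^ (-δ) := by
  refine ⟨2 * ∑' j : ℕ, ((2 : ℝ≥0∞) ^ (-δ)) ^ j, ?_, fun μ y => ?_⟩
  · exact ENNReal.mul_ne_top (by norm_num) (tsum_geometric_ne_top (two_rpow_lt_one (by linarith)))
  set m := μ (Iic y) with hm
  by_cases hm0 : m = 0
  · rw [hm0, ENNReal.zero_rpow_of_neg (by linarith), ENNReal.mul_top]
    · exact le_top
    · refine mul_ne_zero (by norm_num) ?_
      rw [ENNReal.tsum_geometric]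
      exact ENNReal.inv_ne_zero.2 (by simp)
  have hmono : ∀ x ∈ Ici y, m ≤ μ (Iic x) := fun x hx => monotone_measure_Iic μ hx
  by_cases hmt : m = ∞
  · rw [setLIntegral_congr_fun (g := fun _ => 0) measurableSet_Ici]
    · simp
    · intro x hx
      have := hmono x hx
      rw [hmt, top_le_iff] at this
      simp only [this]
      exact ENNReal.top_rpow_of_neg (by linarith)
  -- the blocks are now `2 ^ j m ≤ z ≤ 2 ^ (j + 1) m`
  have hpt : ∀ z : ℝ≥0∞, m ≤ z → z ^ (-1 - δ) ≤ ∑' j : ℕ,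
      {z : ℝ≥0∞ | z ≤ 2 ^ (j + 1) * m}.indicator
        (fun _ => ((2 : ℝ≥0∞) ^ (-1 - δ)) ^ j * m ^ (-1 - δ)) z := by
    intro z hz
    by_cases hzt : z = ∞
    · rw [hzt, ENNReal.top_rpow_of_neg (by linarith)]; exact zero_le
    obtain ⟨j, hj1, hj2⟩ := exists_two_pow_mul_le hm0 hzt hz
    refine le_trans ?_ (ENNReal.le_tsum j)
    have hj2' : z ∈ {z : ℝ≥0∞ | z ≤ 2 ^ (j + 1) * m} := hj2
    rw [indicator_of_mem hj2', ← two_pow_rpow, ← ENNReal.mul_rpow_of_ne_top (by simp) hmt]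
    rw [show -1 - δ = -(1 + δ) by ring, ENNReal.rpow_neg, ENNReal.rpow_neg]
    exact ENNReal.inv_le_inv.2 (ENNReal.rpow_le_rpow hj1 (by linarith))
  have hms : ∀ j : ℕ, MeasurableSet {x : α | μ (Iic x) ≤ 2 ^ (j + 1) * m} := fun j =>
    measurableSet_le (measurable_measure_Iic μ) measurable_const
  calc ∫⁻ x in Ici y, μ (Iic x) ^ (-1 - δ) ∂μ
      ≤ ∫⁻ x in Ici y, ∑' j : ℕ, {x : α | μ (Iic x) ≤ 2 ^ (j + 1) * m}.indicator
          (fun _ => ((2 : ℝ≥0∞) ^ (-1 - δ)) ^ j * m ^ (-1 - δ)) x ∂μ :=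
        setLIntegral_mono' measurableSet_Ici fun x hx => hpt _ (hmono x hx)
    _ ≤ ∫⁻ x, ∑' j : ℕ, {x : α | μ (Iic x) ≤ 2 ^ (j + 1) * m}.indicator
          (fun _ => ((2 : ℝ≥0∞) ^ (-1 - δ)) ^ j * m ^ (-1 - δ)) x ∂μ :=
        setLIntegral_le_lintegral _ _
    _ = ∑' j : ℕ, ((2 : ℝ≥0∞) ^ (-1 - δ)) ^ j * m ^ (-1 - δ) *
          μ {x | μ (Iic x) ≤ 2 ^ (j + 1) * m} := by
        rw [lintegral_tsum]
        · exact tsum_congr fun j => lintegral_indicator_const (hms j) _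
        · exact fun j => (measurable_const.indicator (hms j)).aemeasurable
    _ ≤ ∑' j : ℕ, ((2 : ℝ≥0∞) ^ (-1 - δ)) ^ j * m ^ (-1 - δ) * (2 ^ (j + 1) * m) := by
        gcongr with j
        exact measure_le_of_forall_Iic_le μ _ _ fun e he => he
    _ = (2 * ∑' j : ℕ, ((2 : ℝ≥0∞) ^ (-δ)) ^ j) * m ^ (-δ) := by
        have hmm : m ^ (-δ) = m ^ (-1 - δ) * m := by
          conv_rhs => rw [← ENNReal.rpow_one m, ← ENNReal.rpow_mul, one_mul,
            ← ENNReal.rpow_add _ _ hm0 hmt]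
          congr 1; ring
        have h2 : (2 : ℝ≥0∞) ^ (-δ) = 2 ^ (-1 - δ) * 2 := by
          conv_rhs => rw [← ENNReal.rpow_one 2, ← ENNReal.rpow_mul, one_mul,
            ← ENNReal.rpow_add _ _ (by norm_num) (by norm_num)]
          congr 1; ring
        rw [← ENNReal.tsum_mul_left, ← ENNReal.tsum_mul_right]
        refine tsum_congr fun j => ?_
        rw [hmm, h2, mul_pow, pow_succ]
        ring

end Order

/-! ### Duality, Minkowski's inequality and series -/

/-- A finite quantity which is estimated by a smaller power of itself can be absorbed. -/
theorem rpow_le_of_le_mul_rpow {x c : ℝ≥0∞} {s t : ℝ} (hx : x ≠ ∞) (hs : 0 ≤ s) (ht : 0 < t)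
    (hst : s + t = 1) (h : x ≤ c * x ^ s) : x ^ t ≤ c := by
  by_cases h0 : x = 0
  · rw [h0, ENNReal.zero_rpow_of_pos ht]; exact zero_le
  have hs0 : x ^ s ≠ 0 := (ENNReal.rpow_pos (pos_iff_ne_zero.2 h0) hx).ne'
  have hst' : x ^ s ≠ ∞ := ENNReal.rpow_ne_top_of_nonneg hs hx
  rw [← ENNReal.mul_le_mul_iff_left hs0 hst', ← ENNReal.rpow_add _ _ h0 hx, add_comm, hst,
    ENNReal.rpow_one]
  exact h

/-- Converse of Hölder's inequality. -/
theorem lintegral_rpow_le_of_forall_lintegral_mul_le {α : Type*} [MeasurableSpace α]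
    {σ : Measure α} [SigmaFinite σ] {p p' : ℝ} (hp : p.HolderConjugate p') {g : α → ℝ≥0∞}
    (hg : Measurable g) {c : ℝ≥0∞}
    (h : ∀ f : α → ℝ≥0∞, Measurable f → ∫⁻ x, f x ^ p ∂σ ≠ ∞ →
      ∫⁻ x, f x * g x ∂σ ≤ c * (∫⁻ x, f x ^ p ∂σ) ^ (1 / p)) :
    (∫⁻ x, g x ^ p' ∂σ) ^ (1 / p') ≤ c := by
  have hp0 := hp.pos
  have hp'0 := hp.symm.pos
  have hp'1 := hp.symm.lt
  -- the truncations `G n` have finite norm, so that testing with `G n ^ (p' - 1)` gives a bound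
  set G : ℕ → α → ℝ≥0∞ := fun n => (spanningSets σ n).indicator fun x => min (g x) n with hG
  have hGm : ∀ n, Measurable (G n) := fun n =>
    (hg.min measurable_const).indicator (measurableSet_spanningSets σ n)
  have hGle : ∀ n x, G n x ≤ g x := fun n x =>
    (indicator_le_self _ _ x).trans (min_le_left _ _)
  have hmono : Monotone fun n x => G n x ^ p' := by
    intro m n hmn x
    refine ENNReal.rpow_le_rpow ?_ hp'0.le
    have h1 : G m x ≤ (spanningSets σ m).indicator (fun x => min (g x) n) x := by
      refine indicator_le_indicator (min_le_min_left _ ?_)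
      exact_mod_cast hmn
    exact h1.trans (indicator_le_indicator_of_subset (monotone_spanningSets σ hmn)
      (fun _ => zero_le) x)
  have hlim : ∀ x, Tendsto (fun n => G n x ^ p') atTop (𝓝 (g x ^ p')) := by
    intro x
    refine (ENNReal.continuous_rpow_const.tendsto _).comp ?_
    have h1 : Tendsto (fun n : ℕ => min (g x) (n : ℝ≥0∞)) atTop (𝓝 (min (g x) ∞)) :=
      tendsto_const_nhds.min ENNReal.tendsto_nat_nhds_top
    rw [min_eq_left le_top] at h1
    refine h1.congr' ?_
    filter_upwards [eventually_ge_atTop (spanningSetsIndex σ x)] with n hn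
    rw [hG]
    simp only
    rw [indicator_of_mem]
    exact monotone_spanningSets σ hn (mem_spanningSetsIndex σ x)
  have hbound : ∀ n, (∫⁻ x, G n x ^ p' ∂σ) ^ (1 / p') ≤ c := by
    intro n
    have hfin : ∫⁻ x, G n x ^ p' ∂σ ≠ ∞ := by
      have h1 : ∫⁻ x, G n x ^ p' ∂σ ≤ ∫⁻ x in spanningSets σ n, (n : ℝ≥0∞) ^ p' ∂σ := by
        rw [← lintegral_indicator (measurableSet_spanningSets σ n)]
        refine lintegral_mono fun x => ?_
        by_cases hx : x ∈ spanningSets σ n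
        · rw [indicator_of_mem hx]
          refine ENNReal.rpow_le_rpow ?_ hp'0.le
          simp only [hG, indicator_of_mem hx]
          exact min_le_right _ _
        · simp [hG, indicator_of_notMem hx, hp'0]
      refine (h1.trans_lt ?_).ne
      rw [setLIntegral_const]
      exact ENNReal.mul_lt_top (ENNReal.rpow_lt_top_of_nonneg hp'0.le (ENNReal.natCast_ne_top n))
        (measure_spanningSets_lt_top σ n)
    have hpow : ∀ x, (G n x ^ (p' - 1)) ^ p = G n x ^ p' := fun x => by
      rw [← ENNReal.rpow_mul]
      congr 1
      have := hp.symm.sub_one_mul_conj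
      linarith
    have h2 := h (fun x => G n x ^ (p' - 1)) ((hGm n).pow_const _) (by simpa only [hpow] using hfin)
    simp only [hpow] at h2
    have h3 : ∫⁻ x, G n x ^ p' ∂σ ≤ ∫⁻ x, G n x ^ (p' - 1) * g x ∂σ := by
      refine lintegral_mono fun x => ?_
      calc G n x ^ p' = G n x ^ (p' - 1) * G n x ^ (1 : ℝ) := by
            rw [← ENNReal.rpow_add_of_nonneg _ _ (by linarith) (by norm_num)]; congr 1; ring
        _ ≤ _ := by rw [ENNReal.rpow_one]; exact mul_le_mul_right (hGle n x) _
    refine rpow_le_of_le_mul_rpow hfin (by positivity) (by positivity) ?_ (h3.trans h2)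
    have := hp.inv_add_inv_eq_one
    simpa [one_div] using this
  have hT := lintegral_tendsto_of_tendsto_of_monotone (μ := σ)
    (fun n => ((hGm n).pow_const p').aemeasurable) (ae_of_all _ fun x => fun m n hmn => hmono hmn x)
    (ae_of_all _ hlim)
  exact le_of_tendsto ((ENNReal.continuous_rpow_const.tendsto _).comp hT)
    (Eventually.of_forall hbound)

/-- Minkowski's integral inequality. -/
theorem minkowski_lintegral {α β : Type*} [MeasurableSpace α] [MeasurableSpace β]
    {σ : Measure α} [SigmaFinite σ] {μ : Measure β} [SFinite μ] {p p' : ℝ}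
    (hp : p.HolderConjugate p') {K : α → β → ℝ≥0∞} (hK : Measurable (Function.uncurry K)) :
    (∫⁻ x, (∫⁻ y, K x y ∂μ) ^ p ∂σ) ^ (1 / p) ≤ ∫⁻ y, (∫⁻ x, K x y ^ p ∂σ) ^ (1 / p) ∂μ := by
  refine lintegral_rpow_le_of_forall_lintegral_mul_le hp.symm hK.lintegral_prod_right' ?_
  intro f hf _
  have hKx : ∀ x, Measurable (K x) := fun x => hK.of_uncurry_left
  have hKy : ∀ y, Measurable fun x => K x y := fun y => hK.of_uncurry_right
  calc ∫⁻ x, f x * ∫⁻ y, K x y ∂μ ∂σ = ∫⁻ x, ∫⁻ y, f x * K x y ∂μ ∂σ :=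
        lintegral_congr fun x => (lintegral_const_mul _ (hKx x)).symm
    _ = ∫⁻ y, ∫⁻ x, f x * K x y ∂σ ∂μ :=
        lintegral_lintegral_swap ((hf.comp measurable_fst).mul hK).aemeasurable
    _ ≤ ∫⁻ y, (∫⁻ x, f x ^ p' ∂σ) ^ (1 / p') * (∫⁻ x, K x y ^ p ∂σ) ^ (1 / p) ∂μ :=
        lintegral_mono fun y => ENNReal.lintegral_mul_le_Lp_mul_Lq σ hp.symm hf.aemeasurable
          (hKy y).aemeasurable
    _ = _ := by
        rw [lintegral_const_mul, mul_comm]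
        exact ((hK.pow_const p).lintegral_prod_left' (μ := σ)).pow_const _

/-- Hölder's inequality for three functions. -/
theorem lintegral_mul_mul_le {α : Type*} [MeasurableSpace α] {μ : Measure α} {f g h : α → ℝ≥0∞}
    (hf : AEMeasurable f μ) (hg : AEMeasurable g μ) (hh : AEMeasurable h μ) {a b c : ℝ}
    (ha : 0 ≤ a) (hb : 0 ≤ b) (hc : 0 ≤ c) (habc : a + b + c = 1) :
    ∫⁻ x, f x ^ a * g x ^ b * h x ^ c ∂μ ≤
      (∫⁻ x, f x ∂μ) ^ a * (∫⁻ x, g x ∂μ) ^ b * (∫⁻ x, h x ∂μ) ^ c := by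
  have := ENNReal.lintegral_prod_norm_pow_le (μ := μ) (Finset.univ : Finset (Fin 3))
    (f := ![f, g, h]) (p := ![a, b, c]) (by intro i _; fin_cases i <;> assumption)
    (by simpa [Fin.sum_univ_three] using habc) (by intro i _; fin_cases i <;> assumption)
  simpa [Fin.prod_univ_three] using this

/-- Hölder's inequality for series. -/
theorem tsum_mul_rpow_le {ι : Type*} (e j : ι → ℝ≥0∞) {a b : ℝ} (ha : 0 ≤ a) (hb : 0 ≤ b)
    (hab : a + b = 1) :
    ∑' n, e n ^ a * j n ^ b ≤ (∑' n, e n) ^ a * (∑' n, j n) ^ b := by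
  let _ : MeasurableSpace ι := ⊤
  have := ENNReal.lintegral_mul_norm_pow_le (μ := Measure.count (α := ι)) (f := e) (g := j)
    measurable_from_top.aemeasurable measurable_from_top.aemeasurable ha hb hab
  simpa [lintegral_count] using this

theorem tsum_rpow_le {ι : Type*} (e : ι → ℝ≥0∞) {s : ℝ} (hs : 1 ≤ s) :
    ∑' n, e n ^ s ≤ (∑' n, e n) ^ s := by
  calc ∑' n, e n ^ s ≤ ∑' n, e n * (∑' n, e n) ^ (s - 1) := by
        refine ENNReal.tsum_le_tsum fun n => ?_
        calc e n ^ s = e n ^ (1 : ℝ) * e n ^ (s - 1) := by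
              rw [← ENNReal.rpow_add_of_nonneg _ _ (by norm_num) (by linarith)]; congr 1; ring
          _ ≤ _ := by
              rw [ENNReal.rpow_one]
              exact mul_le_mul_right (ENNReal.rpow_le_rpow (ENNReal.le_tsum n) (by linarith)) _
    _ = (∑' n, e n) ^ (1 : ℝ) * (∑' n, e n) ^ (s - 1) := by
        rw [ENNReal.tsum_mul_right, ENNReal.rpow_one]
    _ = _ := by
        rw [← ENNReal.rpow_add_of_nonneg _ _ (by norm_num) (by linarith)]; congr 1; ring

/-! ### Hardy's inequality for averages -/

theorem monotone_setLIntegral_Iic {α : Type*} [Preorder α] [MeasurableSpace α] (μ : Measure α)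
    (f : α → ℝ≥0∞) : Monotone fun x => ∫⁻ y in Iic x, f y ∂μ :=
  fun _ _ h => lintegral_mono_set (Iic_subset_Iic.2 h)

/-- A primitive is measurable, as it is monotone: `f` is arbitrary. -/
theorem measurable_setLIntegral_Iic' {α : Type*} [LinearOrder α] [TopologicalSpace α]
    [OrderTopology α] [MeasurableSpace α] [BorelSpace α] (μ : Measure α) (f : α → ℝ≥0∞) :
    Measurable fun x => ∫⁻ y in Iic x, f y ∂μ :=
  (monotone_setLIntegral_Iic μ f).measurable

section Order

variable {α : Type*} [LinearOrder α] [TopologicalSpace α] [OrderTopology α]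
  [SecondCountableTopology α] [MeasurableSpace α] [BorelSpace α]

theorem measurable_setLIntegral_Iic {μ : Measure α} [SFinite μ] {G : α → α → ℝ≥0∞}
    (hG : Measurable (Function.uncurry G)) : Measurable fun x => ∫⁻ y in Iic x, G x y ∂μ := by
  have h : ∀ x, ∫⁻ y in Iic x, G x y ∂μ =
      ∫⁻ y, {z : α × α | z.2 ≤ z.1}.indicator (Function.uncurry G) (x, y) ∂μ := fun x => by
    rw [← lintegral_indicator measurableSet_Iic]; rfl
  simp only [h]
  exact (hG.indicator (measurableSet_le measurable_snd measurable_fst)).lintegral_prod_right'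

theorem measurable_setLIntegral_Ici {μ : Measure α} [SFinite μ] {G : α → α → ℝ≥0∞}
    (hG : Measurable (Function.uncurry G)) : Measurable fun x => ∫⁻ y in Ici x, G x y ∂μ :=
  have : @SFinite αᵒᵈ _ μ := ‹SFinite μ›
  measurable_setLIntegral_Iic (α := αᵒᵈ) (μ := μ) hG

/-- Tonelli's theorem on the triangle `y ≤ x`. -/
theorem lintegral_setLIntegral_Iic_swap {μ ν : Measure α} [SFinite μ] [SFinite ν]
    {G : α → α → ℝ≥0∞} (hG : Measurable (Function.uncurry G)) :
    ∫⁻ x, ∫⁻ y in Iic x, G x y ∂μ ∂ν = ∫⁻ y, ∫⁻ x in Ici y, G x y ∂ν ∂μ := by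
  have h1 : ∀ x, ∫⁻ y in Iic x, G x y ∂μ =
      ∫⁻ y, {z : α × α | z.2 ≤ z.1}.indicator (Function.uncurry G) (x, y) ∂μ := fun x => by
    rw [← lintegral_indicator measurableSet_Iic]; rfl
  have h2 : ∀ y, ∫⁻ x in Ici y, G x y ∂ν =
      ∫⁻ x, {z : α × α | z.2 ≤ z.1}.indicator (Function.uncurry G) (x, y) ∂ν := fun y => by
    rw [← lintegral_indicator measurableSet_Ici]; rfl
  simp only [h1, h2]
  exact lintegral_lintegral_swap
    (hG.indicator (measurableSet_le measurable_snd measurable_fst)).aemeasurable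

/-- The form of `rpow_measure_univ_le` for the final segment `[y, ∞)`, on the dual order. -/
theorem rpow_measure_Ici_le (ν : Measure α) (y : α) {β : ℝ} (hβ : 1 ≤ β) :
    ν (Ici y) ^ β ≤ 2 ^ β * ∫⁻ x in Ici y, ν (Ici x) ^ (β - 1) ∂ν := by
  have h := rpow_setLIntegral_le (α := αᵒᵈ) ν (Ici y : Set α) (f := fun _ => 1) measurable_const hβ
  have h1 : ∀ s : Set α, ∫⁻ _ in s, 1 ∂ν = ν s := fun s => setLIntegral_one s
  simp only [one_mul] at h
  rw [← h1 (Ici y)]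
  simp only [← h1 (Ici _)]
  exact h

theorem rpow_mul_rpow_neg_le_one (z : ℝ≥0∞) {δ : ℝ} (hδ : 0 < δ) : z ^ δ * z ^ (-δ) ≤ 1 := by
  by_cases h0 : z = 0
  · simp [h0, hδ]
  by_cases ht : z = ∞
  · simp [ht, hδ]
  rw [← ENNReal.rpow_add _ _ h0 ht]; simp

/-- Hölder's inequality against the constant `1` on `E`. -/
theorem setLIntegral_rpow_holder {α : Type*} [MeasurableSpace α] (μ : Measure α) {p p' : ℝ}
    (hp : p.HolderConjugate p') {f : α → ℝ≥0∞} (hf : AEMeasurable f μ) (E : Set α) :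
    ∫⁻ y in E, f y ∂μ ≤ (∫⁻ y in E, f y ^ p ∂μ) ^ (1 / p) * μ E ^ (1 / p') := by
  have := ENNReal.lintegral_mul_le_Lp_mul_Lq (μ.restrict E) hp hf.restrict
    (aemeasurable_const (b := 1))
  simpa using this

/-- Hardy's inequality for averages with respect to an arbitrary measure. With `M x = μ (Iic x)`,
Hölder's inequality for `f = (f M ^ (1 / (2 p'))) M ^ (-1 / (2 p'))` and Tonelli's theorem reduce
it to the integrals of negative powers of `M`. -/
theorem exists_lintegral_average_rpow_le {p p' : ℝ} (hp : p.HolderConjugate p') :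
    ∃ C : ℝ≥0∞, C ≠ ∞ ∧ ∀ (μ : Measure α) [SFinite μ] (f : α → ℝ≥0∞), Measurable f →
      ∫⁻ x, ((∫⁻ y in Iic x, f y ∂μ) * (μ (Iic x))⁻¹) ^ p ∂μ ≤ C * ∫⁻ x, f x ^ p ∂μ := by
  have hp0 := hp.pos
  have hp1 := hp.lt
  have hp'0 := hp.symm.pos
  obtain ⟨C₁, hC₁, h₁⟩ := exists_setLIntegral_rpow_neg_le (α := α) (γ := 1 / 2) (by norm_num)
    (by norm_num)
  obtain ⟨C₂, hC₂, h₂⟩ := exists_setLIntegral_Ici_rpow_le (α := α) (δ := (p - 1) / 2)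
    (by linarith)
  refine ⟨C₁ ^ (p - 1) * C₂, ENNReal.mul_ne_top
    (ENNReal.rpow_ne_top_of_nonneg (by linarith) hC₁) hC₂, fun μ _ f hf => ?_⟩
  set M : α → ℝ≥0∞ := fun x => μ (Iic x) with hM
  have hMm : Measurable M := measurable_measure_Iic μ
  set δ := (p - 1) / 2 with hδ
  have hδ0 : 0 < δ := by rw [hδ]; linarith
  have hpp : p / p' = p - 1 := hp.div_conj_eq_sub_one
  have hpt : ∀ x, ((∫⁻ y in Iic x, f y ∂μ) * (M x)⁻¹) ^ p ≤
      ∫⁻ y in Iic x, C₁ ^ (p - 1) * (f y ^ p * M y ^ δ * M x ^ (-1 - δ)) ∂μ := by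
    intro x
    -- the average is `0` where the mass is infinite
    by_cases hx : M x = ∞
    · rw [hx]; simp [hp0]
    have hmul : ∀ y ∈ Iic x, μ (Iic y) ≠ 0 →
        f y = (f y * M y ^ (1 / (2 * p'))) * M y ^ (-(1 / (2 * p'))) := fun y hy h0 => by
      have hyt : M y ≠ ∞ := ((monotone_measure_Iic μ hy).trans_lt (lt_top_iff_ne_top.2 hx)).ne
      rw [mul_assoc, ← ENNReal.rpow_add _ _ h0 hyt]; simp
    have hF : ∫⁻ y in Iic x, f y ∂μ ≤
        (∫⁻ y in Iic x, f y ^ p * M y ^ δ ∂μ) ^ (1 / p) * (C₁ * M x ^ (1 / 2 : ℝ)) ^ (1 / p') := by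
      calc ∫⁻ y in Iic x, f y ∂μ
          = ∫⁻ y in Iic x, (f y * M y ^ (1 / (2 * p'))) * M y ^ (-(1 / (2 * p'))) ∂μ := by
            refine lintegral_congr_ae ?_
            filter_upwards [ae_restrict_mem measurableSet_Iic,
              ae_restrict_of_ae (ae_measure_Iic_ne_zero μ)] with y hy h0
            exact hmul y hy h0
        _ ≤ _ := ENNReal.lintegral_mul_le_Lp_mul_Lq _ hp
            (hf.mul (hMm.pow_const _)).aemeasurable (hMm.pow_const _).aemeasurable
        _ ≤ _ := by
            gcongr
            · refine le_of_eq ?_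
              rw [ENNReal.mul_rpow_of_nonneg _ _ hp0.le, ← ENNReal.rpow_mul]
              congr 2
              rw [hδ, ← hpp]; field_simp
            · refine le_trans (le_of_eq (lintegral_congr fun y => ?_))
                ((h₁ μ (Iic x)).trans (le_of_eq (by norm_num [hM])))
              rw [← ENNReal.rpow_mul]
              congr 1; field_simp
    calc ((∫⁻ y in Iic x, f y ∂μ) * (M x)⁻¹) ^ p
        ≤ ((∫⁻ y in Iic x, f y ^ p * M y ^ δ ∂μ) ^ (1 / p) *
            (C₁ * M x ^ (1 / 2 : ℝ)) ^ (1 / p') * (M x)⁻¹) ^ p := by gcongr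
      _ = C₁ ^ (p - 1) * ((∫⁻ y in Iic x, f y ^ p * M y ^ δ ∂μ) * M x ^ (-1 - δ)) := by
          by_cases hx0 : M x = 0
          · have : ∫⁻ y in Iic x, f y ^ p * M y ^ δ ∂μ = 0 :=
              setLIntegral_measure_zero _ _ hx0
            rw [this, ENNReal.zero_rpow_of_pos (by positivity)]
            simp [hp0]
          rw [ENNReal.mul_rpow_of_nonneg _ _ hp0.le, ENNReal.mul_rpow_of_nonneg _ _ hp0.le,
            ← ENNReal.rpow_mul, ← ENNReal.rpow_mul, one_div_mul_cancel hp0.ne', ENNReal.rpow_one,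
            ENNReal.mul_rpow_of_nonneg _ _ (by positivity), ← ENNReal.rpow_mul,
            one_div_mul_eq_div, hpp, ← ENNReal.rpow_neg_one, ← ENNReal.rpow_mul]
          have : M x ^ (1 / 2 * (p - 1)) * M x ^ (-1 * p) = M x ^ (-1 - δ) := by
            rw [← ENNReal.rpow_add _ _ hx0 hx]; congr 1; rw [hδ]; ring
          rw [← this]; ring
      _ = _ := by
          rw [lintegral_const_mul, lintegral_mul_const]
          · exact (hf.pow_const _).mul (hMm.pow_const _)
          · exact ((hf.pow_const _).mul (hMm.pow_const _)).mul_const _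
  refine (lintegral_mono hpt).trans ?_
  rw [lintegral_setLIntegral_Iic_swap (G := fun x y =>
    C₁ ^ (p - 1) * (f y ^ p * M y ^ δ * M x ^ (-1 - δ)))]
  · rw [mul_assoc, ← lintegral_const_mul _ (hf.pow_const _), ← lintegral_const_mul]
    · refine lintegral_mono fun y => ?_
      rw [lintegral_const_mul _ ((hMm.pow_const _).const_mul _),
        lintegral_const_mul _ (hMm.pow_const _)]
      refine mul_le_mul_right ?_ _
      calc f y ^ p * M y ^ δ * ∫⁻ x in Ici y, M x ^ (-1 - δ) ∂μ
          ≤ f y ^ p * M y ^ δ * (C₂ * M y ^ (-δ)) := mul_le_mul_right (h₂ μ y) _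
        _ = C₂ * f y ^ p * (M y ^ δ * M y ^ (-δ)) := by ring
        _ ≤ C₂ * f y ^ p * 1 := mul_le_mul_right (rpow_mul_rpow_neg_le_one _ hδ0) _
        _ = _ := mul_one _
    · exact (hf.pow_const _).const_mul _
  · have h1 : Measurable fun z : α × α => f z.2 := hf.comp measurable_snd
    have h2 : Measurable fun z : α × α => M z.2 := hMm.comp measurable_snd
    have h3 : Measurable fun z : α × α => M z.1 := hMm.comp measurable_fst
    exact (((h1.pow_const _).mul (h2.pow_const _)).mul (h3.pow_const _)).const_mul _

end Order

/-! ### Hardy's inequality with two measures -/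

/-- The relations between the exponents in the case `q < p`. -/
theorem exponent_relations {p p' q q' r : ℝ} (hp : p.HolderConjugate p')
    (hq : q.HolderConjugate q') (hqp : q < p) (hr : 1 / r = 1 / q - 1 / p) :
    0 < r ∧ r / p + 1 = r / q ∧ r / q' + 1 = r / p' ∧ q / p + q / r = 1 ∧
      r / q' * (q / r) = q - 1 := by
  have hp0 := hp.pos
  have hq0 := hq.pos
  have hr0 : 0 < r := by
    rw [← one_div_pos, hr, sub_pos]
    exact one_div_lt_one_div_of_lt hq0 hqp
  have h1 : 1 / p' = 1 - 1 / p := by rw [one_div, one_div, hp.one_sub_inv]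
  have h2 : 1 / q' = 1 - 1 / q := by rw [one_div, one_div, hq.one_sub_inv]
  have h3 : r * (1 / r) = 1 := by field_simp
  have h4 : q * (1 / q) = 1 := by field_simp
  refine ⟨hr0, ?_, ?_, ?_, ?_⟩
  · rw [div_eq_mul_one_div r p, div_eq_mul_one_div r q]; linear_combination -h3 + r * hr
  · rw [div_eq_mul_one_div r q', div_eq_mul_one_div r p', h1, h2]; linear_combination -h3 + r * hr
  · rw [div_eq_mul_one_div q p, div_eq_mul_one_div q r, hr]; linear_combination h4
  · rw [div_eq_mul_one_div r q', h2, div_eq_mul_one_div q r]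
    linear_combination (1 - 1 / q) * q * h3 - h4

section Order

variable {α : Type*} [LinearOrder α] [TopologicalSpace α] [OrderTopology α]
  [SecondCountableTopology α] [MeasurableSpace α] [BorelSpace α]

/-- With `F(x) = ∫_{y ≤ x} f dμ`, the functional `∫ f F ^ (q - 1) V dμ` is what remains of
`∫ F ^ q dν` after integration by parts, `V` being the tail of `ν`. -/
theorem exists_lintegral_mul_rpow_mul_le_of_le {p p' q : ℝ} (hp : p.HolderConjugate p')
    (hpq : p ≤ q) :
    ∃ C : ℝ≥0∞, C ≠ ∞ ∧ ∀ (μ : Measure α) [SFinite μ] (f V : α → ℝ≥0∞) (B : ℝ≥0∞),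
      Measurable f → Measurable V → B ≠ ∞ → (∀ᵐ x ∂μ, μ (Iic x) ^ (q / p') * V x ≤ B) →
      ∫⁻ x, f x * (∫⁻ y in Iic x, f y ∂μ) ^ (q - 1) * V x ∂μ ≤
        C * B * (∫⁻ x, f x ^ p ∂μ) ^ (q / p) := by
  have hp0 := hp.pos
  have hp1 := hp.lt
  have hp'0 := hp.symm.pos
  have hq0 : 0 < q := hp0.trans_le hpq
  obtain ⟨C, hC, h⟩ := exists_lintegral_average_rpow_le (α := α) hp
  refine ⟨C ^ (1 / p'), ENNReal.rpow_ne_top_of_nonneg (by positivity) hC,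
    fun μ _ f V B hf hV hB hMV => ?_⟩
  set M : α → ℝ≥0∞ := fun x => μ (Iic x) with hM
  have hMm : Measurable M := measurable_measure_Iic μ
  set F : α → ℝ≥0∞ := fun x => ∫⁻ y in Iic x, f y ∂μ with hF
  have hFm : Measurable F := measurable_setLIntegral_Iic' μ f
  set Q := ∫⁻ x, f x ^ p ∂μ with hQ
  have hpp : p / p' = p - 1 := hp.div_conj_eq_sub_one
  have hFQ : ∀ x, F x ≤ Q ^ (1 / p) * M x ^ (1 / p') := fun x =>
    (setLIntegral_rpow_holder μ hp hf.aemeasurable (Iic x)).trans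
      (mul_le_mul_left (ENNReal.rpow_le_rpow (setLIntegral_le_lintegral _ _) (by positivity)) _)
  have hpt : ∀ᵐ x ∂μ, f x * F x ^ (q - 1) * V x ≤
      B * Q ^ ((q - p) / p) * (f x * (F x * (M x)⁻¹) ^ (p - 1)) := by
    filter_upwards [hMV, ae_measure_Iic_ne_zero μ] with x hx hx0
    -- where the mass is infinite, finiteness of `B` forces `V x = 0`
    by_cases hxt : M x = ∞
    · have hxt' : μ (Iic x) = ∞ := hxt
      have : V x = 0 := by
        by_contra hV0
        rw [hxt', ENNReal.top_rpow_of_pos (by positivity), ENNReal.top_mul hV0, top_le_iff] at hx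
        exact hB hx
      rw [this, mul_zero]; exact zero_le
    have hx0' : M x ≠ 0 := hx0
    -- the surplus power `F ^ (q - p)` is estimated by Hölder's inequality
    have h1 : F x ^ (q - 1) ≤ F x ^ (p - 1) * (Q ^ ((q - p) / p) * M x ^ ((q - p) / p')) := by
      calc F x ^ (q - 1) = F x ^ (p - 1) * F x ^ (q - p) := by
            rw [← ENNReal.rpow_add_of_nonneg _ _ (by linarith) (by linarith)]; congr 1; ring
        _ ≤ F x ^ (p - 1) * (Q ^ (1 / p) * M x ^ (1 / p')) ^ (q - p) := by
            exact mul_le_mul_right (ENNReal.rpow_le_rpow (hFQ x) (by linarith)) _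
        _ = _ := by
            rw [ENNReal.mul_rpow_of_nonneg _ _ (by linarith), ← ENNReal.rpow_mul,
              ← ENNReal.rpow_mul, one_div_mul_eq_div, one_div_mul_eq_div]
    have h2 : M x ^ ((q - p) / p') * V x ≤ B * ((M x)⁻¹) ^ (p - 1) := by
      have : M x ^ ((q - p) / p') = M x ^ (q / p') * ((M x)⁻¹) ^ (p - 1) := by
        rw [ENNReal.inv_rpow, ← ENNReal.rpow_neg, ← ENNReal.rpow_add _ _ hx0' hxt, sub_div, hpp]
        congr 1
      rw [this, mul_right_comm]
      exact mul_le_mul_left hx _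
    calc f x * F x ^ (q - 1) * V x
        ≤ f x * (F x ^ (p - 1) * (Q ^ ((q - p) / p) * M x ^ ((q - p) / p'))) * V x := by gcongr
      _ = f x * F x ^ (p - 1) * Q ^ ((q - p) / p) * (M x ^ ((q - p) / p') * V x) := by ring
      _ ≤ f x * F x ^ (p - 1) * Q ^ ((q - p) / p) * (B * ((M x)⁻¹) ^ (p - 1)) := by gcongr
      _ = _ := by rw [ENNReal.mul_rpow_of_nonneg _ _ (by linarith : 0 ≤ p - 1)]; ring
  have hGm : Measurable fun x => F x * (M x)⁻¹ := hFm.mul hMm.inv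
  calc ∫⁻ x, f x * F x ^ (q - 1) * V x ∂μ
      ≤ ∫⁻ x, B * Q ^ ((q - p) / p) * (f x * (F x * (M x)⁻¹) ^ (p - 1)) ∂μ :=
        lintegral_mono_ae hpt
    _ = B * Q ^ ((q - p) / p) * ∫⁻ x, f x * (F x * (M x)⁻¹) ^ (p - 1) ∂μ :=
        lintegral_const_mul _ (hf.mul (hGm.pow_const _))
    _ ≤ B * Q ^ ((q - p) / p) * (Q ^ (1 / p) * (C * Q) ^ (1 / p')) := by
        gcongr
        refine (ENNReal.lintegral_mul_le_Lp_mul_Lq μ hp hf.aemeasurable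
          (hGm.pow_const (p - 1)).aemeasurable).trans ?_
        gcongr
        refine le_trans (le_of_eq (lintegral_congr fun x => ?_)) (h μ f hf)
        rw [← ENNReal.rpow_mul, hp.sub_one_mul_conj]
    _ = C ^ (1 / p') * B * (Q ^ ((q - p) / p) * Q ^ (1 / p) * Q ^ (1 / p')) := by
        rw [ENNReal.mul_rpow_of_nonneg _ _ (by positivity)]; ring
    _ = _ := by
        have h1 : 0 ≤ (q - p) / p := div_nonneg (by linarith) hp0.le
        rw [← ENNReal.rpow_add_of_nonneg _ _ h1 (by positivity),
          ← ENNReal.rpow_add_of_nonneg _ _ (by positivity) (by positivity)]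
        congr 2
        have h2 : 1 / p + 1 / p' = 1 := by simpa using hp.inv_add_inv_eq_one
        rw [add_assoc, h2, sub_div, div_self hp0.ne']; ring

/-- The functional `∫ f F ^ (q - 1) V dμ` for `q < p`: Hölder's inequality with the exponents `p`,
`p / (q - 1)` and `r / q` for the functions `f`, `(F / M) ^ (q - 1)` and `V M ^ (q - 1)`, where
`M x = μ (Iic x)`. -/
theorem exists_lintegral_mul_rpow_mul_le_of_lt {p p' q q' r : ℝ} (hp : p.HolderConjugate p')
    (hq : q.HolderConjugate q') (hqp : q < p) (hr : 1 / r = 1 / q - 1 / p) :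
    ∃ C : ℝ≥0∞, C ≠ ∞ ∧ ∀ (μ : Measure α) [SFinite μ] (f V : α → ℝ≥0∞),
      Measurable f → Measurable V → ∫⁻ x, V x ^ (r / q) * μ (Iic x) ^ (r / q') ∂μ ≠ ∞ →
      ∫⁻ x, f x * (∫⁻ y in Iic x, f y ∂μ) ^ (q - 1) * V x ∂μ ≤
        C * (∫⁻ x, V x ^ (r / q) * μ (Iic x) ^ (r / q') ∂μ) ^ (q / r) *
          (∫⁻ x, f x ^ p ∂μ) ^ (q / p) := by
  obtain ⟨hr0, e1, e2, e3, e4⟩ := exponent_relations hp hq hqp hr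
  have hp0 := hp.pos
  have hq0 := hq.pos
  have hq1 := hq.lt
  have hq'0 := hq.symm.pos
  have hp'0 := hp.symm.pos
  obtain ⟨C, hC, h⟩ := exists_lintegral_average_rpow_le (α := α) hp
  have hq1p : 0 ≤ (q - 1) / p := div_nonneg (by linarith) hp0.le
  refine ⟨C ^ ((q - 1) / p), ENNReal.rpow_ne_top_of_nonneg hq1p hC,
    fun μ _ f V hf hV hJ => ?_⟩
  set M : α → ℝ≥0∞ := fun x => μ (Iic x) with hM
  have hMm : Measurable M := measurable_measure_Iic μ
  set F : α → ℝ≥0∞ := fun x => ∫⁻ y in Iic x, f y ∂μ with hF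
  have hFm : Measurable F := measurable_setLIntegral_Iic' μ f
  set Q := ∫⁻ x, f x ^ p ∂μ with hQ
  set J := ∫⁻ x, V x ^ (r / q) * M x ^ (r / q') ∂μ with hJdef
  have hGm : Measurable fun x => F x * (M x)⁻¹ := hFm.mul hMm.inv
  have hJm : Measurable fun x => V x ^ (r / q) * M x ^ (r / q') :=
    (hV.pow_const _).mul (hMm.pow_const _)
  have hpt : ∀ᵐ x ∂μ, f x * F x ^ (q - 1) * V x ≤
      (f x ^ p) ^ (1 / p) * ((F x * (M x)⁻¹) ^ p) ^ ((q - 1) / p) *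
        (V x ^ (r / q) * M x ^ (r / q')) ^ (q / r) := by
    filter_upwards [ae_lt_top hJm hJ, ae_measure_Iic_ne_zero μ] with x hx hx0
    -- where the mass is infinite, finiteness of `J` forces `V x = 0`
    by_cases hxt : M x = ∞
    · have : V x = 0 := by
        by_contra hV0
        rw [hxt, ENNReal.top_rpow_of_pos (by positivity), ENNReal.mul_top] at hx
        · exact lt_irrefl _ hx
        · simp only [ne_eq, ENNReal.rpow_eq_zero_iff, hV0, false_and, false_or, not_and, not_lt]
          exact fun _ => by positivity
      rw [this, mul_zero]; exact zero_le
    have hx0' : M x ≠ 0 := hx0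
    have h1 : r / q * (q / r) = 1 := by field_simp
    have h2 : p * ((q - 1) / p) = q - 1 := by field_simp
    rw [ENNReal.mul_rpow_of_nonneg _ _ (by positivity : 0 ≤ q / r), ← ENNReal.rpow_mul,
      ← ENNReal.rpow_mul, ← ENNReal.rpow_mul, ← ENNReal.rpow_mul, e4, h1, h2,
      mul_one_div_cancel hp0.ne', ENNReal.rpow_one, ENNReal.rpow_one,
      ENNReal.mul_rpow_of_nonneg _ _ (by linarith : 0 ≤ q - 1), ENNReal.inv_rpow]
    have h3 : (M x ^ (q - 1))⁻¹ * M x ^ (q - 1) = 1 := by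
      refine ENNReal.inv_mul_cancel ?_ ?_
      · exact (ENNReal.rpow_pos (pos_iff_ne_zero.2 hx0') hxt).ne'
      · exact ENNReal.rpow_ne_top_of_nonneg (by linarith) hxt
    calc f x * F x ^ (q - 1) * V x
        = f x * F x ^ (q - 1) * V x * ((M x ^ (q - 1))⁻¹ * M x ^ (q - 1)) := by rw [h3, mul_one]
      _ ≤ _ := le_of_eq (by ring)
  calc ∫⁻ x, f x * F x ^ (q - 1) * V x ∂μ
      ≤ ∫⁻ x, (f x ^ p) ^ (1 / p) * ((F x * (M x)⁻¹) ^ p) ^ ((q - 1) / p) *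
        (V x ^ (r / q) * M x ^ (r / q')) ^ (q / r) ∂μ := lintegral_mono_ae hpt
    _ ≤ Q ^ (1 / p) * (∫⁻ x, (F x * (M x)⁻¹) ^ p ∂μ) ^ ((q - 1) / p) * J ^ (q / r) := by
        refine lintegral_mul_mul_le (hf.pow_const _).aemeasurable (hGm.pow_const _).aemeasurable
          hJm.aemeasurable (by positivity) hq1p (by positivity) ?_
        rw [← e3]; ring
    _ ≤ Q ^ (1 / p) * (C * Q) ^ ((q - 1) / p) * J ^ (q / r) := by
        gcongr
        exact h μ f hf
    _ = C ^ ((q - 1) / p) * J ^ (q / r) * (Q ^ (1 / p) * Q ^ ((q - 1) / p)) := by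
        rw [ENNReal.mul_rpow_of_nonneg _ _ hq1p]; ring
    _ = _ := by
        rw [← ENNReal.rpow_add_of_nonneg _ _ (by positivity) hq1p]
        congr 2; ring

/-- The inequality which replaces `∫ F ^ q dν = q ∫ f F ^ (q - 1) ν [y, ∞) dμ(y)`, where `F` is the
primitive of `f`. -/
theorem lintegral_rpow_setLIntegral_Iic_le {q : ℝ} (hq : 1 < q) (μ ν : Measure α) [SFinite μ]
    [SFinite ν] {f : α → ℝ≥0∞} (hf : Measurable f) :
    ∫⁻ x, (∫⁻ y in Iic x, f y ∂μ) ^ q ∂ν ≤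
      2 ^ q * ∫⁻ y, f y * (∫⁻ z in Iic y, f z ∂μ) ^ (q - 1) * ν (Ici y) ∂μ := by
  have hm : Measurable fun y => f y * (∫⁻ z in Iic y, f z ∂μ) ^ (q - 1) :=
    hf.mul ((measurable_setLIntegral_Iic' μ f).pow_const _)
  calc ∫⁻ x, (∫⁻ y in Iic x, f y ∂μ) ^ q ∂ν
      ≤ ∫⁻ x, 2 ^ q * ∫⁻ y in Iic x, f y * (∫⁻ z in Iic y, f z ∂μ) ^ (q - 1) ∂μ ∂ν :=
        lintegral_mono fun x => rpow_setLIntegral_le μ (Iic x) hf hq.le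
    _ = 2 ^ q * ∫⁻ x, ∫⁻ y in Iic x, f y * (∫⁻ z in Iic y, f z ∂μ) ^ (q - 1) ∂μ ∂ν :=
        lintegral_const_mul _ (measurable_setLIntegral_Iic' μ _)
    _ = _ := by
        rw [lintegral_setLIntegral_Iic_swap (G := fun _ y =>
          f y * (∫⁻ z in Iic y, f z ∂μ) ^ (q - 1)) (hm.comp measurable_snd)]
        congr 1
        exact lintegral_congr fun y => setLIntegral_const _ _

/-- Hardy's inequality with measures, sufficiency for `p ≤ q`. -/
theorem exists_hardy_le_of_le {p p' q : ℝ} (hp : p.HolderConjugate p') (hpq : p ≤ q) :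
    ∃ C : ℝ≥0∞, C ≠ ∞ ∧ ∀ (μ ν : Measure α) [SFinite μ] [SFinite ν] (B : ℝ≥0∞), B ≠ ∞ →
      (∀ x, μ (Iic x) ^ (1 / p') * ν (Ici x) ^ (1 / q) ≤ B) → ∀ f : α → ℝ≥0∞, Measurable f →
      (∫⁻ x, (∫⁻ y in Iic x, f y ∂μ) ^ q ∂ν) ^ (1 / q) ≤
        C * B * (∫⁻ x, f x ^ p ∂μ) ^ (1 / p) := by
  have hp'0 := hp.symm.pos
  have hq0 : 0 < q := hp.pos.trans_le hpq
  obtain ⟨C, hC, h⟩ := exists_lintegral_mul_rpow_mul_le_of_le (α := α) hp hpq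
  refine ⟨(2 ^ q * C) ^ (1 / q), ENNReal.rpow_ne_top_of_nonneg (by positivity)
    (ENNReal.mul_ne_top (two_rpow_ne_top _) hC), fun μ ν _ _ B hB hMV f hf => ?_⟩
  have h1 := h μ f (fun x => ν (Ici x)) (B ^ q) hf (measurable_measure_Iic (α := αᵒᵈ) ν)
    (ENNReal.rpow_ne_top_of_nonneg hq0.le hB) (ae_of_all _ fun x => by
      have := ENNReal.rpow_le_rpow (hMV x) hq0.le
      rwa [ENNReal.mul_rpow_of_nonneg _ _ hq0.le, ← ENNReal.rpow_mul, ← ENNReal.rpow_mul,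
        one_div_mul_cancel hq0.ne', ENNReal.rpow_one, one_div_mul_eq_div] at this)
  have h2 := (lintegral_rpow_setLIntegral_Iic_le (hp.lt.trans_le hpq) μ ν hf).trans
    (mul_le_mul_right h1 _)
  have h3 := ENNReal.rpow_le_rpow h2 (by positivity : 0 ≤ 1 / q)
  refine h3.trans (le_of_eq ?_)
  rw [← mul_assoc, ← mul_assoc, ENNReal.mul_rpow_of_nonneg _ _ (by positivity),
    ENNReal.mul_rpow_of_nonneg _ _ (by positivity), ← ENNReal.rpow_mul, ← ENNReal.rpow_mul,
    mul_one_div_cancel hq0.ne', ENNReal.rpow_one]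
  congr 2
  field_simp

/-- Integration by parts between the two forms of the condition for `q < p`. -/
theorem lintegral_rpow_mul_rpow_le {p p' q q' r : ℝ} (hp : p.HolderConjugate p')
    (hq : q.HolderConjugate q') (hqp : q < p) (hr : 1 / r = 1 / q - 1 / p) (μ ν : Measure α)
    [SFinite μ] [SFinite ν] :
    ∫⁻ x, ν (Ici x) ^ (r / q) * μ (Iic x) ^ (r / q') ∂μ ≤
      2 ^ (r / q) * ∫⁻ x, μ (Iic x) ^ (r / p') * ν (Ici x) ^ (r / p) ∂ν := by
  obtain ⟨hr0, e1, e2, e3, e4⟩ := exponent_relations hp hq hqp hr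
  have hp0 := hp.pos
  have hq'0 := hq.symm.pos
  have hm : Measurable fun x => ν (Ici x) := measurable_measure_Iic (α := αᵒᵈ) ν
  have hMm : Measurable fun x => μ (Iic x) := measurable_measure_Iic μ
  have hrp : 0 < r / p := by positivity
  calc ∫⁻ x, ν (Ici x) ^ (r / q) * μ (Iic x) ^ (r / q') ∂μ
      ≤ ∫⁻ x, 2 ^ (r / q) * ∫⁻ z in Ici x, μ (Iic x) ^ (r / q') * ν (Ici z) ^ (r / p) ∂ν ∂μ := by
        refine lintegral_mono fun x => ?_
        rw [lintegral_const_mul _ (hm.pow_const _)]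
        have := rpow_measure_Ici_le ν x (β := r / q) (by rw [← e1]; linarith)
        rw [← e1, add_sub_cancel_right, e1] at this
        calc _ ≤ _ := mul_le_mul_left this _
          _ = _ := by ring
    _ = 2 ^ (r / q) * ∫⁻ z, ∫⁻ x in Iic z, μ (Iic x) ^ (r / q') * ν (Ici z) ^ (r / p) ∂μ ∂ν := by
        have hG : Measurable (Function.uncurry fun z x : α =>
            μ (Iic x) ^ (r / q') * ν (Ici z) ^ (r / p)) :=
          ((hMm.comp measurable_snd).pow_const _).mul ((hm.comp measurable_fst).pow_const _)
        rw [lintegral_setLIntegral_Iic_swap hG, lintegral_const_mul]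
        exact measurable_setLIntegral_Ici (G := fun x z =>
          μ (Iic x) ^ (r / q') * ν (Ici z) ^ (r / p)) (hG.comp measurable_swap)
    _ ≤ _ := by
        gcongr with z
        rw [lintegral_mul_const _ (hMm.pow_const _)]
        gcongr
        calc ∫⁻ x in Iic z, μ (Iic x) ^ (r / q') ∂μ
            ≤ ∫⁻ x in Iic z, μ (Iic z) ^ (r / q') ∂μ :=
              setLIntegral_mono' measurableSet_Iic fun x hx =>
                ENNReal.rpow_le_rpow (monotone_measure_Iic μ hx) (by positivity)
          _ = μ (Iic z) ^ (r / q') * μ (Iic z) ^ (1 : ℝ) := by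
              rw [setLIntegral_const, ENNReal.rpow_one]
          _ = _ := by
              rw [← ENNReal.rpow_add_of_nonneg _ _ (by positivity) (by norm_num), e2]

/-- Hardy's inequality with measures, sufficiency for `q < p`. -/
theorem exists_hardy_le_of_lt {p p' q q' r : ℝ} (hp : p.HolderConjugate p')
    (hq : q.HolderConjugate q') (hqp : q < p) (hr : 1 / r = 1 / q - 1 / p) :
    ∃ C : ℝ≥0∞, C ≠ ∞ ∧ ∀ (μ ν : Measure α) [SFinite μ] [SFinite ν] (B : ℝ≥0∞), B ≠ ∞ →
      (∫⁻ x, μ (Iic x) ^ (r / p') * ν (Ici x) ^ (r / p) ∂ν) ^ (1 / r) ≤ B →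
      ∀ f : α → ℝ≥0∞, Measurable f →
      (∫⁻ x, (∫⁻ y in Iic x, f y ∂μ) ^ q ∂ν) ^ (1 / q) ≤
        C * B * (∫⁻ x, f x ^ p ∂μ) ^ (1 / p) := by
  obtain ⟨hr0, e1, e2, e3, e4⟩ := exponent_relations hp hq hqp hr
  have hp0 := hp.pos
  have hq0 := hq.pos
  obtain ⟨C, hC, h⟩ := exists_lintegral_mul_rpow_mul_le_of_lt (α := α) hp hq hqp hr
  refine ⟨(2 ^ q * C * (2 ^ (r / q)) ^ (q / r)) ^ (1 / q),
    ENNReal.rpow_ne_top_of_nonneg (by positivity) (ENNReal.mul_ne_top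
    (ENNReal.mul_ne_top (two_rpow_ne_top _) hC)
      (ENNReal.rpow_ne_top_of_nonneg (by positivity) (two_rpow_ne_top _))),
    fun μ ν _ _ B hB hMV f hf => ?_⟩
  have hJ : ∫⁻ x, μ (Iic x) ^ (r / p') * ν (Ici x) ^ (r / p) ∂ν ≤ B ^ r := by
    have := ENNReal.rpow_le_rpow hMV hr0.le
    rwa [← ENNReal.rpow_mul, one_div_mul_cancel hr0.ne', ENNReal.rpow_one] at this
  have hJ' := (lintegral_rpow_mul_rpow_le hp hq hqp hr μ ν).trans (mul_le_mul_right hJ _)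
  have hfin : 2 ^ (r / q) * B ^ r ≠ ∞ :=
    ENNReal.mul_ne_top (two_rpow_ne_top _) (ENNReal.rpow_ne_top_of_nonneg hr0.le hB)
  have h1 := h μ f (fun x => ν (Ici x)) hf (measurable_measure_Iic (α := αᵒᵈ) ν)
    (hJ'.trans_lt (lt_top_iff_ne_top.2 hfin)).ne
  have h2 := (lintegral_rpow_setLIntegral_Iic_le hq.lt μ ν hf).trans (mul_le_mul_right h1 _)
  have h3 := ENNReal.rpow_le_rpow h2 (by positivity : 0 ≤ 1 / q)
  refine h3.trans ?_
  calc (2 ^ q * (C * (∫⁻ x, ν (Ici x) ^ (r / q) * μ (Iic x) ^ (r / q') ∂μ) ^ (q / r) *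
          (∫⁻ x, f x ^ p ∂μ) ^ (q / p))) ^ (1 / q)
      ≤ (2 ^ q * (C * (2 ^ (r / q) * B ^ r) ^ (q / r) *
          (∫⁻ x, f x ^ p ∂μ) ^ (q / p))) ^ (1 / q) := by gcongr
    _ = ((2 ^ q * C * (2 ^ (r / q)) ^ (q / r)) * (B ^ q *
          (∫⁻ x, f x ^ p ∂μ) ^ (q / p))) ^ (1 / q) := by
        rw [ENNReal.mul_rpow_of_nonneg (2 ^ (r / q)) _ (by positivity), ← ENNReal.rpow_mul B]
        have : r * (q / r) = q := by field_simp
        rw [this]; ring_nf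
    _ = _ := by
        generalize (2 : ℝ≥0∞) ^ q * C * (2 ^ (r / q)) ^ (q / r) = K
        rw [ENNReal.mul_rpow_of_nonneg _ _ (by positivity),
          ENNReal.mul_rpow_of_nonneg _ _ (by positivity), ← ENNReal.rpow_mul, ← ENNReal.rpow_mul,
          mul_one_div_cancel hq0.ne', ENNReal.rpow_one, mul_assoc]
        congr 3
        field_simp

end Order

/-! ### Oinarov kernels -/

/-- An Oinarov kernel on the triangle `y ≤ x`: increasing in `x`, decreasing in `y` and
subadditive under splitting of the interval from `y` to `x`. -/
structure IsOinarovKernel {α : Type*} [LinearOrder α] [MeasurableSpace α]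
    (k : α → α → ℝ≥0∞) : Prop where
  measurable : Measurable (Function.uncurry k)
  antitone : ∀ x, Antitone fun y => k y x
  monotone : ∀ y, Monotone (k y)
  triangle : ∀ y e x, y ≤ e → e ≤ x → k y x ≤ k y e + k e x

/-- The integral operator `f ↦ ∫_{y ≤ x} f(y) k(y, x) dσ(y)`. -/
noncomputable def kernelOp {α : Type*} [Preorder α] [MeasurableSpace α] (σ : Measure α)
    (k : α → α → ℝ≥0∞) (f : α → ℝ≥0∞) (x : α) : ℝ≥0∞ :=
  ∫⁻ y in Iic x, f y * k y x ∂σ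

theorem IsOinarovKernel.measurable_left {α : Type*} [LinearOrder α] [MeasurableSpace α]
    {k : α → α → ℝ≥0∞} (hk : IsOinarovKernel k) (x : α) :
    Measurable fun y => k y x := hk.measurable.of_uncurry_right

theorem monotone_kernelOp {α : Type*} [LinearOrder α] [MeasurableSpace α]
    {σ : Measure α} {k : α → α → ℝ≥0∞} (hk : IsOinarovKernel k)
    {f : α → ℝ≥0∞} : Monotone (kernelOp σ k f) := fun _ _ h =>
  (lintegral_mono fun y => mul_le_mul_right (hk.monotone y h) _).trans
    (lintegral_mono_set (Iic_subset_Iic.2 h))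

/-- The dyadic level set `2ⁿ ≤ S < 2ⁿ⁺¹`. -/
def dyadicLevel {α : Type*} (S : α → ℝ≥0∞) (n : ℤ) : Set α :=
  {z | (2 : ℝ≥0∞) ^ n ≤ S z ∧ S z < 2 ^ (n + 1)}

theorem pairwise_disjoint_dyadicLevel {α : Type*} (S : α → ℝ≥0∞) :
    Pairwise (Function.onFun Disjoint (dyadicLevel S)) := by
  have key : ∀ m n : ℤ, m < n → Disjoint (dyadicLevel S m) (dyadicLevel S n) := by
    intro m n hmn
    refine Set.disjoint_left.2 fun z hm hn => ?_
    have h1 : (2 : ℝ≥0∞) ^ (m + 1) ≤ 2 ^ n :=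
      ENNReal.zpow_le_of_le (by norm_num) (by omega)
    exact absurd (hn.1.trans_lt hm.2) (not_lt.2 h1)
  intro m n hmn
  rcases lt_or_gt_of_ne hmn with h | h
  · exact key m n h
  · exact (key n m h).symm

theorem measurableSet_dyadicLevel {α : Type*} [MeasurableSpace α] {S : α → ℝ≥0∞}
    (hS : Measurable S) (n : ℤ) : MeasurableSet (dyadicLevel S n) :=
  (measurableSet_le measurable_const hS).inter (measurableSet_lt hS measurable_const)

theorem tsum_setLIntegral_dyadicLevel_le {α : Type*} [MeasurableSpace α] (μ : Measure α)
    {S : α → ℝ≥0∞} (hS : Measurable S) (g : α → ℝ≥0∞) :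
    ∑' n, ∫⁻ y in dyadicLevel S n, g y ∂μ ≤ ∫⁻ y, g y ∂μ := by
  rw [← lintegral_iUnion (measurableSet_dyadicLevel hS) (pairwise_disjoint_dyadicLevel S)]
  exact setLIntegral_le_lintegral _ _

theorem tsum_setLIntegral_dyadicLevel_union_le {α : Type*} [MeasurableSpace α] (μ : Measure α)
    {S : α → ℝ≥0∞} (hS : Measurable S) (g : α → ℝ≥0∞) :
    ∑' n, ∫⁻ y in dyadicLevel S (n - 1) ∪ dyadicLevel S n, g y ∂μ ≤ 2 * ∫⁻ y, g y ∂μ := by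
  calc ∑' n, ∫⁻ y in dyadicLevel S (n - 1) ∪ dyadicLevel S n, g y ∂μ
      ≤ ∑' n, (∫⁻ y in dyadicLevel S (n - 1), g y ∂μ + ∫⁻ y in dyadicLevel S n, g y ∂μ) :=
        ENNReal.tsum_le_tsum fun n => lintegral_union_le _ _ _
    _ = ∑' n, ∫⁻ y in dyadicLevel S (n - 1), g y ∂μ + ∑' n, ∫⁻ y in dyadicLevel S n, g y ∂μ :=
        ENNReal.tsum_add
    _ = ∑' n, ∫⁻ y in dyadicLevel S n, g y ∂μ + ∑' n, ∫⁻ y in dyadicLevel S n, g y ∂μ := by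
        congr 1
        exact (Equiv.subRight (1 : ℤ)).tsum_eq fun n => ∫⁻ y in dyadicLevel S n, g y ∂μ
    _ ≤ _ := by
        rw [two_mul]
        exact add_le_add (tsum_setLIntegral_dyadicLevel_le μ hS g)
          (tsum_setLIntegral_dyadicLevel_le μ hS g)

section Order

variable {α : Type*} [LinearOrder α] [TopologicalSpace α] [OrderTopology α]
  [SecondCountableTopology α] [MeasurableSpace α] [BorelSpace α]

theorem measurable_kernelOp {σ : Measure α} [SFinite σ] {k : α → α → ℝ≥0∞}
    (hk : Measurable (Function.uncurry k)) {f : α → ℝ≥0∞} (hf : Measurable f) :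
    Measurable (kernelOp σ k f) :=
  measurable_setLIntegral_Iic (G := fun x y => f y * k y x)
    ((hf.comp measurable_snd).mul (hk.comp measurable_swap))

/-- Splitting of `S = kernelOp σ k f` at the level `s`: the part of the integral from the region
`S < s` is at most `s` up to a term which is controlled by the primitive of `f` alone, the
other part is estimated by Hölder's inequality. -/
theorem kernelOp_le_add {σ : Measure α} [SFinite σ] {k : α → α → ℝ≥0∞} (hk : IsOinarovKernel k)
    {f : α → ℝ≥0∞} (hf : Measurable f) {p p' q : ℝ} (hp : p.HolderConjugate p') (hq : 1 < q)
    (s t : ℝ≥0∞) (z : α) (hz : kernelOp σ k f z < t) :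
    kernelOp σ k f z ≤ s +
      (2 ^ q * ∫⁻ y in Iic z, f y * (∫⁻ x in Iic y, f x ∂σ) ^ (q - 1) * k y z ^ q ∂σ) ^ (1 / q) +
      (∫⁻ y in {y | s ≤ kernelOp σ k f y ∧ kernelOp σ k f y < t}, f y ^ p ∂σ) ^ (1 / p) *
        (∫⁻ y in Iic z, k y z ^ p' ∂σ) ^ (1 / p') := by
  have hq0 : 0 < q := by linarith
  set S := kernelOp σ k f with hS
  have hSm : Measurable S := measurable_kernelOp hk.measurable hf
  set Θ := ∫⁻ y in Iic z, f y * (∫⁻ x in Iic y, f x ∂σ) ^ (q - 1) * k y z ^ q ∂σ with hΘ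
  set E := {y | s ≤ S y ∧ S y < t} with hE
  have hEm : MeasurableSet E := (measurableSet_le measurable_const hSm).inter
    (measurableSet_lt hSm measurable_const)
  have hkz := hk.measurable_left z
  set E₁ := Iic z ∩ {y | S y < s} with hE₁
  have hE₁m : MeasurableSet E₁ := measurableSet_Iic.inter (measurableSet_lt hSm measurable_const)
  -- `S` is increasing, so that `S < t` on all of `Iic z`
  have hcov : Iic z ⊆ E₁ ∪ (Iic z ∩ E) := by
    intro y hy
    rcases lt_or_ge (S y) s with h | h
    · exact Or.inl ⟨hy, h⟩
    · exact Or.inr ⟨hy, h, (monotone_kernelOp hk hy).trans_lt hz⟩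
  -- on `Iic e` with `S e < s`, the kernel is split at `e`
  have hone : ∫⁻ y in E₁, f y * k y z ∂σ ≤ s + (2 ^ q * Θ) ^ (1 / q) := by
    rw [← withDensity_apply _ hE₁m]
    refine measure_le_of_forall_Iic_le _ _ _ fun e he => ?_
    rw [withDensity_apply _ measurableSet_Iic]
    have hez : e ≤ z := he.1
    have h1 : (∫⁻ x in Iic e, f x ∂σ) * k e z ≤ (2 ^ q * Θ) ^ (1 / q) := by
      rw [one_div, ENNReal.le_rpow_inv_iff hq0, ENNReal.mul_rpow_of_nonneg _ _ hq0.le]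
      calc (∫⁻ x in Iic e, f x ∂σ) ^ q * k e z ^ q
          ≤ (2 ^ q * ∫⁻ y in Iic e, f y * (∫⁻ x in Iic y, f x ∂σ) ^ (q - 1) ∂σ) * k e z ^ q :=
            mul_le_mul_left (rpow_setLIntegral_le σ (Iic e) hf hq.le) _
        _ = 2 ^ q * ∫⁻ y in Iic e, f y * (∫⁻ x in Iic y, f x ∂σ) ^ (q - 1) * k e z ^ q ∂σ := by
            rw [mul_assoc, lintegral_mul_const]
            exact hf.mul ((measurable_setLIntegral_Iic' σ f).pow_const _)
        _ ≤ 2 ^ q * Θ := by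
            gcongr
            refine (setLIntegral_mono' measurableSet_Iic fun y hy => ?_).trans
              (lintegral_mono_set (Iic_subset_Iic.2 hez))
            exact mul_le_mul_right (ENNReal.rpow_le_rpow (hk.antitone z hy) hq0.le) _
    calc ∫⁻ y in Iic e, f y * k y z ∂σ
        ≤ ∫⁻ y in Iic e, (f y * k y e + f y * k e z) ∂σ :=
          setLIntegral_mono' measurableSet_Iic fun y hy => by
            rw [← mul_add]
            exact mul_le_mul_right (hk.triangle y e z hy hez) _
      _ = S e + (∫⁻ x in Iic e, f x ∂σ) * k e z := by
          rw [lintegral_add_right _ (hf.mul_const _), lintegral_mul_const _ hf]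
          rfl
      _ ≤ _ := add_le_add he.2.le h1
  have htwo : ∫⁻ y in Iic z ∩ E, f y * k y z ∂σ ≤
      (∫⁻ y in E, f y ^ p ∂σ) ^ (1 / p) * (∫⁻ y in Iic z, k y z ^ p' ∂σ) ^ (1 / p') := by
    refine (ENNReal.lintegral_mul_le_Lp_mul_Lq (σ.restrict (Iic z ∩ E)) hp hf.aemeasurable
      hkz.aemeasurable).trans ?_
    have hp0 := hp.pos
    have hp'0 := hp.symm.pos
    gcongr
    · exact inter_subset_right
    · exact inter_subset_left
  calc S z ≤ ∫⁻ y in E₁ ∪ (Iic z ∩ E), f y * k y z ∂σ := lintegral_mono_set hcov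
    _ ≤ _ := lintegral_union_le _ _ _
    _ ≤ _ := add_le_add hone htwo

/-- The dyadic estimate for an Oinarov kernel operator. The sum runs over the parts of the
dyadic levels of `S = kernelOp σ k f` on which the local term of `kernelOp_le_add` dominates. -/
theorem lintegral_kernelOp_rpow_le {σ ω : Measure α} [SFinite σ] [SFinite ω]
    {k : α → α → ℝ≥0∞} (hk : IsOinarovKernel k)
    {f : α → ℝ≥0∞} (hf : Measurable f) {p p' q : ℝ} (hp : p.HolderConjugate p') (hq : 1 < q)
    (hfin : ∀ᵐ z ∂ω, kernelOp σ k f z ≠ ∞) :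
    ∫⁻ z, kernelOp σ k f z ^ q ∂ω ≤
      8 ^ q * (2 ^ q * ∫⁻ y, f y * (∫⁻ x in Iic y, f x ∂σ) ^ (q - 1) *
        ∫⁻ z in Ici y, k y z ^ q ∂ω ∂σ) +
      8 ^ q * ∑' n : ℤ, ((2 : ℝ≥0∞) ^ (n - 2)) ^ q * ω (dyadicLevel (kernelOp σ k f) n ∩
        {z | (2 : ℝ≥0∞) ^ (n - 2) ≤
          (∫⁻ y in dyadicLevel (kernelOp σ k f) (n - 1) ∪ dyadicLevel (kernelOp σ k f) n,
            f y ^ p ∂σ) ^ (1 / p) * (∫⁻ y in Iic z, k y z ^ p' ∂σ) ^ (1 / p')}) := by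
  have hq0 : 0 < q := by linarith
  have hp0 := hp.pos
  set S := kernelOp σ k f with hS
  have hSm : Measurable S := measurable_kernelOp hk.measurable hf
  set e : ℤ → ℝ≥0∞ := fun n => ∫⁻ y in dyadicLevel S (n - 1) ∪ dyadicLevel S n, f y ^ p ∂σ with he
  set D : α → ℝ≥0∞ := fun z => ∫⁻ y in Iic z, k y z ^ p' ∂σ with hD
  have hDm : Measurable D := measurable_setLIntegral_Iic (G := fun z y => k y z ^ p')
    ((hk.measurable.comp measurable_swap).pow_const _)
  set F : α → ℝ≥0∞ := fun y => ∫⁻ x in Iic y, f x ∂σ with hF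
  have hFm : Measurable F := measurable_setLIntegral_Iic' σ f
  set Θ : α → ℝ≥0∞ := fun z => ∫⁻ y in Iic z, f y * F y ^ (q - 1) * k y z ^ q ∂σ with hΘ
  have hGm : Measurable (Function.uncurry fun z y : α => f y * F y ^ (q - 1) * k y z ^ q) :=
    ((hf.mul (hFm.pow_const _)).comp measurable_snd).mul
      ((hk.measurable.comp measurable_swap).pow_const _)
  have hΘm : Measurable Θ := measurable_setLIntegral_Iic hGm
  set B : ℤ → Set α := fun n => dyadicLevel S n ∩
    {z | (2 : ℝ≥0∞) ^ (n - 2) ≤ e n ^ (1 / p) * D z ^ (1 / p')} with hB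
  have hBm : ∀ n, MeasurableSet (B n) := fun n => (measurableSet_dyadicLevel hSm n).inter
    (measurableSet_le measurable_const ((hDm.pow_const _).const_mul _))
  have h20 : ∀ n : ℤ, (2 : ℝ≥0∞) ^ n ≠ ∞ := fun n =>
    ENNReal.zpow_ne_top (by norm_num) (by norm_num) n
  have hz1 : ∀ n : ℤ, (2 : ℝ≥0∞) ^ (n + 1) = 2 * 2 ^ n := fun n => by
    rw [ENNReal.zpow_add (by norm_num) (by norm_num), zpow_one, mul_comm]
  have hpt : ∀ᵐ z ∂ω, S z ^ q ≤ 8 ^ q * (2 ^ q * Θ z) +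
      8 ^ q * ∑' n : ℤ, (B n).indicator (fun _ => ((2 : ℝ≥0∞) ^ (n - 2)) ^ q) z := by
    filter_upwards [hfin] with z hzt
    by_cases hz0 : S z = 0
    · rw [hz0, ENNReal.zero_rpow_of_pos hq0]; exact zero_le
    obtain ⟨n, hn1, hn2⟩ := ENNReal.exists_mem_Ico_zpow hz0 hzt (y := 2) (by norm_num)
      (by norm_num)
    have hsub : {y | (2 : ℝ≥0∞) ^ (n - 1) ≤ S y ∧ S y < 2 ^ (n + 1)} ⊆
        dyadicLevel S (n - 1) ∪ dyadicLevel S n := by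
      intro y hy
      rcases lt_or_ge (S y) (2 ^ n) with h | h
      · refine Or.inl ⟨hy.1, ?_⟩
        rwa [sub_add_cancel]
      · exact Or.inr ⟨h, hy.2⟩
    have hkey := kernelOp_le_add hk hf hp hq (2 ^ (n - 1)) (2 ^ (n + 1)) z hn2
    set X := (2 ^ q * Θ z) ^ (1 / q) with hX
    have hkey2 : S z ≤ 2 ^ (n - 1) + X + e n ^ (1 / p) * D z ^ (1 / p') := by
      refine hkey.trans ?_
      gcongr
      exact lintegral_mono_set hsub
    set Y := e n ^ (1 / p) * D z ^ (1 / p') with hY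
    have hhalf : (2 : ℝ≥0∞) ^ (n - 1) ≤ X + Y := by
      have h1 : (2 : ℝ≥0∞) ^ (n - 1) + 2 ^ (n - 1) ≤ 2 ^ (n - 1) + (X + Y) := by
        rw [← add_assoc, ← two_mul, ← hz1, sub_add_cancel]
        exact hn1.trans hkey2
      exact (ENNReal.add_le_add_iff_left (h20 _)).1 h1
    -- as `2 ^ (n - 1) ≤ X + Y`, one of `X`, `Y` is at least `2 ^ (n - 2)`, an eighth of the upper
    -- bound for `S z`
    have h8 : S z ≤ 8 * 2 ^ (n - 2) := by
      refine hn2.le.trans (le_of_eq ?_)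
      have : n + 1 = (n - 2) + 1 + 1 + 1 := by ring
      rw [this, hz1, hz1, hz1]; ring
    have h4 : (2 : ℝ≥0∞) ^ (n - 2) ≤ X ∨ (2 : ℝ≥0∞) ^ (n - 2) ≤ Y := by
      by_contra hcon
      push Not at hcon
      have h1 := ENNReal.add_lt_add hcon.1 hcon.2
      rw [← two_mul, ← hz1, show n - 2 + 1 = n - 1 by ring] at h1
      exact absurd hhalf (not_le.2 h1)
    rcases h4 with h | h
    · refine le_add_right ?_
      calc S z ^ q ≤ (8 * X) ^ q :=
            ENNReal.rpow_le_rpow (h8.trans (mul_le_mul_right h _)) hq0.le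
        _ = _ := by
            rw [ENNReal.mul_rpow_of_nonneg _ _ hq0.le, hX, ← ENNReal.rpow_mul,
              one_div_mul_cancel hq0.ne', ENNReal.rpow_one]
    · refine le_add_left ?_
      have hzB : z ∈ B n := ⟨⟨hn1, hn2⟩, h⟩
      calc S z ^ q ≤ (8 * 2 ^ (n - 2)) ^ q := ENNReal.rpow_le_rpow h8 hq0.le
        _ = 8 ^ q * (B n).indicator (fun _ => ((2 : ℝ≥0∞) ^ (n - 2)) ^ q) z := by
            rw [ENNReal.mul_rpow_of_nonneg _ _ hq0.le, indicator_of_mem hzB]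
        _ ≤ _ := mul_le_mul_right
            (ENNReal.le_tsum (f := fun n => (B n).indicator (fun _ => ((2 : ℝ≥0∞) ^ (n - 2)) ^ q) z)
              n) _
  refine (lintegral_mono_ae hpt).trans (le_of_eq ?_)
  rw [lintegral_add_left ((hΘm.const_mul _).const_mul _), lintegral_const_mul _ (hΘm.const_mul _),
    lintegral_const_mul _ hΘm, lintegral_const_mul, lintegral_tsum]
  · congr 3
    · rw [hΘ, lintegral_setLIntegral_Iic_swap hGm]
      congr 1
      ext y
      rw [lintegral_const_mul]
      exact (hk.measurable.of_uncurry_left (x := y)).pow_const _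
    · ext n
      rw [lintegral_indicator_const (hBm n)]
  · exact fun n => (measurable_const.indicator (hBm n)).aemeasurable
  · exact Measurable.tsum fun n => measurable_const.indicator (hBm n)

end Order

/-! ### Sufficiency for Oinarov kernel operators -/

theorem rpow_one_div_le_of_le {X K B Q : ℝ≥0∞} {p q : ℝ} (hp : 0 < p) (hq : 0 < q)
    (h : X ≤ K * B ^ q * Q ^ (q / p)) : X ^ (1 / q) ≤ K ^ (1 / q) * B * Q ^ (1 / p) := by
  refine (ENNReal.rpow_le_rpow h (by positivity : 0 ≤ 1 / q)).trans (le_of_eq ?_)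
  rw [ENNReal.mul_rpow_of_nonneg _ _ (by positivity),
    ENNReal.mul_rpow_of_nonneg _ _ (by positivity), ← ENNReal.rpow_mul, ← ENNReal.rpow_mul, mul_one_div_cancel hq.ne', ENNReal.rpow_one]
  congr 2
  field_simp

/-- Hölder's inequality for the kernel operator at a point. -/
theorem kernelOp_le_holder {α : Type*} [LinearOrder α] [MeasurableSpace α]
    {σ : Measure α} {k : α → α → ℝ≥0∞} (hk : IsOinarovKernel k)
    {f : α → ℝ≥0∞} (hf : Measurable f) {p p' : ℝ} (hp : p.HolderConjugate p') (z : α) :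
    kernelOp σ k f z ≤
      (∫⁻ x, f x ^ p ∂σ) ^ (1 / p) * (∫⁻ y in Iic z, k y z ^ p' ∂σ) ^ (1 / p') := by
  have hp0 := hp.pos
  refine (ENNReal.lintegral_mul_le_Lp_mul_Lq (σ.restrict (Iic z)) hp hf.aemeasurable
      (hk.measurable_left z).aemeasurable).trans ?_
  gcongr
  exact Measure.restrict_le_self

/-- The operator has finite values almost everywhere when its characterizing quantity is finite,
since `ω (Ici z) ≠ 0` for almost every `z`. -/
theorem ae_kernelOp_ne_top {α : Type*} [LinearOrder α] [TopologicalSpace α] [OrderTopology α]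
    [SecondCountableTopology α] [MeasurableSpace α] {σ ω : Measure α}
    {k : α → α → ℝ≥0∞} (hk : IsOinarovKernel k) {f : α → ℝ≥0∞} (hf : Measurable f) {p p' : ℝ}
    (hp : p.HolderConjugate p') (hQ : ∫⁻ x, f x ^ p ∂σ ≠ ∞) {s t : ℝ} (hs : 0 < s) (ht : 0 < t)
    (h : ∀ᵐ z ∂ω, (∫⁻ y in Iic z, k y z ^ p' ∂σ) ^ s * ω (Ici z) ^ t ≠ ∞) :
    ∀ᵐ z ∂ω, kernelOp σ k f z ≠ ∞ := by
  filter_upwards [h, ae_measure_Iic_ne_zero (α := αᵒᵈ) ω] with z hz hz0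
  have hz0' : ω (Ici z) ≠ 0 := hz0
  have hD : ∫⁻ y in Iic z, k y z ^ p' ∂σ ≠ ∞ := by
    intro hcon
    rw [hcon, ENNReal.top_rpow_of_pos hs, ENNReal.top_mul] at hz
    · exact hz rfl
    · simp [ENNReal.rpow_eq_zero_iff, hz0', not_lt.2 ht.le]
  refine ((kernelOp_le_holder hk hf hp z).trans_lt ?_).ne
  have hp0 := hp.pos
  have hp'0 := hp.symm.pos
  exact ENNReal.mul_lt_top (ENNReal.rpow_lt_top_of_nonneg (by positivity) hQ)
    (ENNReal.rpow_lt_top_of_nonneg (by positivity) hD)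

section Order

variable {α : Type*} [LinearOrder α] [TopologicalSpace α] [OrderTopology α]
  [SecondCountableTopology α] [MeasurableSpace α] [BorelSpace α]

/-- Boundedness of Oinarov kernel operators for `p ≤ q`. -/
theorem exists_kernelOp_le_of_le {p p' q : ℝ} (hp : p.HolderConjugate p') (hpq : p ≤ q) :
    ∃ C : ℝ≥0∞, C ≠ ∞ ∧ ∀ (σ ω : Measure α) [SFinite σ] [SFinite ω] (k : α → α → ℝ≥0∞)
      (B : ℝ≥0∞), IsOinarovKernel k → B ≠ ∞ →
      (∀ t, (∫⁻ y in Iic t, k y t ^ p' ∂σ) ^ (1 / p') * ω (Ici t) ^ (1 / q) ≤ B) →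
      (∀ t, σ (Iic t) ^ (1 / p') * (∫⁻ x in Ici t, k t x ^ q ∂ω) ^ (1 / q) ≤ B) →
      ∀ f : α → ℝ≥0∞, Measurable f → ∫⁻ x, f x ^ p ∂σ ≠ ∞ →
      (∫⁻ x, kernelOp σ k f x ^ q ∂ω) ^ (1 / q) ≤ C * B * (∫⁻ x, f x ^ p ∂σ) ^ (1 / p) := by
  have hp0 := hp.pos
  have hp'0 := hp.symm.pos
  have hq0 : 0 < q := hp0.trans_le hpq
  have hq1 : 1 < q := hp.lt.trans_le hpq
  have hpq1 : 1 ≤ q / p := by rwa [one_le_div hp0]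
  obtain ⟨C, hC, h⟩ := exists_lintegral_mul_rpow_mul_le_of_le (α := α) hp hpq
  refine ⟨(8 ^ q * (2 ^ q * C) + 8 ^ q * 2 ^ (q / p)) ^ (1 / q),
    ENNReal.rpow_ne_top_of_nonneg (by positivity) ?_, fun σ ω _ _ k B hk hB h₁ h₂ f hf hQ => ?_⟩
  · have h8 : (8 : ℝ≥0∞) ^ q ≠ ∞ := ENNReal.rpow_ne_top_of_nonneg hq0.le (by norm_num)
    exact ENNReal.add_ne_top.2 ⟨ENNReal.mul_ne_top h8 (ENNReal.mul_ne_top (two_rpow_ne_top _) hC),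
      ENNReal.mul_ne_top h8 (two_rpow_ne_top _)⟩
  refine rpow_one_div_le_of_le hp0 hq0 ?_
  have hfin := ae_kernelOp_ne_top hk hf hp hQ (ω := ω) (s := 1 / p') (t := 1 / q)
    (by positivity) (by positivity)
    (ae_of_all _ fun z => ((h₁ z).trans_lt (lt_top_iff_ne_top.2 hB)).ne)
  have hpow : ∀ x y z : ℝ≥0∞, x ^ (1 / p') * y ^ (1 / q) ≤ z → x ^ (q / p') * y ≤ z ^ q := by
    intro x y z hxyz
    have := ENNReal.rpow_le_rpow hxyz hq0.le
    rwa [ENNReal.mul_rpow_of_nonneg _ _ hq0.le, ← ENNReal.rpow_mul, ← ENNReal.rpow_mul,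
      one_div_mul_cancel hq0.ne', ENNReal.rpow_one, one_div_mul_eq_div] at this
  have hBq := ENNReal.rpow_ne_top_of_nonneg hq0.le hB
  refine (lintegral_kernelOp_rpow_le hk hf hp hq1 hfin).trans ?_
  set S := kernelOp σ k f with hS
  have hSm : Measurable S := measurable_kernelOp hk.measurable hf
  set Q := ∫⁻ x, f x ^ p ∂σ with hQdef
  set V : α → ℝ≥0∞ := fun t => ∫⁻ x in Ici t, k t x ^ q ∂ω with hV
  have hVm : Measurable V := measurable_setLIntegral_Ici (G := fun t x => k t x ^ q)
    (hk.measurable.pow_const _)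
  have hA := h σ f V (B ^ q) hf hVm hBq (ae_of_all _ fun t => hpow _ _ _ (h₂ t))
  set e : ℤ → ℝ≥0∞ := fun n => ∫⁻ y in dyadicLevel S (n - 1) ∪ dyadicLevel S n, f y ^ p ∂σ with he
  have hsum : ∑' n, e n ≤ 2 * Q := tsum_setLIntegral_dyadicLevel_union_le σ hSm _
  -- a bound for the final segments `Ici z` with `z` in a level set is a bound for the level set
  have hterm : ∀ n : ℤ, ((2 : ℝ≥0∞) ^ (n - 2)) ^ q * ω (dyadicLevel S n ∩
      {z | (2 : ℝ≥0∞) ^ (n - 2) ≤ e n ^ (1 / p) * (∫⁻ y in Iic z, k y z ^ p' ∂σ) ^ (1 / p')}) ≤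
      B ^ q * e n ^ (q / p) := by
    intro n
    have := measure_le_of_forall_Iic_le (α := αᵒᵈ) ((((2 : ℝ≥0∞) ^ (n - 2)) ^ q) • ω)
      (dyadicLevel S n ∩ {z | (2 : ℝ≥0∞) ^ (n - 2) ≤
        e n ^ (1 / p) * (∫⁻ y in Iic z, k y z ^ p' ∂σ) ^ (1 / p')} : Set α) (B ^ q * e n ^ (q / p))
      (fun z hz => ?_)
    · exact this
    · change ((2 : ℝ≥0∞) ^ (n - 2)) ^ q * ω (Ici z) ≤ _
      have h3 := ENNReal.rpow_le_rpow hz.2 hq0.le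
      rw [ENNReal.mul_rpow_of_nonneg _ _ hq0.le, ← ENNReal.rpow_mul, ← ENNReal.rpow_mul,
        one_div_mul_eq_div, one_div_mul_eq_div] at h3
      calc ((2 : ℝ≥0∞) ^ (n - 2)) ^ q * ω (Ici z)
          ≤ e n ^ (q / p) * (∫⁻ y in Iic z, k y z ^ p' ∂σ) ^ (q / p') * ω (Ici z) :=
            mul_le_mul_left h3 _
        _ = e n ^ (q / p) * ((∫⁻ y in Iic z, k y z ^ p' ∂σ) ^ (q / p') * ω (Ici z)) := by ring
        _ ≤ e n ^ (q / p) * B ^ q := mul_le_mul_right (hpow _ _ _ (h₁ z)) _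
        _ = _ := mul_comm _ _
  calc _ ≤ 8 ^ q * (2 ^ q * (C * B ^ q * Q ^ (q / p))) + 8 ^ q * ∑' n, B ^ q * e n ^ (q / p) :=
        add_le_add (mul_le_mul_right (mul_le_mul_right hA _) _)
          (mul_le_mul_right (ENNReal.tsum_le_tsum hterm) _)
    _ ≤ 8 ^ q * (2 ^ q * (C * B ^ q * Q ^ (q / p))) + 8 ^ q * (B ^ q * (2 * Q) ^ (q / p)) := by
        rw [ENNReal.tsum_mul_left]
        gcongr
        exact (tsum_rpow_le e hpq1).trans (ENNReal.rpow_le_rpow hsum (by linarith))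
    _ = _ := by
        rw [ENNReal.mul_rpow_of_nonneg _ _ (by linarith)]; ring

/-- Boundedness of Oinarov kernel operators for `q < p`. -/
theorem exists_kernelOp_le_of_lt {p p' q q' r : ℝ} (hp : p.HolderConjugate p')
    (hq : q.HolderConjugate q') (hqp : q < p) (hr : 1 / r = 1 / q - 1 / p) :
    ∃ C : ℝ≥0∞, C ≠ ∞ ∧ ∀ (σ ω : Measure α) [SFinite σ] [SFinite ω] (k : α → α → ℝ≥0∞)
      (B : ℝ≥0∞), IsOinarovKernel k → B ≠ ∞ →
      (∫⁻ t, (∫⁻ x in Ici t, k t x ^ q ∂ω) ^ (r / q) * σ (Iic t) ^ (r / q') ∂σ) ^ (1 / r) ≤ B →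
      (∫⁻ t, (∫⁻ y in Iic t, k y t ^ p' ∂σ) ^ (r / p') * ω (Ici t) ^ (r / p) ∂ω) ^ (1 / r) ≤ B →
      ∀ f : α → ℝ≥0∞, Measurable f → ∫⁻ x, f x ^ p ∂σ ≠ ∞ →
      (∫⁻ x, kernelOp σ k f x ^ q ∂ω) ^ (1 / q) ≤ C * B * (∫⁻ x, f x ^ p ∂σ) ^ (1 / p) := by
  obtain ⟨hr0, e1, e2, e3, e4⟩ := exponent_relations hp hq hqp hr
  have hp0 := hp.pos
  have hp'0 := hp.symm.pos
  have hq0 := hq.pos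
  have hq1 := hq.lt
  obtain ⟨C, hC, h⟩ := exists_lintegral_mul_rpow_mul_le_of_lt (α := α) hp hq hqp hr
  refine ⟨(8 ^ q * (2 ^ q * C) + 8 ^ q * (2 * 2 ^ (q / p))) ^ (1 / q),
    ENNReal.rpow_ne_top_of_nonneg (by positivity) ?_, fun σ ω _ _ k B hk hB h₁ h₂ f hf hQ => ?_⟩
  · have h8 : (8 : ℝ≥0∞) ^ q ≠ ∞ := ENNReal.rpow_ne_top_of_nonneg hq0.le (by norm_num)
    exact ENNReal.add_ne_top.2 ⟨ENNReal.mul_ne_top h8 (ENNReal.mul_ne_top (two_rpow_ne_top _) hC),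
      ENNReal.mul_ne_top h8 (ENNReal.mul_ne_top (by norm_num) (two_rpow_ne_top _))⟩
  refine rpow_one_div_le_of_le hp0 hq0 ?_
  have hpow : ∀ x : ℝ≥0∞, x ^ (1 / r) ≤ B → x ≤ B ^ r := by
    intro x hx
    have := ENNReal.rpow_le_rpow hx hr0.le
    rwa [← ENNReal.rpow_mul, one_div_mul_cancel hr0.ne', ENNReal.rpow_one] at this
  have hBr := ENNReal.rpow_ne_top_of_nonneg hr0.le hB
  have h₁' := hpow _ h₁
  have h₂' := hpow _ h₂
  set D : α → ℝ≥0∞ := fun z => ∫⁻ y in Iic z, k y z ^ p' ∂σ with hD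
  have hDm : Measurable D := measurable_setLIntegral_Iic (G := fun z y => k y z ^ p')
    ((hk.measurable.comp measurable_swap).pow_const _)
  have hWm : Measurable fun z => ω (Ici z) := measurable_measure_Iic (α := αᵒᵈ) ω
  have hDWm : Measurable fun t => D t ^ (r / p') * ω (Ici t) ^ (r / p) :=
    (hDm.pow_const _).mul (hWm.pow_const _)
  have hfin := ae_kernelOp_ne_top hk hf hp hQ (ω := ω) (s := r / p') (t := r / p)
    (by positivity) (by positivity)
    ((ae_lt_top hDWm (h₂'.trans_lt (lt_top_iff_ne_top.2 hBr)).ne).mono fun z hz => hz.ne)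
  refine (lintegral_kernelOp_rpow_le hk hf hp hq1 hfin).trans ?_
  set S := kernelOp σ k f with hS
  have hSm : Measurable S := measurable_kernelOp hk.measurable hf
  set Q := ∫⁻ x, f x ^ p ∂σ with hQdef
  set V : α → ℝ≥0∞ := fun t => ∫⁻ x in Ici t, k t x ^ q ∂ω with hV
  have hVm : Measurable V := measurable_setLIntegral_Ici (G := fun t x => k t x ^ q)
    (hk.measurable.pow_const _)
  have hA := h σ f V hf hVm (h₁'.trans_lt (lt_top_iff_ne_top.2 hBr)).ne
  have hBq : ∀ x : ℝ≥0∞, x ≤ B ^ r → x ^ (q / r) ≤ B ^ q := fun x hx => by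
    have := ENNReal.rpow_le_rpow hx (by positivity : 0 ≤ q / r)
    rwa [← ENNReal.rpow_mul, show r * (q / r) = q by field_simp] at this
  set e : ℤ → ℝ≥0∞ := fun n => ∫⁻ y in dyadicLevel S (n - 1) ∪ dyadicLevel S n, f y ^ p ∂σ with he
  have hsum : ∑' n, e n ≤ 2 * Q := tsum_setLIntegral_dyadicLevel_union_le σ hSm _
  set j : ℤ → ℝ≥0∞ := fun n => ∫⁻ t in dyadicLevel S n, D t ^ (r / p') * ω (Ici t) ^ (r / p) ∂ω
    with hj
  have hjsum : ∑' n, j n ≤ B ^ r := (tsum_setLIntegral_dyadicLevel_le ω hSm _).trans h₂'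
  -- with `E` the set in question, `ω E ^ (r / q)` is estimated by `∫_E ω (Ici x) ^ (r / p) dω`,
  -- and the lower bound for `D` on `E` is inserted in this integral
  have hterm : ∀ n : ℤ, ((2 : ℝ≥0∞) ^ (n - 2)) ^ q * ω (dyadicLevel S n ∩
      {z | (2 : ℝ≥0∞) ^ (n - 2) ≤ e n ^ (1 / p) * D z ^ (1 / p')}) ≤
      2 * (e n ^ (q / p) * j n ^ (q / r)) := by
    intro n
    set E := dyadicLevel S n ∩ {z | (2 : ℝ≥0∞) ^ (n - 2) ≤ e n ^ (1 / p) * D z ^ (1 / p')} with hE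
    have hEm : MeasurableSet E := (measurableSet_dyadicLevel hSm n).inter
      (measurableSet_le measurable_const ((hDm.pow_const _).const_mul _))
    have hωE : ω E ^ (r / q) ≤ 2 ^ (r / q) * ∫⁻ x in E, ω (Ici x) ^ (r / p) ∂ω := by
      have h4 := rpow_setLIntegral_le (α := αᵒᵈ) ω (E : Set α) (f := fun _ => 1) measurable_const
        (β := r / q) (by rw [← e1]; have : 0 < r / p := by positivity
                         linarith)
      have h5 : ∀ s : Set α, ∫⁻ _ in s, 1 ∂ω = ω s := fun s => setLIntegral_one s
      simp only [one_mul] at h4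
      rw [← e1, add_sub_cancel_right, e1] at h4
      rw [← h5 E]
      simp only [← h5 (Ici _)]
      exact h4
    have h6 : ((2 : ℝ≥0∞) ^ (n - 2)) ^ r * ω E ^ (r / q) ≤ 2 ^ (r / q) * (e n ^ (r / p) * j n) := by
      calc ((2 : ℝ≥0∞) ^ (n - 2)) ^ r * ω E ^ (r / q)
          ≤ ((2 : ℝ≥0∞) ^ (n - 2)) ^ r * (2 ^ (r / q) * ∫⁻ x in E, ω (Ici x) ^ (r / p) ∂ω) :=
            mul_le_mul_right hωE _
        _ = 2 ^ (r / q) * ∫⁻ x in E, ((2 : ℝ≥0∞) ^ (n - 2)) ^ r * ω (Ici x) ^ (r / p) ∂ω := by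
            rw [lintegral_const_mul _ (hWm.pow_const _)]; ring
        _ ≤ 2 ^ (r / q) * ∫⁻ x in E, e n ^ (r / p) * (D x ^ (r / p') * ω (Ici x) ^ (r / p)) ∂ω := by
            refine mul_le_mul_right (setLIntegral_mono' hEm fun x hx => ?_) _
            have h7 := ENNReal.rpow_le_rpow hx.2 hr0.le
            rw [ENNReal.mul_rpow_of_nonneg _ _ hr0.le, ← ENNReal.rpow_mul, ← ENNReal.rpow_mul,
              one_div_mul_eq_div, one_div_mul_eq_div] at h7
            rw [← mul_assoc]
            exact mul_le_mul_left h7 _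
        _ = 2 ^ (r / q) * (e n ^ (r / p) *
              ∫⁻ x in E, D x ^ (r / p') * ω (Ici x) ^ (r / p) ∂ω) := by
            rw [lintegral_const_mul _ hDWm]
        _ ≤ _ := by
            gcongr
            exact lintegral_mono_set inter_subset_left
    have h8 := ENNReal.rpow_le_rpow h6 (by positivity : 0 ≤ q / r)
    have hqr : 0 ≤ q / r := by positivity
    rw [ENNReal.mul_rpow_of_nonneg _ _ hqr, ENNReal.mul_rpow_of_nonneg _ _ hqr,
      ENNReal.mul_rpow_of_nonneg _ _ hqr, ← ENNReal.rpow_mul, ← ENNReal.rpow_mul,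
      ← ENNReal.rpow_mul, ← ENNReal.rpow_mul, show r * (q / r) = q by field_simp,
      show r / q * (q / r) = 1 by field_simp, show r / p * (q / r) = q / p by field_simp,
      ENNReal.rpow_one, ENNReal.rpow_one] at h8
    exact h8
  calc _ ≤ 8 ^ q * (2 ^ q * (C * B ^ q * Q ^ (q / p))) +
        8 ^ q * ∑' n, 2 * (e n ^ (q / p) * j n ^ (q / r)) :=
        add_le_add (mul_le_mul_right (mul_le_mul_right (hA.trans (mul_le_mul_left
          (mul_le_mul_right (hBq _ h₁') _) _)) _) _)
          (mul_le_mul_right (ENNReal.tsum_le_tsum hterm) _)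
    _ ≤ 8 ^ q * (2 ^ q * (C * B ^ q * Q ^ (q / p))) +
        8 ^ q * (2 * ((2 * Q) ^ (q / p) * B ^ q)) := by
        rw [ENNReal.tsum_mul_left]
        gcongr
        refine (tsum_mul_rpow_le e j (by positivity) (by positivity) e3).trans ?_
        gcongr
        exact hBq _ hjsum
    _ = _ := by
        rw [ENNReal.mul_rpow_of_nonneg _ _ (by positivity)]; ring

end Order

/-! ### Necessity for Oinarov kernel operators with `q < p` -/

/-- Products of monotone convergent sequences converge: the product `0 * ∞` does no harm, because a
monotone sequence with limit `0` vanishes. -/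
theorem tendsto_mul_of_monotone {a b : ℕ → ℝ≥0∞} {A B : ℝ≥0∞} (ha : Monotone a)
    (hb : Monotone b) (hA : Tendsto a atTop (𝓝 A)) (hB : Tendsto b atTop (𝓝 B)) :
    Tendsto (fun n => a n * b n) atTop (𝓝 (A * B)) := by
  by_cases hA0 : A = 0
  · have : ∀ n, a n = 0 := fun n => le_antisymm (hA0 ▸ ha.ge_of_tendsto hA n) zero_le
    simp [this, hA0]
  by_cases hB0 : B = 0
  · have : ∀ n, b n = 0 := fun n => le_antisymm (hB0 ▸ hb.ge_of_tendsto hB n) zero_le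
    simp [this, hB0]
  exact ENNReal.Tendsto.mul hA (Or.inl hA0) hB (Or.inl hB0)

theorem indicator_le_indicator_of_subset_of_le {α : Type*} {s t : Set α} (hst : s ⊆ t)
    {f g : α → ℝ≥0∞} {x : α} (h : f x ≤ g x) : s.indicator f x ≤ t.indicator g x := by
  by_cases hx : x ∈ s
  · simpa [hx, hst hx] using h
  · simp [hx]

section Order

variable {α : Type*} [LinearOrder α] [TopologicalSpace α] [OrderTopology α]
  [SecondCountableTopology α] [MeasurableSpace α] [BorelSpace α]

/-- Necessity for `q < p` under the assumption that the quantity to be estimated is finite. The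
test function is a product of powers of `σ (Iic t)` and `V t = ∫_{x ≥ t} k(t, x) ^ q dω(x)`. -/
theorem exists_le_of_kernelOp_le_of_ne_top {p p' q q' r : ℝ} (hp : p.HolderConjugate p')
    (hq : q.HolderConjugate q') (hqp : q < p) (hr : 1 / r = 1 / q - 1 / p) :
    ∃ C : ℝ≥0∞, C ≠ ∞ ∧ ∀ (σ ω : Measure α) [SFinite σ] [SFinite ω] (k : α → α → ℝ≥0∞)
      (N : ℝ≥0∞), Measurable (Function.uncurry k) → (∀ x, Antitone fun y => k y x) →
      (∀ f : α → ℝ≥0∞, Measurable f → ∫⁻ x, f x ^ p ∂σ ≠ ∞ →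
        (∫⁻ x, kernelOp σ k f x ^ q ∂ω) ^ (1 / q) ≤ N * (∫⁻ x, f x ^ p ∂σ) ^ (1 / p)) →
      ∫⁻ t, (∫⁻ x in Ici t, k t x ^ q ∂ω) ^ (r / q) * σ (Iic t) ^ (r / q') ∂σ ≠ ∞ →
      (∫⁻ t, (∫⁻ x in Ici t, k t x ^ q ∂ω) ^ (r / q) * σ (Iic t) ^ (r / q') ∂σ) ^ (1 / r) ≤
        C * N := by
  obtain ⟨hr0, e1, e2, e3, e4⟩ := exponent_relations hp hq hqp hr
  have hp0 := hp.pos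
  have hq0 := hq.pos
  have hq1 := hq.lt
  have hq'0 := hq.symm.pos
  -- the exponents are chosen such that the test function `f = V ^ e M ^ s` satisfies
  -- `f ^ p = V ^ (r / q) M ^ (r / q')`
  set s := r / (p * q') with hs
  set e := r / (p * q) with he
  have hs0 : 0 < s := by positivity
  have he0 : 0 < e := by positivity
  set K : ℝ≥0∞ := 2 ^ (1 + s) with hK
  have hKt : K ≠ ∞ := two_rpow_ne_top _
  refine ⟨(K ^ (q - 1)) ^ (1 / q), ENNReal.rpow_ne_top_of_nonneg (by positivity)
    (ENNReal.rpow_ne_top_of_nonneg (by linarith) hKt), fun σ ω _ _ k N hk hanti hN hJ => ?_⟩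
  set M : α → ℝ≥0∞ := fun t => σ (Iic t) with hM
  have hMm : Measurable M := measurable_measure_Iic σ
  set V : α → ℝ≥0∞ := fun t => ∫⁻ x in Ici t, k t x ^ q ∂ω with hV
  have hVm : Measurable V := measurable_setLIntegral_Ici (G := fun t x => k t x ^ q)
    (hk.pow_const _)
  have hVanti : Antitone V := fun t t' h =>
    (lintegral_mono fun x => ENNReal.rpow_le_rpow (hanti x h) hq0.le).trans
      (lintegral_mono_set (Ici_subset_Ici.2 h))
  set J := ∫⁻ t, V t ^ (r / q) * M t ^ (r / q') ∂σ with hJdef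
  set f : α → ℝ≥0∞ := fun t => V t ^ e * M t ^ s with hf
  have hfm : Measurable f := (hVm.pow_const _).mul (hMm.pow_const _)
  have hfp : ∫⁻ t, f t ^ p ∂σ = J := by
    refine lintegral_congr fun t => ?_
    rw [hf]
    simp only
    rw [ENNReal.mul_rpow_of_nonneg _ _ hp0.le, ← ENNReal.rpow_mul, ← ENNReal.rpow_mul]
    congr 2
    · rw [he]; field_simp
    · rw [hs]; field_simp
  have hkx : ∀ x, Measurable fun y => k y x := fun x => hk.of_uncurry_right
  -- a lower bound for the operator, from the monotonicity of `V` and `k`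
  have hlow : ∀ x t, V t ^ e * M t ^ (1 + s) * k t x ≤ K * ∫⁻ y in Iic t, f y * k y x ∂σ := by
    intro x t
    have h1 := rpow_setLIntegral_le σ (Iic t) (f := fun _ => 1) measurable_const (β := 1 + s)
      (by linarith)
    simp only [setLIntegral_one, one_mul, add_sub_cancel_left] at h1
    calc V t ^ e * M t ^ (1 + s) * k t x
        ≤ V t ^ e * (K * ∫⁻ y in Iic t, M y ^ s ∂σ) * k t x := by gcongr
      _ = K * ∫⁻ y in Iic t, V t ^ e * M y ^ s * k t x ∂σ := by
          rw [lintegral_mul_const _ ((hMm.pow_const _).const_mul _),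
            lintegral_const_mul _ (hMm.pow_const _)]
          ring
      _ ≤ _ := by
          refine mul_le_mul_right (setLIntegral_mono' measurableSet_Iic fun y hy => ?_) _
          exact mul_le_mul' (mul_le_mul_left (ENNReal.rpow_le_rpow (hVanti hy) he0.le) _)
            (hanti x hy)
  have hexp1 : e * (q - 1) + e = r / p := by
    rw [he]; field_simp; ring
  have hexp2 : (1 + s) * (q - 1) + s = r / q' := by
    have h1 : q / q' = q - 1 := hq.div_conj_eq_sub_one
    have h2 : s * q = r / p * (q - 1) := by
      rw [← h1, hs]; field_simp
    have h3 : (q - 1) * (r / q) = r / q' := by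
      rw [← h1]; field_simp
    rw [← h3, ← e1]; linear_combination h2
  have hS : ∀ x, ∫⁻ t in Iic x, V t ^ (r / p) * M t ^ (r / q') * k t x ^ q ∂σ ≤
      K ^ (q - 1) * kernelOp σ k f x ^ q := by
    intro x
    set S := kernelOp σ k f x with hSdef
    have hK1 : K ^ (q - 1) ≠ ∞ := ENNReal.rpow_ne_top_of_nonneg (by linarith) hKt
    calc ∫⁻ t in Iic x, V t ^ (r / p) * M t ^ (r / q') * k t x ^ q ∂σ
        = ∫⁻ t in Iic x, (V t ^ e * M t ^ (1 + s) * k t x) ^ (q - 1) * (f t * k t x) ∂σ := by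
          refine lintegral_congr fun t => ?_
          have hq10 : 0 ≤ q - 1 := by linarith
          have h3 : k t x ^ q = k t x ^ (q - 1) * k t x := by
            conv_rhs => rw [← ENNReal.rpow_one (k t x), ← ENNReal.rpow_mul, one_mul,
              ← ENNReal.rpow_add_of_nonneg _ _ hq10 zero_le_one]
            congr 1; ring
          rw [ENNReal.mul_rpow_of_nonneg _ _ hq10, ENNReal.mul_rpow_of_nonneg _ _ hq10,
            ← ENNReal.rpow_mul, ← ENNReal.rpow_mul, h3, ← hexp1, ← hexp2,
            ENNReal.rpow_add_of_nonneg _ _ (by positivity) he0.le,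
            ENNReal.rpow_add_of_nonneg _ _ (by positivity) hs0.le, hf]
          ring
      _ ≤ ∫⁻ t in Iic x, (K * S) ^ (q - 1) * (f t * k t x) ∂σ := by
          refine setLIntegral_mono' measurableSet_Iic fun t ht => mul_le_mul_left ?_ _
          refine ENNReal.rpow_le_rpow ((hlow x t).trans (mul_le_mul_right ?_ _)) (by linarith)
          exact lintegral_mono_set (Iic_subset_Iic.2 ht)
      _ = (K * S) ^ (q - 1) * S := lintegral_const_mul _ (hfm.mul (hkx x))
      _ = _ := by
          rw [ENNReal.mul_rpow_of_nonneg _ _ (by linarith : 0 ≤ q - 1), mul_assoc]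
          congr 1
          conv_lhs => rw [← ENNReal.rpow_one S, ← ENNReal.rpow_mul, one_mul,
            ← ENNReal.rpow_add_of_nonneg _ _ (by linarith) zero_le_one]
          congr 1; ring
  have hG : Measurable (Function.uncurry fun x t : α =>
      V t ^ (r / p) * M t ^ (r / q') * k t x ^ q) :=
    (((hVm.pow_const _).mul (hMm.pow_const _)).comp measurable_snd).mul
      ((hk.comp measurable_swap).pow_const _)
  have hJle : J ≤ K ^ (q - 1) * ∫⁻ x, kernelOp σ k f x ^ q ∂ω := by
    calc J = ∫⁻ t, ∫⁻ x in Ici t, V t ^ (r / p) * M t ^ (r / q') * k t x ^ q ∂ω ∂σ := by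
          refine lintegral_congr fun t => ?_
          rw [lintegral_const_mul]
          · rw [← e1, ENNReal.rpow_add_of_nonneg _ _ (by positivity) zero_le_one, ENNReal.rpow_one]
            ring
          · exact (hk.of_uncurry_left (x := t)).pow_const _
      _ = ∫⁻ x, ∫⁻ t in Iic x, V t ^ (r / p) * M t ^ (r / q') * k t x ^ q ∂σ ∂ω :=
          (lintegral_setLIntegral_Iic_swap hG).symm
      _ ≤ ∫⁻ x, K ^ (q - 1) * kernelOp σ k f x ^ q ∂ω := lintegral_mono hS
      _ = _ := lintegral_const_mul _ ((measurable_kernelOp hk hfm).pow_const _)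
  have hmain : J ≤ K ^ (q - 1) * N ^ q * J ^ (q / p) := by
    refine hJle.trans ?_
    rw [mul_assoc]
    refine mul_le_mul_right ?_ _
    have h1 := ENNReal.rpow_le_rpow (hN f hfm (hfp ▸ hJ)) hq0.le
    rwa [hfp, ← ENNReal.rpow_mul, one_div_mul_cancel hq0.ne', ENNReal.rpow_one,
      ENNReal.mul_rpow_of_nonneg _ _ hq0.le, ← ENNReal.rpow_mul, one_div_mul_eq_div] at h1
  have h2 := rpow_le_of_le_mul_rpow hJ (by positivity) (by positivity) e3 hmain
  have h3 := ENNReal.rpow_le_rpow h2 (by positivity : 0 ≤ 1 / q)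
  rw [← ENNReal.rpow_mul, ENNReal.mul_rpow_of_nonneg _ _ (by positivity), ← ENNReal.rpow_mul N,
    mul_one_div_cancel hq0.ne', ENNReal.rpow_one, show q / r * (1 / q) = 1 / r by field_simp] at h3
  exact h3

/-- Necessity for `q < p` of the condition in terms of `∫_{x ≥ t} k(t, x) ^ q dω(x)`. The kernel
and the measures are truncated to make the condition finite. -/
theorem exists_le_of_kernelOp_le {p p' q q' r : ℝ} (hp : p.HolderConjugate p')
    (hq : q.HolderConjugate q') (hqp : q < p) (hr : 1 / r = 1 / q - 1 / p) :
    ∃ C : ℝ≥0∞, C ≠ ∞ ∧ ∀ (σ ω : Measure α) [SigmaFinite σ] [SigmaFinite ω] (k : α → α → ℝ≥0∞)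
      (N : ℝ≥0∞), Measurable (Function.uncurry k) → (∀ x, Antitone fun y => k y x) →
      (∀ f : α → ℝ≥0∞, Measurable f → ∫⁻ x, f x ^ p ∂σ ≠ ∞ →
        (∫⁻ x, kernelOp σ k f x ^ q ∂ω) ^ (1 / q) ≤ N * (∫⁻ x, f x ^ p ∂σ) ^ (1 / p)) →
      (∫⁻ t, (∫⁻ x in Ici t, k t x ^ q ∂ω) ^ (r / q) * σ (Iic t) ^ (r / q') ∂σ) ^ (1 / r) ≤
        C * N := by
  obtain ⟨hr0, e1, e2, e3, e4⟩ := exponent_relations hp hq hqp hr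
  have hp0 := hp.pos
  have hq0 := hq.pos
  have hq'0 := hq.symm.pos
  have hrq0 : 0 < r / q := by positivity
  have hrq'0 : 0 < r / q' := by positivity
  obtain ⟨C, hC, h⟩ := exists_le_of_kernelOp_le_of_ne_top (α := α) hp hq hqp hr
  refine ⟨C, hC, fun σ ω _ _ k N hk hanti hN => ?_⟩
  set A := spanningSets σ with hA
  set B := spanningSets ω with hB
  have hAm : ∀ n, MeasurableSet (A n) := measurableSet_spanningSets σ
  have hBm : ∀ n, MeasurableSet (B n) := measurableSet_spanningSets ω
  set kn : ℕ → α → α → ℝ≥0∞ := fun n y x => min (k y x) n with hkn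
  have hknm : ∀ n, Measurable (Function.uncurry (kn n)) := fun n => hk.min measurable_const
  set V : α → ℝ≥0∞ := fun t => ∫⁻ x in Ici t, k t x ^ q ∂ω with hV
  set Vn : ℕ → α → ℝ≥0∞ := fun n t => ∫⁻ x in Ici t, kn n t x ^ q ∂(ω.restrict (B n)) with hVn
  have hVnm : ∀ n, Measurable (Vn n) := fun n =>
    measurable_setLIntegral_Ici (G := fun t x => kn n t x ^ q) ((hknm n).pow_const _)
  set Mn : ℕ → α → ℝ≥0∞ := fun n t => σ.restrict (A n) (Iic t) with hMn
  have hMnm : ∀ n, Measurable (Mn n) := fun n => measurable_measure_Iic _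
  -- the truncated quantities are finite
  have hJn : ∀ n, (∫⁻ t, Vn n t ^ (r / q) * Mn n t ^ (r / q') ∂(σ.restrict (A n))) ^ (1 / r) ≤
      C * N := by
    intro n
    refine h (σ.restrict (A n)) (ω.restrict (B n)) (kn n) N (hknm n)
      (fun x y y' hy => min_le_min_right _ (hanti x hy)) (fun f hf hfin => ?_) ?_
    · have hfi : Measurable ((A n).indicator f) := hf.indicator (hAm n)
      have hpow : ∫⁻ x, (A n).indicator f x ^ p ∂σ = ∫⁻ x, f x ^ p ∂(σ.restrict (A n)) := by
        rw [← lintegral_indicator (hAm n)]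
        refine lintegral_congr fun x => ?_
        by_cases hx : x ∈ A n
        · simp [hx]
        · simp [hx, hp0]
      have h1 := hN _ hfi (hpow ▸ hfin)
      rw [hpow] at h1
      refine le_trans (ENNReal.rpow_le_rpow ?_ (by positivity)) h1
      refine (lintegral_mono fun x => ENNReal.rpow_le_rpow ?_ hq0.le).trans
        (lintegral_mono' Measure.restrict_le_self le_rfl)
      calc kernelOp (σ.restrict (A n)) (kn n) f x
          ≤ ∫⁻ y in Iic x, f y * k y x ∂(σ.restrict (A n)) :=
            lintegral_mono fun y => mul_le_mul_right (min_le_left _ _) _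
        _ = kernelOp σ k ((A n).indicator f) x := by
            rw [Measure.restrict_restrict measurableSet_Iic, inter_comm,
              ← Measure.restrict_restrict (hAm n), ← lintegral_indicator (hAm n)]
            refine lintegral_congr fun y => ?_
            by_cases hy : y ∈ A n
            · simp [hy]
            · simp [hy]
    · have hVb : ∀ t, Vn n t ≤ (n : ℝ≥0∞) ^ q * ω (B n) := fun t => by
        calc Vn n t ≤ ∫⁻ x, (n : ℝ≥0∞) ^ q ∂(ω.restrict (B n)) :=
              (setLIntegral_le_lintegral _ _).trans (lintegral_mono fun x =>
                ENNReal.rpow_le_rpow (min_le_right _ _) hq0.le)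
          _ = _ := by simp
      have hMb : ∀ t, Mn n t ≤ σ (A n) := fun t => by
        calc Mn n t ≤ σ.restrict (A n) univ := measure_mono (subset_univ _)
          _ = _ := by simp
      have hle : ∫⁻ t, Vn n t ^ (r / q) * Mn n t ^ (r / q') ∂(σ.restrict (A n)) ≤
          ((n : ℝ≥0∞) ^ q * ω (B n)) ^ (r / q) * σ (A n) ^ (r / q') * σ (A n) := by
        calc _ ≤ ∫⁻ t, ((n : ℝ≥0∞) ^ q * ω (B n)) ^ (r / q) * σ (A n) ^ (r / q')
              ∂(σ.restrict (A n)) := lintegral_mono fun t => by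
                gcongr
                · exact hVb t
                · exact hMb t
          _ = _ := by simp
      refine (hle.trans_lt ?_).ne
      have hAf : σ (A n) < ∞ := measure_spanningSets_lt_top σ n
      have hBf : ω (B n) < ∞ := measure_spanningSets_lt_top ω n
      exact ENNReal.mul_lt_top (ENNReal.mul_lt_top (ENNReal.rpow_lt_top_of_nonneg hrq0.le
        (ENNReal.mul_lt_top (ENNReal.rpow_lt_top_of_nonneg hq0.le (ENNReal.natCast_ne_top n))
          hBf).ne) (ENNReal.rpow_lt_top_of_nonneg hrq'0.le hAf.ne)) hAf
  -- passage to the limit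
  have hkmono : ∀ t x, Monotone fun n => kn n t x := fun t x m n hmn =>
    min_le_min_left _ (by exact_mod_cast hmn)
  have hVmono : ∀ t, Monotone fun n => Vn n t := fun t m n hmn =>
    lintegral_mono' (Measure.restrict_mono le_rfl
      (Measure.restrict_mono (monotone_spanningSets ω hmn) le_rfl))
      (fun x => ENNReal.rpow_le_rpow (hkmono t x hmn) hq0.le)
  have hMmono : ∀ t, Monotone fun n => Mn n t := fun t m n hmn =>
    Measure.restrict_mono (monotone_spanningSets σ hmn) le_rfl _
  have hVlim : ∀ t, Tendsto (fun n => Vn n t) atTop (𝓝 (V t)) := by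
    intro t
    have hrw : ∀ n, Vn n t = ∫⁻ x in Ici t, (B n).indicator (fun x => kn n t x ^ q) x ∂ω := by
      intro n
      rw [lintegral_indicator (hBm n), hVn]
      simp only
      rw [Measure.restrict_restrict measurableSet_Ici, Measure.restrict_restrict (hBm n),
        inter_comm]
    simp only [hrw]
    have hkt : ∀ n, Measurable fun x => kn n t x ^ q := fun n =>
      ((hknm n).of_uncurry_left (x := t)).pow_const _
    refine lintegral_tendsto_of_tendsto_of_monotone
      (fun n => ((hkt n).indicator (hBm n)).aemeasurable) (ae_of_all _ fun x m n hmn => ?_)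
      (ae_of_all _ fun x => ?_)
    · exact indicator_le_indicator_of_subset_of_le (monotone_spanningSets ω hmn)
        (ENNReal.rpow_le_rpow (hkmono t x hmn) hq0.le)
    · have h1 : Tendsto (fun n : ℕ => min (k t x) (n : ℝ≥0∞)) atTop (𝓝 (min (k t x) ∞)) :=
        tendsto_const_nhds.min ENNReal.tendsto_nat_nhds_top
      rw [min_eq_left le_top] at h1
      refine ((ENNReal.continuous_rpow_const.tendsto _).comp h1).congr' ?_
      filter_upwards [eventually_ge_atTop (spanningSetsIndex ω x)] with n hn
      rw [indicator_of_mem]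
      · rfl
      · exact monotone_spanningSets ω hn (mem_spanningSetsIndex ω x)
  have hMlim : ∀ t, Tendsto (fun n => Mn n t) atTop (𝓝 (σ (Iic t))) := by
    intro t
    rw [← Measure.iSup_restrict_spanningSets (μ := σ) (Iic t)]
    exact tendsto_atTop_iSup (hMmono t)
  have hprodmono : ∀ t, Monotone fun n => Vn n t ^ (r / q) * Mn n t ^ (r / q') := fun t m n hmn =>
    mul_le_mul' (ENNReal.rpow_le_rpow (hVmono t hmn) hrq0.le)
      (ENNReal.rpow_le_rpow (hMmono t hmn) hrq'0.le)
  have hprodlim : ∀ t, Tendsto (fun n => Vn n t ^ (r / q) * Mn n t ^ (r / q')) atTop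
      (𝓝 (V t ^ (r / q) * σ (Iic t) ^ (r / q'))) := fun t =>
    tendsto_mul_of_monotone (fun m n hmn => ENNReal.rpow_le_rpow (hVmono t hmn) hrq0.le)
      (fun m n hmn => ENNReal.rpow_le_rpow (hMmono t hmn) hrq'0.le)
      ((ENNReal.continuous_rpow_const.tendsto _).comp (hVlim t))
      ((ENNReal.continuous_rpow_const.tendsto _).comp (hMlim t))
  have hlim : Tendsto (fun n => ∫⁻ t, (A n).indicator
      (fun t => Vn n t ^ (r / q) * Mn n t ^ (r / q')) t ∂σ) atTop
      (𝓝 (∫⁻ t, V t ^ (r / q) * σ (Iic t) ^ (r / q') ∂σ)) := by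
    refine lintegral_tendsto_of_tendsto_of_monotone
      (fun n => ((((hVnm n).pow_const _).mul ((hMnm n).pow_const _)).indicator
        (hAm n)).aemeasurable) (ae_of_all _ fun t m n hmn => ?_) (ae_of_all _ fun t => ?_)
    · exact indicator_le_indicator_of_subset_of_le (monotone_spanningSets σ hmn)
        (hprodmono t hmn)
    · refine (hprodlim t).congr' ?_
      filter_upwards [eventually_ge_atTop (spanningSetsIndex σ t)] with n hn
      rw [indicator_of_mem]
      exact monotone_spanningSets σ hn (mem_spanningSetsIndex σ t)
  refine le_of_tendsto ((ENNReal.continuous_rpow_const.tendsto _).comp hlim)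
    (Eventually.of_forall fun n => ?_)
  have := hJn n
  rwa [← lintegral_indicator (hAm n)] at this

/-- The dual operator of `kernelOp σ k` has the same bound. -/
theorem dual_kernelOp_le {p p' q q' : ℝ} (hp : p.HolderConjugate p') (hq : q.HolderConjugate q')
    {σ ω : Measure α} [SigmaFinite σ] [SFinite ω] {k : α → α → ℝ≥0∞} {N : ℝ≥0∞}
    (hk : Measurable (Function.uncurry k))
    (hN : ∀ f : α → ℝ≥0∞, Measurable f → ∫⁻ x, f x ^ p ∂σ ≠ ∞ →
        (∫⁻ x, kernelOp σ k f x ^ q ∂ω) ^ (1 / q) ≤ N * (∫⁻ x, f x ^ p ∂σ) ^ (1 / p))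
    {h : α → ℝ≥0∞} (hh : Measurable h) :
    (∫⁻ y, (∫⁻ x in Ici y, h x * k y x ∂ω) ^ p' ∂σ) ^ (1 / p') ≤
      N * (∫⁻ x, h x ^ q' ∂ω) ^ (1 / q') := by
  have hGm : Measurable (Function.uncurry fun y x : α => h x * k y x) :=
    (hh.comp measurable_snd).mul hk
  refine lintegral_rpow_le_of_forall_lintegral_mul_le hp
    (measurable_setLIntegral_Ici hGm) fun f hf hfin => ?_
  calc ∫⁻ y, f y * ∫⁻ x in Ici y, h x * k y x ∂ω ∂σ
      = ∫⁻ y, ∫⁻ x in Ici y, h x * (f y * k y x) ∂ω ∂σ := by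
        refine lintegral_congr fun y => ?_
        rw [← lintegral_const_mul]
        · exact lintegral_congr fun x => by ring
        · exact hGm.of_uncurry_left
    _ = ∫⁻ x, ∫⁻ y in Iic x, h x * (f y * k y x) ∂σ ∂ω := by
        refine (lintegral_setLIntegral_Iic_swap (G := fun x y => h x * (f y * k y x)) ?_).symm
        exact (hh.comp measurable_fst).mul ((hf.comp measurable_snd).mul (hk.comp measurable_swap))
    _ = ∫⁻ x, h x * kernelOp σ k f x ∂ω := by
        refine lintegral_congr fun x => ?_
        exact lintegral_const_mul _ (hf.mul hk.of_uncurry_right)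
    _ ≤ (∫⁻ x, h x ^ q' ∂ω) ^ (1 / q') * (∫⁻ x, kernelOp σ k f x ^ q ∂ω) ^ (1 / q) :=
        ENNReal.lintegral_mul_le_Lp_mul_Lq ω hq.symm hh.aemeasurable
          (measurable_kernelOp hk hf).aemeasurable
    _ ≤ (∫⁻ x, h x ^ q' ∂ω) ^ (1 / q') * (N * (∫⁻ x, f x ^ p ∂σ) ^ (1 / p)) := by
        gcongr
        exact hN f hf hfin
    _ = _ := by ring

/-- Necessity for `q < p` of the condition in terms of `∫_{y ≤ t} k(y, t) ^ p' dσ(y)`: the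
previous condition for the dual operator on the dual order. -/
theorem exists_le_of_kernelOp_le_dual {p p' q q' r : ℝ} (hp : p.HolderConjugate p')
    (hq : q.HolderConjugate q') (hqp : q < p) (hr : 1 / r = 1 / q - 1 / p) :
    ∃ C : ℝ≥0∞, C ≠ ∞ ∧ ∀ (σ ω : Measure α) [SigmaFinite σ] [SigmaFinite ω] (k : α → α → ℝ≥0∞)
      (N : ℝ≥0∞), Measurable (Function.uncurry k) → (∀ y, Monotone (k y)) →
      (∀ f : α → ℝ≥0∞, Measurable f → ∫⁻ x, f x ^ p ∂σ ≠ ∞ →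
        (∫⁻ x, kernelOp σ k f x ^ q ∂ω) ^ (1 / q) ≤ N * (∫⁻ x, f x ^ p ∂σ) ^ (1 / p)) →
      (∫⁻ t, (∫⁻ y in Iic t, k y t ^ p' ∂σ) ^ (r / p') * ω (Ici t) ^ (r / p) ∂ω) ^ (1 / r) ≤
        C * N := by
  have h1 : 1 / p' = 1 - 1 / p := by rw [one_div, one_div, hp.one_sub_inv]
  have h2 : 1 / q' = 1 - 1 / q := by rw [one_div, one_div, hq.one_sub_inv]
  have hlt : p' < q' := by
    have : 1 / q' < 1 / p' := by
      rw [h1, h2]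
      have := one_div_lt_one_div_of_lt hq.pos hqp
      linarith
    exact lt_of_one_div_lt_one_div hq.symm.pos this
  obtain ⟨C, hC, h⟩ := exists_le_of_kernelOp_le (α := αᵒᵈ) hq.symm hp.symm hlt
    (by rw [hr, h1, h2]; ring : 1 / r = 1 / p' - 1 / q')
  refine ⟨C, hC, fun σ ω _ _ k N hk hmono hN => ?_⟩
  have : @SigmaFinite αᵒᵈ _ ω := ‹SigmaFinite ω›
  have : @SigmaFinite αᵒᵈ _ σ := ‹SigmaFinite σ›
  exact h ω σ (fun x y => k y x) N (hk.comp measurable_swap) (fun y x x' hxx => hmono y hxx)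
    fun f hf _ => dual_kernelOp_le hp hq hk hN hf

end Order

/-! ### Functionals equivalent to norms -/

/-- Converse of Hölder's inequality on a set, with a constant factor which may be infinite. -/
theorem rpow_setLIntegral_mul_le {α : Type*} [MeasurableSpace α] {σ : Measure α} [SigmaFinite σ]
    {p p' : ℝ} (hp : p.HolderConjugate p') {g : α → ℝ≥0∞} (hg : Measurable g) {E : Set α}
    (hE : MeasurableSet E) {c N : ℝ≥0∞}
    (h : ∀ f : α → ℝ≥0∞, Measurable f → ∫⁻ x, f x ^ p ∂σ ≠ ∞ →
      (∫⁻ x in E, f x * g x ∂σ) * c ≤ N * (∫⁻ x, f x ^ p ∂σ) ^ (1 / p)) :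
    (∫⁻ x in E, g x ^ p' ∂σ) ^ (1 / p') * c ≤ N := by
  have hp'0 := hp.symm.pos
  have h1 := lintegral_rpow_le_of_forall_lintegral_mul_le hp (σ := σ)
    (g := E.indicator fun x => g x * c) (c := N) ((hg.mul_const c).indicator hE) ?_
  · have h2 : ∫⁻ x, E.indicator (fun x => g x * c) x ^ p' ∂σ =
        (∫⁻ x in E, g x ^ p' ∂σ) * c ^ p' := by
      rw [← lintegral_mul_const _ (hg.pow_const _), ← lintegral_indicator hE]
      refine lintegral_congr fun x => ?_
      by_cases hx : x ∈ E
      · simp [hx, ENNReal.mul_rpow_of_nonneg _ _ hp'0.le]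
      · simp [hx, hp'0]
    rwa [h2, ENNReal.mul_rpow_of_nonneg _ _ (by positivity), ← ENNReal.rpow_mul,
      mul_one_div_cancel hp'0.ne', ENNReal.rpow_one] at h1
  · intro f hf hfin
    refine le_of_eq_of_le ?_ (h f hf hfin)
    have hfg : Measurable fun x => f x * g x := hf.mul hg
    rw [← lintegral_mul_const _ hfg, ← lintegral_indicator hE]
    refine lintegral_congr fun x => ?_
    by_cases hx : x ∈ E
    · simp [hx, mul_assoc]
    · simp [hx]

/-- If `c k` is a lower bound of `S` on `E`, then the `L^q` norm of `S` is at least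
`c ‖k‖_{L^q(E)}`. -/
theorem mul_rpow_setLIntegral_le {α : Type*} [MeasurableSpace α] {ω : Measure α} {q : ℝ}
    (hq : 0 < q) {E : Set α} (hE : MeasurableSet E) {c : ℝ≥0∞} {k S : α → ℝ≥0∞}
    (hk : Measurable k) (h : ∀ x ∈ E, c * k x ≤ S x) :
    c * (∫⁻ x in E, k x ^ q ∂ω) ^ (1 / q) ≤ (∫⁻ x, S x ^ q ∂ω) ^ (1 / q) := by
  calc c * (∫⁻ x in E, k x ^ q ∂ω) ^ (1 / q)
      = (∫⁻ x in E, (c * k x) ^ q ∂ω) ^ (1 / q) := by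
        simp_rw [ENNReal.mul_rpow_of_nonneg _ _ hq.le]
        rw [lintegral_const_mul _ (hk.pow_const _), ENNReal.mul_rpow_of_nonneg _ _ (by positivity),
          ← ENNReal.rpow_mul, mul_one_div_cancel hq.ne', ENNReal.rpow_one]
    _ ≤ _ := ENNReal.rpow_le_rpow ((setLIntegral_mono' hE fun x hx =>
        ENNReal.rpow_le_rpow (h x hx) hq.le).trans (setLIntegral_le_lintegral _ _)) (by positivity)

/-- `H` is equivalent, uniformly in the measures, to the norm of the Hardy operator
`f ↦ ∫_{y ≤ x} f(y) dμ(y)` from `L^p(μ)` to `L^q(ν)`. -/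
def IsHardyFunctional {α : Type*} [LinearOrder α] [MeasurableSpace α] (p q : ℝ)
    (H : Measure α → Measure α → ℝ≥0∞) : Prop :=
  ∃ C : ℝ≥0∞, C ≠ ∞ ∧ ∀ (μ ν : Measure α) [SigmaFinite μ] [SigmaFinite ν],
    (H μ ν ≠ ∞ → ∀ f : α → ℝ≥0∞, Measurable f →
      (∫⁻ x, (∫⁻ y in Iic x, f y ∂μ) ^ q ∂ν) ^ (1 / q) ≤
        C * H μ ν * (∫⁻ x, f x ^ p ∂μ) ^ (1 / p)) ∧
    ∀ N : ℝ≥0∞, (∀ f : α → ℝ≥0∞, Measurable f → ∫⁻ x, f x ^ p ∂μ ≠ ∞ →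
      (∫⁻ x, (∫⁻ y in Iic x, f y ∂μ) ^ q ∂ν) ^ (1 / q) ≤ N * (∫⁻ x, f x ^ p ∂μ) ^ (1 / p)) →
      H μ ν ≤ C * N

/-- `O` is equivalent, uniformly in the measures and in the Oinarov kernel, to the norm of the
operator with this kernel from `L^p(σ)` to `L^q(ω)`. -/
def IsOinarovFunctional {α : Type*} [LinearOrder α] [MeasurableSpace α] (p q : ℝ)
    (O : Measure α → Measure α → (α → α → ℝ≥0∞) → ℝ≥0∞) : Prop :=
  ∃ C : ℝ≥0∞, C ≠ ∞ ∧ ∀ (σ ω : Measure α) [SigmaFinite σ] [SigmaFinite ω]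
    (k : α → α → ℝ≥0∞), IsOinarovKernel k →
    (O σ ω k ≠ ∞ → ∀ f : α → ℝ≥0∞, Measurable f → ∫⁻ x, f x ^ p ∂σ ≠ ∞ →
      (∫⁻ x, kernelOp σ k f x ^ q ∂ω) ^ (1 / q) ≤
        C * O σ ω k * (∫⁻ x, f x ^ p ∂σ) ^ (1 / p)) ∧
    ∀ N : ℝ≥0∞, (∀ f : α → ℝ≥0∞, Measurable f → ∫⁻ x, f x ^ p ∂σ ≠ ∞ →
      (∫⁻ x, kernelOp σ k f x ^ q ∂ω) ^ (1 / q) ≤ N * (∫⁻ x, f x ^ p ∂σ) ^ (1 / p)) →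
      O σ ω k ≤ C * N

/-- Muckenhoupt's quantity for Hardy's inequality with `p ≤ q`. -/
noncomputable def hardySup {α : Type*} [Preorder α] [MeasurableSpace α] (p' q : ℝ)
    (μ ν : Measure α) : ℝ≥0∞ :=
  ⨆ x, μ (Iic x) ^ (1 / p') * ν (Ici x) ^ (1 / q)

/-- Maz'ya's quantity for Hardy's inequality with `q < p`. -/
noncomputable def hardyInt {α : Type*} [Preorder α] [MeasurableSpace α] (p p' r : ℝ)
    (μ ν : Measure α) : ℝ≥0∞ :=
  (∫⁻ x, μ (Iic x) ^ (r / p') * ν (Ici x) ^ (r / p) ∂ν) ^ (1 / r)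

/-- The sum of the two quantities which characterize boundedness for `p ≤ q`. -/
noncomputable def oinarovSup {α : Type*} [Preorder α] [MeasurableSpace α] (p' q : ℝ)
    (σ ω : Measure α) (k : α → α → ℝ≥0∞) : ℝ≥0∞ :=
  (⨆ t, (∫⁻ y in Iic t, k y t ^ p' ∂σ) ^ (1 / p') * ω (Ici t) ^ (1 / q)) +
    ⨆ t, σ (Iic t) ^ (1 / p') * (∫⁻ x in Ici t, k t x ^ q ∂ω) ^ (1 / q)

/-- The sum of the two quantities which characterize boundedness for `q < p`. -/
noncomputable def oinarovInt {α : Type*} [Preorder α] [MeasurableSpace α] (p p' q q' r : ℝ)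
    (σ ω : Measure α) (k : α → α → ℝ≥0∞) : ℝ≥0∞ :=
  (∫⁻ t, (∫⁻ x in Ici t, k t x ^ q ∂ω) ^ (r / q) * σ (Iic t) ^ (r / q') ∂σ) ^ (1 / r) +
    (∫⁻ t, (∫⁻ y in Iic t, k y t ^ p' ∂σ) ^ (r / p') * ω (Ici t) ^ (r / p) ∂ω) ^ (1 / r)

section Order

variable {α : Type*} [LinearOrder α] [TopologicalSpace α] [OrderTopology α]
  [SecondCountableTopology α] [MeasurableSpace α] [BorelSpace α]

theorem isHardyFunctional_hardySup {p p' q : ℝ} (hp : p.HolderConjugate p') (hpq : p ≤ q) :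
    IsHardyFunctional (α := α) p q (hardySup p' q) := by
  have hq0 : 0 < q := hp.pos.trans_le hpq
  obtain ⟨C, hC, h⟩ := exists_hardy_le_of_le (α := α) hp hpq
  refine ⟨C + 1, ENNReal.add_ne_top.2 ⟨hC, ENNReal.one_ne_top⟩, fun μ ν _ _ => ⟨?_, ?_⟩⟩
  · intro hH f hf
    refine (h μ ν _ hH (fun x => le_iSup (fun x =>
      μ (Iic x) ^ (1 / p') * ν (Ici x) ^ (1 / q)) x) f hf).trans ?_
    exact mul_le_mul_left (mul_le_mul_left le_self_add _) _
  · intro N hN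
    refine le_trans (iSup_le fun x => ?_) (le_mul_of_one_le_left zero_le le_add_self)
    have h1 := rpow_setLIntegral_mul_le hp (σ := μ) (g := fun _ => 1) measurable_const
      (E := Iic x) measurableSet_Iic (c := ν (Ici x) ^ (1 / q)) (N := N) fun f hf hfin => ?_
    · simpa using h1
    refine le_trans ?_ (hN f hf hfin)
    have h2 := mul_rpow_setLIntegral_le (ω := ν) hq0 (E := Ici x) measurableSet_Ici
      (c := ∫⁻ y in Iic x, f y ∂μ) (k := fun _ => 1) measurable_const
      (S := fun z => ∫⁻ y in Iic z, f y ∂μ) fun z hz => by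
        rw [mul_one]; exact lintegral_mono_set (Iic_subset_Iic.2 hz)
    simpa using h2

theorem isHardyFunctional_hardyInt {p p' q q' r : ℝ} (hp : p.HolderConjugate p')
    (hq : q.HolderConjugate q') (hqp : q < p) (hr : 1 / r = 1 / q - 1 / p) :
    IsHardyFunctional (α := α) p q (hardyInt p p' r) := by
  obtain ⟨C, hC, h⟩ := exists_hardy_le_of_lt (α := α) hp hq hqp hr
  obtain ⟨C', hC', h'⟩ := exists_le_of_kernelOp_le_dual (α := α) hp hq hqp hr
  refine ⟨C + C', ENNReal.add_ne_top.2 ⟨hC, hC'⟩, fun μ ν _ _ => ⟨?_, ?_⟩⟩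
  · intro hH f hf
    refine (h μ ν _ hH le_rfl f hf).trans ?_
    exact mul_le_mul_left (mul_le_mul_left le_self_add _) _
  · intro N hN
    have h1 := h' μ ν (fun _ _ => 1) N measurable_const (fun _ => monotone_const)
      (fun f hf hfin => by simpa [kernelOp] using hN f hf hfin)
    refine le_trans ?_ (h1.trans (mul_le_mul_left le_add_self _))
    simp [hardyInt]

theorem isOinarovFunctional_oinarovSup {p p' q : ℝ} (hp : p.HolderConjugate p') (hpq : p ≤ q) :
    IsOinarovFunctional (α := α) p q (oinarovSup p' q) := by
  have hq0 : 0 < q := hp.pos.trans_le hpq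
  obtain ⟨C, hC, h⟩ := exists_kernelOp_le_of_le (α := α) hp hpq
  refine ⟨C + 2, ENNReal.add_ne_top.2 ⟨hC, ENNReal.ofNat_ne_top⟩, fun σ ω _ _ k hk => ⟨?_, ?_⟩⟩
  · intro hO f hf hfin
    refine (h σ ω k (oinarovSup p' q σ ω k) hk hO (fun t => ?_) (fun t => ?_) f hf hfin).trans ?_
    · exact (le_iSup (fun t => (∫⁻ y in Iic t, k y t ^ p' ∂σ) ^ (1 / p') *
        ω (Ici t) ^ (1 / q)) t).trans le_self_add
    · exact (le_iSup (fun t => σ (Iic t) ^ (1 / p') *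
        (∫⁻ x in Ici t, k t x ^ q ∂ω) ^ (1 / q)) t).trans le_add_self
    · exact mul_le_mul_left (mul_le_mul_left le_self_add _) _
  · intro N hN
    refine le_trans ?_ (mul_le_mul_left (le_add_self : (2 : ℝ≥0∞) ≤ C + 2) N)
    rw [two_mul]
    refine add_le_add (iSup_le fun t => ?_) (iSup_le fun t => ?_)
    · refine rpow_setLIntegral_mul_le hp (hk.measurable_left t) measurableSet_Iic
        fun f hf hfin => le_trans ?_ (hN f hf hfin)
      have h2 := mul_rpow_setLIntegral_le (ω := ω) hq0 (E := Ici t) measurableSet_Ici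
        (c := ∫⁻ y in Iic t, f y * k y t ∂σ) (k := fun _ => 1) measurable_const
        (S := kernelOp σ k f) fun z hz => by
          rw [mul_one]; exact monotone_kernelOp hk hz
      simpa using h2
    · have h1 := rpow_setLIntegral_mul_le hp (σ := σ) (g := fun _ => 1) measurable_const
        (E := Iic t) measurableSet_Iic (c := (∫⁻ x in Ici t, k t x ^ q ∂ω) ^ (1 / q)) (N := N)
        fun f hf hfin => ?_
      · simpa using h1
      refine le_trans ?_ (hN f hf hfin)
      simp only [mul_one]
      refine mul_rpow_setLIntegral_le hq0 measurableSet_Ici hk.measurable.of_uncurry_left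
        fun z hz => ?_
      rw [← lintegral_mul_const _ hf]
      exact (setLIntegral_mono' measurableSet_Iic fun y hy =>
        mul_le_mul_right (hk.antitone z hy) _).trans (lintegral_mono_set (Iic_subset_Iic.2 hz))

theorem isOinarovFunctional_oinarovInt {p p' q q' r : ℝ} (hp : p.HolderConjugate p')
    (hq : q.HolderConjugate q') (hqp : q < p) (hr : 1 / r = 1 / q - 1 / p) :
    IsOinarovFunctional (α := α) p q (oinarovInt p p' q q' r) := by
  obtain ⟨C, hC, h⟩ := exists_kernelOp_le_of_lt (α := α) hp hq hqp hr
  obtain ⟨C₁, hC₁, h₁⟩ := exists_le_of_kernelOp_le (α := α) hp hq hqp hr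
  obtain ⟨C₂, hC₂, h₂⟩ := exists_le_of_kernelOp_le_dual (α := α) hp hq hqp hr
  refine ⟨C + (C₁ + C₂), ENNReal.add_ne_top.2 ⟨hC, ENNReal.add_ne_top.2 ⟨hC₁, hC₂⟩⟩,
    fun σ ω _ _ k hk => ⟨?_, ?_⟩⟩
  · intro hO f hf hfin
    refine (h σ ω k (oinarovInt p p' q q' r σ ω k) hk hO le_self_add le_add_self f hf
      hfin).trans ?_
    exact mul_le_mul_left (mul_le_mul_left le_self_add _) _
  · intro N hN
    refine le_trans ?_ (mul_le_mul_left (le_add_self : C₁ + C₂ ≤ C + (C₁ + C₂)) N)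
    rw [add_mul]
    exact add_le_add (h₁ σ ω k N hk.measurable hk.antitone hN)
      (h₂ σ ω k N hk.measurable hk.monotone hN)

end Order

/-! ### The measure `d(-φ)` -/

theorem tsum_min_sub_natCast (z : ℝ≥0∞) : ∑' n : ℕ, min (z - n) 1 = z := by
  by_cases hz : z = ∞
  · simp [hz]
  · exact tsum_layers z hz

/-- One layer of `φ(x) ≤ d(-φ)[x, ∞) + φ(∞) ≤ φ(s)`. -/
theorem measure_Ici_negLayer_add {φ : ℝ → ℝ≥0∞} (hφ : Antitone φ) {L : ℝ≥0∞}
    (hL : Tendsto φ atTop (𝓝 L)) (n : ℕ) (x : ℝ) :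
    min (φ x - n) 1 ≤ (negLayer_monotone hφ n).stieltjesFunction.measure (Ici x) +
        min (L - n) 1 ∧
      ∀ s < x, (negLayer_monotone hφ n).stieltjesFunction.measure (Ici x) + min (L - n) 1 ≤
        min (φ s - n) 1 := by
  have hfin : ∀ z : ℝ≥0∞, min (z - n) 1 ≠ ∞ := fun z =>
    ((min_le_right _ _).trans_lt ENNReal.one_lt_top).ne
  set m := negLayer_monotone hφ n
  set f := m.stieltjesFunction with hf
  set l : ℝ := -(min (L - n) 1).toReal with hl
  have hlim : Tendsto (negLayer φ n) atTop (𝓝 l) := by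
    have h1 : Tendsto (fun t => φ t - (n : ℝ≥0∞)) atTop (𝓝 (L - n)) :=
      ENNReal.Tendsto.sub hL tendsto_const_nhds (Or.inr (ENNReal.natCast_ne_top n))
    exact ((ENNReal.tendsto_toReal (hfin L)).comp (h1.min tendsto_const_nhds)).neg
  have hflim : Tendsto f atTop (𝓝 l) := by
    refine tendsto_of_tendsto_of_tendsto_of_le_of_le hlim
      (hlim.comp (tendsto_atTop_add_const_right atTop 1 tendsto_id)) (fun t => ?_) fun t => ?_
    · rw [hf, Monotone.stieltjesFunction_eq]; exact m.le_rightLim le_rfl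
    · rw [hf, Monotone.stieltjesFunction_eq]; exact m.rightLim_le (lt_add_one t)
  have hup : Function.leftLim f x ≤ negLayer φ n x := by
    refine le_of_tendsto (f.mono.tendsto_leftLim x) ?_
    filter_upwards [self_mem_nhdsWithin] with y hy
    rw [hf, Monotone.stieltjesFunction_eq]
    exact m.rightLim_le hy
  have hlow : ∀ s < x, negLayer φ n s ≤ Function.leftLim f x := fun s hs => by
    refine le_trans ?_ (f.mono.le_leftLim hs)
    rw [hf, Monotone.stieltjesFunction_eq]
    exact m.le_rightLim le_rfl
  have hl0 : min (L - n) 1 = ENNReal.ofReal (-l) := by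
    rw [hl, neg_neg, ENNReal.ofReal_toReal (hfin L)]
  have hle : ∀ t, negLayer φ n t ≤ l := fun t => m.ge_of_tendsto hlim t
  have hlx : Function.leftLim f x ≤ l := hup.trans (hle x)
  have hl1 : 0 ≤ -l := by rw [hl, neg_neg]; exact ENNReal.toReal_nonneg
  have hneg : ∀ t, min (φ t - n) 1 = ENNReal.ofReal (-negLayer φ n t) := fun t => by
    rw [negLayer, neg_neg, ENNReal.ofReal_toReal (hfin _)]
  have hsum : f.measure (Ici x) + min (L - n) 1 = ENNReal.ofReal (-Function.leftLim f x) := by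
    rw [f.measure_Ici hflim, hl0, ← ENNReal.ofReal_add (by linarith) hl1]
    congr 1; ring
  rw [hsum]
  refine ⟨?_, fun s hs => ?_⟩
  · rw [hneg]; exact ENNReal.ofReal_le_ofReal (neg_le_neg hup)
  · rw [hneg]; exact ENNReal.ofReal_le_ofReal (neg_le_neg (hlow s hs))

theorem negStieltjes_Ici_eq_tsum {φ : ℝ → ℝ≥0∞} (hφ : Antitone φ) {x : ℝ} (hx : 0 < x) :
    negStieltjes φ hφ (Ici x) =
      ∑' n, (negLayer_monotone hφ n).stieltjesFunction.measure (Ici x) := by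
  have hsub : Ici x ∩ Ioi 0 = Ici x := inter_eq_left.2 fun t ht => hx.trans_le ht
  rw [negStieltjes, Measure.restrict_apply measurableSet_Ici, hsub,
    Measure.sum_apply _ measurableSet_Ici]

/-- Together with `negStieltjes_Ici_add_le`, this is all that is used about `d(-φ)`: up to the
values at jumps, `φ(x)` is `d(-φ)[x, ∞) + φ(∞)`. -/
theorem le_negStieltjes_Ici_add {φ : ℝ → ℝ≥0∞} (hφ : Antitone φ) {L : ℝ≥0∞}
    (hL : Tendsto φ atTop (𝓝 L)) {x : ℝ} (hx : 0 < x) :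
    φ x ≤ negStieltjes φ hφ (Ici x) + L := by
  rw [negStieltjes_Ici_eq_tsum hφ hx, ← tsum_min_sub_natCast (φ x), ← tsum_min_sub_natCast L,
    ← ENNReal.tsum_add]
  exact ENNReal.tsum_le_tsum fun n => (measure_Ici_negLayer_add hφ hL n x).1

theorem negStieltjes_Ici_add_le {φ : ℝ → ℝ≥0∞} (hφ : Antitone φ) {L : ℝ≥0∞}
    (hL : Tendsto φ atTop (𝓝 L)) {s x : ℝ} (hx : 0 < x) (hs : s < x) :
    negStieltjes φ hφ (Ici x) + L ≤ φ s := by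
  rw [negStieltjes_Ici_eq_tsum hφ hx, ← tsum_min_sub_natCast (φ s), ← tsum_min_sub_natCast L,
    ← ENNReal.tsum_add]
  exact ENNReal.tsum_le_tsum fun n => (measure_Ici_negLayer_add hφ hL n x).2 s hs

theorem negStieltjes_Iic_zero {φ : ℝ → ℝ≥0∞} (hφ : Antitone φ) :
    negStieltjes φ hφ (Iic 0) = 0 := by
  have hemp : Iic (0 : ℝ) ∩ Ioi 0 = ∅ := by
    ext x; simp
  rw [negStieltjes, Measure.restrict_apply measurableSet_Iic, hemp, measure_empty]

theorem ae_pos_of_measure_Iic_zero {μ : Measure ℝ} (h : μ (Iic 0) = 0) : ∀ᵐ t ∂μ, 0 < t := by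
  rw [ae_iff]
  have : {t : ℝ | ¬ 0 < t} = Iic 0 := by ext t; simp
  rwa [this]

instance sFinite_negStieltjes {φ : ℝ → ℝ≥0∞} (hφ : Antitone φ) :
    SFinite (negStieltjes φ hφ) := by
  unfold negStieltjes; infer_instance

theorem negStieltjes_Ici_ne_top {φ : ℝ → ℝ≥0∞} (hφ : Antitone φ)
    (hfin : ∀ t, 0 < t → φ t ≠ ∞) {x : ℝ} (hx : 0 < x) :
    negStieltjes φ hφ (Ici x) ≠ ∞ :=
  ((le_self_add.trans (negStieltjes_Ici_add_le hφ (tendsto_atTop_iInf hφ) hx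
    (half_lt_self hx))).trans_lt (hfin _ (half_pos hx)).lt_top).ne

theorem sigmaFinite_negStieltjes {φ : ℝ → ℝ≥0∞} (hφ : Antitone φ)
    (hfin : ∀ t, 0 < t → φ t ≠ ∞) : SigmaFinite (negStieltjes φ hφ) := by
  refine ⟨⟨⟨fun n : ℕ => Iic 0 ∪ Ici (1 / ((n : ℝ) + 1)), fun _ => trivial, fun n => ?_, ?_⟩⟩⟩
  · refine (measure_union_le _ _).trans_lt ?_
    rw [negStieltjes_Iic_zero, zero_add]
    exact (negStieltjes_Ici_ne_top hφ hfin (by positivity)).lt_top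
  · refine eq_univ_of_forall fun x => ?_
    rcases le_or_gt x 0 with hx | hx
    · exact mem_iUnion.2 ⟨0, Or.inl hx⟩
    · obtain ⟨n, hn⟩ := exists_nat_one_div_lt hx
      exact mem_iUnion.2 ⟨n, Or.inr hn.le⟩

theorem tailSup_rpow (f : ℝ → ℝ≥0∞) {s : ℝ} (hs : 0 < s) (t : ℝ) :
    tailSup (fun t => f t ^ s) t = tailSup f t ^ s := by
  have := fun (ι : Type) (g : ι → ℝ≥0∞) => ((ENNReal.orderIsoRpow s hs).map_iSup g)
  simp only [ENNReal.orderIsoRpow_apply] at this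
  simp only [tailSup]
  rw [this]
  refine iSup_congr fun τ => ?_
  by_cases h0 : 0 < τ
  · by_cases h1 : t ≤ τ
    · simp [h0, h1]
    · simp [h0, h1, hs]
  · simp [h0, hs]

theorem tailSup_mul_const (f : ℝ → ℝ≥0∞) (c : ℝ≥0∞) (t : ℝ) :
    tailSup (fun t => f t * c) t = tailSup f t * c := by
  simp only [tailSup, ENNReal.iSup_mul]

theorem limTailSup_le (f : ℝ → ℝ≥0∞) (t : ℝ) : limTailSup f ≤ tailSup f t :=
  (tailSup_antitone f).le_of_tendsto (tendsto_tailSup f) t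

/-- The limit at infinity of the tail supremum commutes with a positive power. -/
theorem limTailSup_rpow (f : ℝ → ℝ≥0∞) {s : ℝ} (hs : 0 < s) :
    limTailSup (fun t => f t ^ s) = limTailSup f ^ s := by
  refine tendsto_nhds_unique (tendsto_tailSup _) ?_
  simp only [funext (tailSup_rpow f hs)]
  exact (ENNReal.continuous_rpow_const.tendsto _).comp (tendsto_tailSup f)

/-! ### The supremum beyond `t` -/

theorem le_tailSup {f : ℝ → ℝ≥0∞} {t τ : ℝ} (hτ : 0 < τ) (h : t ≤ τ) :
    f τ ≤ tailSup f t :=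
  le_iSup_of_le τ (le_iSup_of_le hτ (le_iSup (fun _ : t ≤ τ => f τ) h))

theorem measurable_tailSup (f : ℝ → ℝ≥0∞) : Measurable (tailSup f) :=
  (tailSup_antitone f).measurable

/-- The supremum defining the operator at `t` is split at `t`. Beyond `t`, Hölder's inequality
applies with a majorant `Φ` of `y ↦ sup_{τ ≥ y} ρ(τ) ^ p' σ(-∞, τ]`. -/
theorem tailSup_mul_le_add {p p' : ℝ} (hp : p.HolderConjugate p') {σ : Measure ℝ}
    {ρ f Φ : ℝ → ℝ≥0∞} (hf : Measurable f) {t : ℝ}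
    (hΦ : ∀ y, t < y → ∀ τ, y ≤ τ → ρ τ ^ p' * σ (Iic τ) ≤ Φ y) :
    tailSup (fun τ => ρ τ * ∫⁻ y in Iic τ, f y ∂σ) t ≤
      tailSup ρ t * ∫⁻ y in Iic t, f y ∂σ +
        (∫⁻ y in Ioi t, f y ^ p * Φ y ^ (p - 1) ∂σ) ^ (1 / p) := by
  have hp0 := hp.pos
  have hp1 := hp.lt
  have hp'0 := hp.symm.pos
  refine iSup_le fun τ => iSup_le fun hτ => iSup_le fun htτ => ?_
  have hsplit : ∫⁻ y in Iic τ, f y ∂σ = ∫⁻ y in Iic t, f y ∂σ + ∫⁻ y in Ioc t τ, f y ∂σ := by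
    rw [← Iic_union_Ioc_eq_Iic htτ, lintegral_union measurableSet_Ioc]
    exact Set.disjoint_left.2 fun y hy hy' => not_lt.2 hy hy'.1
  simp only
  rw [hsplit, mul_add]
  refine add_le_add (mul_le_mul_left (le_tailSup hτ htτ) _) ?_
  rw [one_div, ENNReal.le_rpow_inv_iff hp0]
  have hpp : p / p' = p - 1 := hp.div_conj_eq_sub_one
  have hconst : (ρ τ * σ (Iic τ) ^ (1 / p')) ^ p = (ρ τ ^ p' * σ (Iic τ)) ^ (p - 1) := by
    rw [ENNReal.mul_rpow_of_nonneg _ _ hp0.le, ENNReal.mul_rpow_of_nonneg _ _ (by linarith),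
      ← ENNReal.rpow_mul, ← ENNReal.rpow_mul, one_div_mul_eq_div, hpp, mul_comm p',
      hp.sub_one_mul_conj]
  calc (ρ τ * ∫⁻ y in Ioc t τ, f y ∂σ) ^ p
      ≤ (ρ τ * ((∫⁻ y in Ioc t τ, f y ^ p ∂σ) ^ (1 / p) * σ (Iic τ) ^ (1 / p'))) ^ p := by
        refine ENNReal.rpow_le_rpow (mul_le_mul_right ?_ _) hp0.le
        refine (setLIntegral_rpow_holder σ hp hf.aemeasurable _).trans (mul_le_mul_right ?_ _)
        exact ENNReal.rpow_le_rpow (measure_mono Ioc_subset_Iic_self) (by positivity)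
    _ = (∫⁻ y in Ioc t τ, f y ^ p ∂σ) * (ρ τ ^ p' * σ (Iic τ)) ^ (p - 1) := by
        rw [← hconst, mul_left_comm, ENNReal.mul_rpow_of_nonneg _ _ hp0.le, ← ENNReal.rpow_mul,
          one_div_mul_cancel hp0.ne', ENNReal.rpow_one]
    _ = ∫⁻ y in Ioc t τ, f y ^ p * (ρ τ ^ p' * σ (Iic τ)) ^ (p - 1) ∂σ :=
        (lintegral_mul_const _ (hf.pow_const _)).symm
    _ ≤ ∫⁻ y in Ioc t τ, f y ^ p * Φ y ^ (p - 1) ∂σ := by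
        refine setLIntegral_mono' measurableSet_Ioc fun y hy => mul_le_mul_right ?_ _
        exact ENNReal.rpow_le_rpow (hΦ y hy.1 τ hy.2) (by linarith)
    _ ≤ _ := lintegral_mono_set Ioc_subset_Ioi_self

theorem measurable_measure_Ici (μ : Measure ℝ) : Measurable fun y => μ (Ici y) :=
  measurable_measure_Iic (α := ℝᵒᵈ) μ

/-- The function on the scale of `μ` which corresponds to `f`: with `Φ y = μ [y, ∞) + L`, it is
`τ ↦ (∫_{y ≤ τ} f ^ p / Φ dσ) ^ (1 / p)`. -/
noncomputable def scaleTransfer (p : ℝ) (σ μ : Measure ℝ) (L : ℝ≥0∞) (f : ℝ → ℝ≥0∞) (τ : ℝ) :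
    ℝ≥0∞ :=
  (∫⁻ y in Iic τ, (f y * (μ (Ici y) + L) ^ (-(1 / p))) ^ p ∂σ) ^ (1 / p)

theorem measurable_scaleTransfer (p : ℝ) (σ μ : Measure ℝ) (L : ℝ≥0∞) (f : ℝ → ℝ≥0∞) :
    Measurable (scaleTransfer p σ μ L f) :=
  (measurable_setLIntegral_Iic' σ _).pow_const _

/-- The transferred function has at most the norm of `f`: by Tonelli's theorem, `f ^ p / Φ` is
integrated against `μ [y, ∞) ≤ Φ y`. -/
theorem lintegral_scaleTransfer_rpow_le {p : ℝ} (hp : 1 < p) {σ μ : Measure ℝ} [SFinite σ]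
    [SFinite μ] {L : ℝ≥0∞} {f : ℝ → ℝ≥0∞} (hf : Measurable f) :
    ∫⁻ τ, scaleTransfer p σ μ L f τ ^ p ∂μ ≤ ∫⁻ y, f y ^ p ∂σ := by
  have hp0 : 0 < p := by linarith
  have hΦm : Measurable fun y => μ (Ici y) + L := (measurable_measure_Ici μ).add_const L
  have hm : Measurable fun y => (f y * (μ (Ici y) + L) ^ (-(1 / p))) ^ p :=
    (hf.mul (hΦm.pow_const _)).pow_const _
  simp only [scaleTransfer, ← ENNReal.rpow_mul, one_div_mul_cancel hp0.ne', ENNReal.rpow_one]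
  rw [lintegral_setLIntegral_Iic_swap (G := fun _ y => (f y * (μ (Ici y) + L) ^ (-(1 / p))) ^ p)
    (hm.comp measurable_snd)]
  refine lintegral_mono fun y => ?_
  rw [setLIntegral_const, ENNReal.mul_rpow_of_nonneg _ _ hp0.le, ← ENNReal.rpow_mul, mul_assoc,
    neg_mul, one_div_mul_cancel hp0.ne', ENNReal.rpow_neg_one]
  refine mul_le_of_le_one_right zero_le ?_
  exact (mul_le_mul_right le_self_add _).trans (ENNReal.inv_mul_le_one _)

/-- Minkowski's inequality turns the weight `Φ ^ (p - 1)`, where `Φ y = μ [y, ∞) + L`, into an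
integral with respect to `μ`. -/
theorem rpow_setLIntegral_Ioi_le {p p' : ℝ} (hp : p.HolderConjugate p') {σ μ : Measure ℝ}
    [SigmaFinite σ] [SFinite μ] {L : ℝ≥0∞} {f : ℝ → ℝ≥0∞} (hf : Measurable f) {t : ℝ}
    (hfin : ∀ y, t < y → μ (Ici y) + L ≠ ∞) :
    (∫⁻ y in Ioi t, f y ^ p * (μ (Ici y) + L) ^ (p - 1) ∂σ) ^ (1 / p) ≤
      ∫⁻ τ in Ioi t, scaleTransfer p σ μ L f τ ∂μ +
        L ^ (1 / p') * (∫⁻ y, f y ^ p ∂σ) ^ (1 / p) := by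
  have hp0 := hp.pos
  have hp1 := hp.lt
  have hp'0 := hp.symm.pos
  set Φ : ℝ → ℝ≥0∞ := fun y => μ (Ici y) + L with hΦ
  have hΦm : Measurable Φ := (measurable_measure_Ici μ).add_const L
  set e : ℝ → ℝ≥0∞ := fun y => f y * Φ y ^ (-(1 / p)) with he
  have hem : Measurable e := hf.mul (hΦm.pow_const _)
  -- `Φ ^ ((p - 1) / p) = Φ ^ (-1 / p) Φ`, and one of these factors is written as an integral
  have hΦ1 : ∀ y, t < y → Φ y ^ (p - 1) = (Φ y ^ (-(1 / p)) * Φ y) ^ p := by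
    intro y hy
    by_cases h0 : Φ y = 0
    · rw [h0, mul_zero, ENNReal.zero_rpow_of_pos hp0, ENNReal.zero_rpow_of_pos (by linarith)]
    · rw [ENNReal.mul_rpow_of_nonneg _ _ hp0.le, ← ENNReal.rpow_mul,
        ← ENNReal.rpow_add _ _ h0 (hfin y hy)]
      congr 1; field_simp; ring
  have h1 : ∫⁻ y in Ioi t, f y ^ p * Φ y ^ (p - 1) ∂σ =
      ∫⁻ y in Ioi t, ((fun y => e y * μ (Ici y)) + fun y => e y * L) y ^ p ∂σ := by
    refine setLIntegral_congr_fun measurableSet_Ioi fun y hy => ?_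
    simp only [Pi.add_apply]
    rw [← mul_add, he, hΦ1 y hy, ← ENNReal.mul_rpow_of_nonneg _ _ hp0.le, mul_assoc]
  rw [h1]
  refine (ENNReal.lintegral_Lp_add_le (hem.mul (measurable_measure_Ici μ)).aemeasurable
    (hem.mul_const L).aemeasurable hp1.le).trans (add_le_add ?_ ?_)
  · set K : ℝ → ℝ → ℝ≥0∞ := fun y τ => {z : ℝ × ℝ | z.1 ≤ z.2}.indicator (fun z => e z.1) (y, τ)
      with hK
    have hKm : Measurable (Function.uncurry K) :=
      (hem.comp measurable_fst).indicator (measurableSet_le measurable_fst measurable_snd)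
    have hK1 : ∀ y, ∫⁻ τ, K y τ ∂μ = e y * μ (Ici y) := by
      intro y
      rw [← setLIntegral_const, ← lintegral_indicator measurableSet_Ici]
      rfl
    have hK3 : ∫⁻ y in Ioi t, (e y * μ (Ici y)) ^ p ∂σ =
        ∫⁻ y in Ioi t, (∫⁻ τ, K y τ ∂μ) ^ p ∂σ := lintegral_congr fun y => by rw [hK1]
    refine (ENNReal.rpow_le_rpow hK3.le (by positivity)).trans ?_
    refine (minkowski_lintegral hp hKm).trans ?_
    rw [← lintegral_indicator measurableSet_Ioi]
    refine lintegral_mono fun τ => ?_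
    have hK2 : ∫⁻ y in Ioi t, K y τ ^ p ∂σ = ∫⁻ y in Ioi t ∩ Iic τ, e y ^ p ∂σ := by
      rw [inter_comm, ← Measure.restrict_restrict measurableSet_Iic,
        ← lintegral_indicator measurableSet_Iic]
      refine lintegral_congr fun y => ?_
      by_cases hy : y ≤ τ
      · simp [hK, hy]
      · simp [hK, hy, hp0]
    rw [hK2]
    by_cases hτ : t < τ
    · rw [indicator_of_mem (show τ ∈ Ioi t from hτ), scaleTransfer]
      exact ENNReal.rpow_le_rpow (lintegral_mono_set inter_subset_right) (by positivity)
    · have hemp : Ioi t ∩ Iic τ = ∅ := by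
        ext y; simp only [mem_inter_iff, mem_Ioi, mem_Iic, mem_empty_iff_false, iff_false]
        intro hy; exact hτ (hy.1.trans_le hy.2)
      rw [hemp]
      simp [hp0]
  · have h2 : ∀ y, (e y * L) ^ p ≤ L ^ (p - 1) * f y ^ p := by
      intro y
      have h3 : (Φ y ^ (-(1 / p)) * L) ^ p ≤ L ^ (p - 1) := by
        rw [ENNReal.mul_rpow_of_nonneg _ _ hp0.le, ← ENNReal.rpow_mul, neg_mul,
          one_div_mul_cancel hp0.ne', ENNReal.rpow_neg_one]
        have h4 : L ^ p = L * L ^ (p - 1) := by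
          conv_rhs => rw [← ENNReal.rpow_one L, ← ENNReal.rpow_mul, one_mul,
            ← ENNReal.rpow_add_of_nonneg _ _ zero_le_one (by linarith)]
          congr 1; ring
        rw [h4, ← mul_assoc]
        refine mul_le_of_le_one_left zero_le ?_
        exact (mul_le_mul_right le_add_self _).trans (ENNReal.inv_mul_le_one _)
      calc (e y * L) ^ p = f y ^ p * (Φ y ^ (-(1 / p)) * L) ^ p := by
            rw [← ENNReal.mul_rpow_of_nonneg _ _ hp0.le, he, mul_assoc]
        _ ≤ f y ^ p * L ^ (p - 1) := mul_le_mul_right h3 _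
        _ = _ := mul_comm _ _
    calc (∫⁻ y in Ioi t, (e y * L) ^ p ∂σ) ^ (1 / p)
        ≤ (∫⁻ y, L ^ (p - 1) * f y ^ p ∂σ) ^ (1 / p) :=
          ENNReal.rpow_le_rpow ((setLIntegral_le_lintegral _ _).trans (lintegral_mono h2))
            (by positivity)
      _ = _ := by
          rw [lintegral_const_mul _ (hf.pow_const _),
            ENNReal.mul_rpow_of_nonneg _ _ (by positivity), ← ENNReal.rpow_mul]
          congr 2
          rw [← hp.div_conj_eq_sub_one]; field_simp

/-- Tonelli's theorem for the integral over `t ≤ x` and `τ > t`. -/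
theorem setLIntegral_Iic_setLIntegral_Ioi {α μ : Measure ℝ} [SFinite α] [SFinite μ]
    {g : ℝ → ℝ≥0∞} (hg : Measurable g) (x : ℝ) :
    ∫⁻ t in Iic x, ∫⁻ τ in Ioi t, g τ ∂μ ∂α = ∫⁻ τ, g τ * α (Iic x ∩ Iio τ) ∂μ := by
  have h1 : ∀ t, ∫⁻ τ in Ioi t, g τ ∂μ =
      ∫⁻ τ, {z : ℝ × ℝ | z.1 < z.2}.indicator (fun z => g z.2) (t, τ) ∂μ := fun t => by
    rw [← lintegral_indicator measurableSet_Ioi]; rfl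
  simp only [h1]
  rw [lintegral_lintegral_swap]
  · refine lintegral_congr fun τ => ?_
    rw [inter_comm, ← Measure.restrict_apply measurableSet_Iio, ← setLIntegral_const,
      ← lintegral_indicator measurableSet_Iio]
    rfl
  · exact ((hg.comp measurable_snd).indicator
      (measurableSet_lt measurable_fst measurable_snd)).aemeasurable

/-- The part `τ ≤ x` leads to the Hardy operator, the part `τ ≥ x` to its dual. -/
theorem setLIntegral_Iic_setLIntegral_Ioi_le {α μ : Measure ℝ} [SFinite α] [SFinite μ]
    {g : ℝ → ℝ≥0∞} (hg : Measurable g) (x : ℝ) :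
    ∫⁻ t in Iic x, ∫⁻ τ in Ioi t, g τ ∂μ ∂α ≤
      ∫⁻ τ in Iic x, α (Iic τ) * g τ ∂μ + α (Iic x) * ∫⁻ τ in Ici x, g τ ∂μ := by
  have hm : Measurable fun τ => α (Iic τ) * g τ := (measurable_measure_Iic α).mul hg
  rw [setLIntegral_Iic_setLIntegral_Ioi hg, ← lintegral_const_mul _ hg,
    ← lintegral_indicator measurableSet_Iic, ← lintegral_indicator measurableSet_Ici,
    ← lintegral_add_left (hm.indicator measurableSet_Iic)]
  refine lintegral_mono fun τ => ?_
  rcases le_total τ x with h | h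
  · refine le_trans ?_ le_self_add
    rw [indicator_of_mem (show τ ∈ Iic x from h), mul_comm]
    exact mul_le_mul_left (measure_mono (inter_subset_right.trans Iio_subset_Iic_self)) _
  · refine le_trans ?_ le_add_self
    rw [indicator_of_mem (show τ ∈ Ici x from h), mul_comm]
    exact mul_le_mul_left (measure_mono inter_subset_left) _

theorem measure_inter_Iio_eq {α : Measure ℝ} [NullSingletonClass α] (x τ : ℝ) :
    α (Iic x ∩ Iio τ) = α (Iic (min x τ)) := by
  rw [← Iic_inter_Iic]
  refine measure_congr ?_
  exact (ae_eq_refl _).inter Iio_ae_eq_Iic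

/-- This and `mul_setLIntegral_Ici_le` are converses of `setLIntegral_Iic_setLIntegral_Ioi_le`, for
measures `α` without atoms. -/
theorem setLIntegral_Iic_mul_le {α μ : Measure ℝ} [SFinite α] [SFinite μ] [NullSingletonClass α]
    {g : ℝ → ℝ≥0∞} (hg : Measurable g) (x : ℝ) :
    ∫⁻ τ in Iic x, α (Iic τ) * g τ ∂μ ≤ ∫⁻ t in Iic x, ∫⁻ τ in Ioi t, g τ ∂μ ∂α := by
  rw [setLIntegral_Iic_setLIntegral_Ioi hg]
  refine le_trans (setLIntegral_mono' measurableSet_Iic fun τ hτ => ?_)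
    (setLIntegral_le_lintegral (Iic x) _)
  rw [measure_inter_Iio_eq, min_eq_right hτ, mul_comm]

theorem mul_setLIntegral_Ici_le {α μ : Measure ℝ} [SFinite α] [SFinite μ] [NullSingletonClass α]
    {g : ℝ → ℝ≥0∞} (hg : Measurable g) (x : ℝ) :
    α (Iic x) * ∫⁻ τ in Ici x, g τ ∂μ ≤ ∫⁻ t in Iic x, ∫⁻ τ in Ioi t, g τ ∂μ ∂α := by
  rw [setLIntegral_Iic_setLIntegral_Ioi hg, ← lintegral_const_mul _ hg]
  refine le_trans (setLIntegral_mono' measurableSet_Ici fun τ hτ => ?_)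
    (setLIntegral_le_lintegral (Ici x) _)
  rw [measure_inter_Iio_eq, min_eq_left hτ, mul_comm]

/-- The kernel `(y, x) ↦ κ (y, x]` of a measure `κ`. -/
def intervalKernel (κ : Measure ℝ) (y x : ℝ) : ℝ≥0∞ := κ (Ioc y x)

theorem isOinarovKernel_intervalKernel (κ : Measure ℝ) [SFinite κ] :
    IsOinarovKernel (intervalKernel κ) where
  measurable := by
    have h : MeasurableSet {z : (ℝ × ℝ) × ℝ | z.1.1 < z.2 ∧ z.2 ≤ z.1.2} :=
      (measurableSet_lt (measurable_fst.comp measurable_fst) measurable_snd).inter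
        (measurableSet_le measurable_snd (measurable_snd.comp measurable_fst))
    exact measurable_measure_prodMk_left h
  antitone x y y' h := measure_mono (Ioc_subset_Ioc_left h)
  monotone y x x' h := measure_mono (Ioc_subset_Ioc_right h)
  triangle y e x hy hx := by
    simp only [intervalKernel]
    rw [← Ioc_union_Ioc_eq_Ioc hy hx]
    exact measure_union_le _ _

theorem kernelOp_intervalKernel {σ κ : Measure ℝ} [SFinite σ] [SFinite κ] [NullSingletonClass κ]
    {f : ℝ → ℝ≥0∞} (hf : Measurable f) (x : ℝ) :
    kernelOp σ (intervalKernel κ) f x = ∫⁻ s in Iic x, ∫⁻ y in Iic s, f y ∂σ ∂κ := by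
  rw [lintegral_setLIntegral_Iic_swap (G := fun _ y => f y) (hf.comp measurable_snd), kernelOp,
    ← lintegral_indicator measurableSet_Iic]
  refine lintegral_congr fun y => ?_
  rw [setLIntegral_const, Measure.restrict_apply measurableSet_Ici, Ici_inter_Iic,
    measure_congr Ioc_ae_eq_Icc.symm]
  by_cases hy : y ≤ x
  · rw [indicator_of_mem (show y ∈ Iic x from hy), intervalKernel]
  · rw [indicator_of_notMem (show y ∉ Iic x from hy), Ioc_eq_empty (fun h => hy h.le),
      measure_empty, mul_zero]

/-! ### Upper bound for the supremum operator -/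

/-- The operator `f ↦ sup_{τ ≥ t} ρ(τ) ∫_{y ≤ τ} f dσ`. -/
noncomputable def supOp (ρ : ℝ → ℝ≥0∞) (σ : Measure ℝ) (f : ℝ → ℝ≥0∞) : ℝ → ℝ≥0∞ :=
  tailSup fun τ => ρ τ * ∫⁻ y in Iic τ, f y ∂σ

/-- The function `φ(t) = sup_{τ ≥ t} ρ(τ) ^ p' σ(-∞, τ]`. -/
noncomputable def scaleFun (p' : ℝ) (ρ : ℝ → ℝ≥0∞) (σ : Measure ℝ) : ℝ → ℝ≥0∞ :=
  tailSup fun τ => ρ τ ^ p' * σ (Iic τ)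

/-- The measure `d(-φ)` of the function `φ = scaleFun p' ρ σ`. -/
noncomputable def scaleMeasure (p' : ℝ) (ρ : ℝ → ℝ≥0∞) (σ : Measure ℝ) : Measure ℝ :=
  negStieltjes (scaleFun p' ρ σ) (tailSup_antitone _)

/-- The limit of `scaleFun p' ρ σ` at infinity. -/
noncomputable def scaleLim (p' : ℝ) (ρ : ℝ → ℝ≥0∞) (σ : Measure ℝ) : ℝ≥0∞ :=
  limTailSup fun τ => ρ τ ^ p' * σ (Iic τ)

instance (p' : ℝ) (ρ : ℝ → ℝ≥0∞) (σ : Measure ℝ) : SFinite (scaleMeasure p' ρ σ) :=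
  sFinite_negStieltjes _

/-- `N` bounds the operator `f ↦ ∫_{t ≤ x} (supOp ρ σ f) dα` from `L^p(σ)` to `L^q(ω)`. -/
def IsSupOpBound (p q : ℝ) (ρ : ℝ → ℝ≥0∞) (σ ω α : Measure ℝ) (N : ℝ≥0∞) : Prop :=
  ∀ f : ℝ → ℝ≥0∞, Measurable f → ∫⁻ y, f y ^ p ∂σ ≠ ∞ →
    (∫⁻ x, (∫⁻ t in Iic x, supOp ρ σ f t ∂α) ^ q ∂ω) ^ (1 / q) ≤
      N * (∫⁻ y, f y ^ p ∂σ) ^ (1 / p)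

/-- The sum of the quantities which characterize boundedness, built from an Oinarov functional
`O`, a Hardy functional `H` and a Hardy functional `H'` for the reversed order. -/
noncomputable def charSum (p' q : ℝ) (O : Measure ℝ → Measure ℝ → (ℝ → ℝ → ℝ≥0∞) → ℝ≥0∞)
    (H : Measure ℝ → Measure ℝ → ℝ≥0∞) (H' : Measure ℝᵒᵈ → Measure ℝᵒᵈ → ℝ≥0∞)
    (ρ : ℝ → ℝ≥0∞) (σ ω α : Measure ℝ) : ℝ≥0∞ :=
  O σ ω (intervalKernel (α.withDensity (tailSup ρ))) +
    H ((scaleMeasure p' ρ σ).withDensity fun t => α (Iic t) ^ p') ω +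
    H' (scaleMeasure p' ρ σ) (ω.withDensity fun t => α (Iic t) ^ q) +
    (∫⁻ x, α (Iic x) ^ q ∂ω) ^ (1 / q) * scaleLim p' ρ σ ^ (1 / p')

/-- The defining property of a Hardy functional for the reversed order, on `ℝ`. -/
theorem exists_of_isHardyFunctional_dual {p q : ℝ} {H' : Measure ℝᵒᵈ → Measure ℝᵒᵈ → ℝ≥0∞}
    (h : IsHardyFunctional p q H') :
    ∃ C : ℝ≥0∞, C ≠ ∞ ∧ ∀ (μ ν : Measure ℝ) [SigmaFinite μ] [SigmaFinite ν],
      (H' μ ν ≠ ∞ → ∀ f : ℝ → ℝ≥0∞, Measurable f →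
        (∫⁻ x, (∫⁻ y in Ici x, f y ∂μ) ^ q ∂ν) ^ (1 / q) ≤
          C * H' μ ν * (∫⁻ x, f x ^ p ∂μ) ^ (1 / p)) ∧
      ∀ N : ℝ≥0∞, (∀ f : ℝ → ℝ≥0∞, Measurable f → ∫⁻ x, f x ^ p ∂μ ≠ ∞ →
        (∫⁻ x, (∫⁻ y in Ici x, f y ∂μ) ^ q ∂ν) ^ (1 / q) ≤ N * (∫⁻ x, f x ^ p ∂μ) ^ (1 / p)) →
        H' μ ν ≤ C * N := by
  obtain ⟨C, hC, h⟩ := h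
  refine ⟨C, hC, fun μ ν _ _ => ?_⟩
  have : @SigmaFinite ℝᵒᵈ _ μ := ‹SigmaFinite μ›
  have : @SigmaFinite ℝᵒᵈ _ ν := ‹SigmaFinite ν›
  exact h μ ν

section Substitution

variable {μ : Measure ℝ} {A : ℝ → ℝ≥0∞} {p p' : ℝ}

/-- The substitution `f = g A ^ (1 - p')` in the weighted Hardy operator. -/
theorem setLIntegral_withDensity_rpow (hA : Measurable A) (hA0 : ∀ᵐ x ∂μ, A x ≠ 0)
    (hAt : ∀ᵐ x ∂μ, A x ≠ ∞) {g : ℝ → ℝ≥0∞} (hg : Measurable g) {E : Set ℝ}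
    (hE : MeasurableSet E) :
    ∫⁻ x in E, g x * A x ^ (1 - p') ∂(μ.withDensity fun x => A x ^ p') =
      ∫⁻ x in E, A x * g x ∂μ := by
  have hm : Measurable fun x => g x * A x ^ (1 - p') := hg.mul (hA.pow_const _)
  rw [setLIntegral_withDensity_eq_setLIntegral_mul μ (hA.pow_const _) hm hE]
  refine lintegral_congr_ae (ae_restrict_of_ae ?_)
  filter_upwards [hA0, hAt] with x h0 ht
  simp only [Pi.mul_apply]
  have h1 : A x ^ p' * A x ^ (1 - p') = A x := by
    rw [← ENNReal.rpow_add _ _ h0 ht]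
    simp
  rw [mul_left_comm, h1, mul_comm]

theorem lintegral_withDensity_rpow (hp : p.HolderConjugate p') (hA : Measurable A)
    (hA0 : ∀ᵐ x ∂μ, A x ≠ 0) (hAt : ∀ᵐ x ∂μ, A x ≠ ∞) {g : ℝ → ℝ≥0∞} (hg : Measurable g) :
    ∫⁻ x, (g x * A x ^ (1 - p')) ^ p ∂(μ.withDensity fun x => A x ^ p') =
      ∫⁻ x, g x ^ p ∂μ := by
  have hm : Measurable fun x => (g x * A x ^ (1 - p')) ^ p :=
    (hg.mul (hA.pow_const _)).pow_const _
  rw [lintegral_withDensity_eq_lintegral_mul μ (hA.pow_const _) hm]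
  refine lintegral_congr_ae ?_
  filter_upwards [hA0, hAt] with x h0 ht
  simp only [Pi.mul_apply]
  have h1 : A x ^ p' * A x ^ ((1 - p') * p) = 1 := by
    rw [← ENNReal.rpow_add _ _ h0 ht]
    have : p' + (1 - p') * p = 0 := by
      have := hp.sub_one_mul_conj
      linarith
    rw [this, ENNReal.rpow_zero]
  rw [ENNReal.mul_rpow_of_nonneg _ _ hp.pos.le, ← ENNReal.rpow_mul, mul_left_comm, h1, mul_one]

end Substitution

theorem withDensity_nullSingletonClass {α : Measure ℝ} [NullSingletonClass α] (f : ℝ → ℝ≥0∞) :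
    NullSingletonClass (α.withDensity f) :=
  ⟨fun x => withDensity_absolutelyContinuous α f (measure_singleton x)⟩

theorem measurable_setLIntegral_Ici' (μ : Measure ℝ) (f : ℝ → ℝ≥0∞) :
    Measurable fun x => ∫⁻ y in Ici x, f y ∂μ :=
  measurable_setLIntegral_Iic' (α := ℝᵒᵈ) μ f

/-- The part of the operator in which the supremum is separated from the primitive is the
operator with kernel `∫_y^x (sup_{τ ≥ s} ρ(τ)) dα(s)`. -/
theorem kernelOp_eq_setLIntegral_tailSup {σ α : Measure ℝ} [SFinite σ] [SFinite α]
    [NullSingletonClass α] {ρ f : ℝ → ℝ≥0∞} (hf : Measurable f) (x : ℝ) :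
    kernelOp σ (intervalKernel (α.withDensity (tailSup ρ))) f x =
      ∫⁻ t in Iic x, tailSup ρ t * ∫⁻ y in Iic t, f y ∂σ ∂α := by
  have := withDensity_nullSingletonClass (α := α) (tailSup ρ)
  rw [kernelOp_intervalKernel hf, setLIntegral_withDensity_eq_setLIntegral_mul α
    (measurable_tailSup ρ) (measurable_setLIntegral_Iic' σ f) measurableSet_Iic]
  rfl

theorem le_scaleMeasure_Ici_add {p' : ℝ} {ρ : ℝ → ℝ≥0∞} {σ : Measure ℝ} {y τ : ℝ} (hy : 0 < y)
    (hτ : y ≤ τ) :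
    ρ τ ^ p' * σ (Iic τ) ≤ scaleMeasure p' ρ σ (Ici y) + scaleLim p' ρ σ :=
  (le_tailSup (f := fun τ => ρ τ ^ p' * σ (Iic τ)) (hy.trans_le hτ) hτ).trans
    (le_negStieltjes_Ici_add (tailSup_antitone _) (tendsto_tailSup _) hy)

/-- Pointwise bound of the operator by the kernel operator, two Hardy operators in the
variable of `d(-φ)`, and a multiple of the norm of `f`. -/
theorem setLIntegral_supOp_le {p p' : ℝ} (hp : p.HolderConjugate p') {ρ : ℝ → ℝ≥0∞}
    {σ α : Measure ℝ} [SigmaFinite σ] [SFinite α] [NullSingletonClass α] (hα0 : α (Iic 0) = 0)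
    (hφ : ∀ t, 0 < t → scaleFun p' ρ σ t ≠ ∞) {f : ℝ → ℝ≥0∞} (hf : Measurable f) (x : ℝ) :
    ∫⁻ t in Iic x, supOp ρ σ f t ∂α ≤
      (kernelOp σ (intervalKernel (α.withDensity (tailSup ρ))) f x +
      (∫⁻ τ in Iic x, α (Iic τ) * scaleTransfer p σ (scaleMeasure p' ρ σ) (scaleLim p' ρ σ) f τ
        ∂(scaleMeasure p' ρ σ) +
      α (Iic x) * ∫⁻ τ in Ici x, scaleTransfer p σ (scaleMeasure p' ρ σ) (scaleLim p' ρ σ) f τ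
        ∂(scaleMeasure p' ρ σ))) +
      scaleLim p' ρ σ ^ (1 / p') * (∫⁻ y, f y ^ p ∂σ) ^ (1 / p) * α (Iic x) := by
  set μ := scaleMeasure p' ρ σ with hμ
  set L := scaleLim p' ρ σ with hL
  set g := scaleTransfer p σ μ L f with hg
  have hgm : Measurable g := measurable_scaleTransfer _ _ _ _ _
  have hpos := ae_pos_of_measure_Iic_zero hα0
  have hpt : ∀ᵐ t ∂α, supOp ρ σ f t ≤ tailSup ρ t * ∫⁻ y in Iic t, f y ∂σ +
      (∫⁻ τ in Ioi t, g τ ∂μ + L ^ (1 / p') * (∫⁻ y, f y ^ p ∂σ) ^ (1 / p)) := by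
    filter_upwards [hpos] with t ht
    refine (tailSup_mul_le_add hp hf (Φ := fun y => μ (Ici y) + L) fun y hy τ hτ =>
      le_scaleMeasure_Ici_add (ht.trans hy) hτ).trans (add_le_add le_rfl ?_)
    refine rpow_setLIntegral_Ioi_le hp hf fun y hy => ?_
    exact ((negStieltjes_Ici_add_le _ (tendsto_tailSup _) (ht.trans hy) hy).trans_lt
      (hφ t ht).lt_top).ne
  have hm : Measurable fun t => tailSup ρ t * ∫⁻ y in Iic t, f y ∂σ :=
    (measurable_tailSup ρ).mul (measurable_setLIntegral_Iic' σ f)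
  calc ∫⁻ t in Iic x, supOp ρ σ f t ∂α
      ≤ ∫⁻ t in Iic x, (tailSup ρ t * ∫⁻ y in Iic t, f y ∂σ +
        (∫⁻ τ in Ioi t, g τ ∂μ + L ^ (1 / p') * (∫⁻ y, f y ^ p ∂σ) ^ (1 / p))) ∂α :=
        lintegral_mono_ae (ae_restrict_of_ae hpt)
    _ = kernelOp σ (intervalKernel (α.withDensity (tailSup ρ))) f x +
        ∫⁻ t in Iic x, ∫⁻ τ in Ioi t, g τ ∂μ ∂α +
        L ^ (1 / p') * (∫⁻ y, f y ^ p ∂σ) ^ (1 / p) * α (Iic x) := by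
        rw [lintegral_add_left hm, lintegral_add_right _ measurable_const, setLIntegral_const,
          kernelOp_eq_setLIntegral_tailSup hf, add_assoc]
    _ ≤ _ := add_le_add (add_le_add le_rfl (setLIntegral_Iic_setLIntegral_Ioi_le hgm x)) le_rfl

/-- Sufficiency: the sum of the characterizing quantities bounds the operator. -/
theorem exists_isSupOpBound_charSum {p p' q : ℝ} (hp : p.HolderConjugate p') (hq : 1 < q)
    {O : Measure ℝ → Measure ℝ → (ℝ → ℝ → ℝ≥0∞) → ℝ≥0∞}
    {H : Measure ℝ → Measure ℝ → ℝ≥0∞} {H' : Measure ℝᵒᵈ → Measure ℝᵒᵈ → ℝ≥0∞}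
    (hO : IsOinarovFunctional p q O) (hH : IsHardyFunctional p q H)
    (hH' : IsHardyFunctional p q H') :
    ∃ C : ℝ≥0∞, C ≠ ∞ ∧ ∀ (ρ : ℝ → ℝ≥0∞) (σ ω α : Measure ℝ) [SigmaFinite σ] [SigmaFinite ω]
      [SFinite α] [NullSingletonClass α], α (Iic 0) = 0 → (∀ x, 0 < x → α (Iic x) ≠ 0) →
      (∀ x, α (Iic x) ≠ ∞) → (∀ t, 0 < t → scaleFun p' ρ σ t ≠ ∞) →
      charSum p' q O H H' ρ σ ω α ≠ ∞ →
      IsSupOpBound p q ρ σ ω α (C * charSum p' q O H H' ρ σ ω α) := by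
  have hp0 := hp.pos
  have hp'0 := hp.symm.pos
  have hq0 : 0 < q := by linarith
  obtain ⟨C₁, hC₁, h₁⟩ := hO
  obtain ⟨C₂, hC₂, h₂⟩ := hH
  obtain ⟨C₃, hC₃, h₃⟩ := exists_of_isHardyFunctional_dual hH'
  refine ⟨C₁ + C₂ + C₃ + 1, by finiteness, fun ρ σ ω α _ _ _ _ hα0 hαp hαt hφ hR f hf hfin => ?_⟩
  set R := charSum p' q O H H' ρ σ ω α with hRdef
  set μ := scaleMeasure p' ρ σ with hμ
  set L := scaleLim p' ρ σ with hL
  set g := scaleTransfer p σ μ L f with hg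
  set A : ℝ → ℝ≥0∞ := fun x => α (Iic x) with hA
  set k := intervalKernel (α.withDensity (tailSup ρ)) with hk
  set n := (∫⁻ y, f y ^ p ∂σ) ^ (1 / p) with hn
  have hAm : Measurable A := measurable_measure_Iic α
  have hgm : Measurable g := measurable_scaleTransfer _ _ _ _ _
  have : SigmaFinite μ := sigmaFinite_negStieltjes _ hφ
  have hμpos : ∀ᵐ t ∂μ, 0 < t := ae_pos_of_measure_Iic_zero (negStieltjes_Iic_zero _)
  have hA0 : ∀ᵐ t ∂μ, A t ≠ 0 := hμpos.mono fun t ht => hαp t ht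
  have hAt : ∀ᵐ t ∂μ, A t ≠ ∞ := ae_of_all _ hαt
  have : SigmaFinite (μ.withDensity fun t => A t ^ p') :=
    SigmaFinite.withDensity_of_ne_top
      (ae_of_all _ fun t => ENNReal.rpow_ne_top_of_nonneg hp'0.le (hαt t))
  have : SigmaFinite (ω.withDensity fun t => A t ^ q) :=
    SigmaFinite.withDensity_of_ne_top
      (ae_of_all _ fun t => ENNReal.rpow_ne_top_of_nonneg hq0.le (hαt t))
  have hg1 : (∫⁻ x, g x ^ p ∂μ) ^ (1 / p) ≤ n :=
    ENNReal.rpow_le_rpow (lintegral_scaleTransfer_rpow_le hp.lt hf) (by positivity)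
  have hO1 : O σ ω k ≤ R := le_self_add.trans (le_self_add.trans le_self_add)
  have hH1 : H (μ.withDensity fun t => A t ^ p') ω ≤ R :=
    le_add_self.trans (le_self_add.trans le_self_add)
  have hH'1 : H' μ (ω.withDensity fun t => A t ^ q) ≤ R := le_add_self.trans le_self_add
  have hne : ∀ {z}, z ≤ R → z ≠ ∞ := fun hz => (hz.trans_lt hR.lt_top).ne
  -- the norms of the four parts
  have e₁ : (∫⁻ x, kernelOp σ k f x ^ q ∂ω) ^ (1 / q) ≤ C₁ * R * n :=
    ((h₁ σ ω k (isOinarovKernel_intervalKernel _)).1 (hne hO1) f hf hfin).trans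
      (mul_le_mul_left (mul_le_mul_right hO1 _) _)
  have e₂ : (∫⁻ x, (∫⁻ τ in Iic x, A τ * g τ ∂μ) ^ q ∂ω) ^ (1 / q) ≤ C₂ * R * n := by
    have h := (h₂ (μ.withDensity fun t => A t ^ p') ω).1 (hne hH1) (fun x => g x * A x ^ (1 - p'))
      (hgm.mul (hAm.pow_const _))
    rw [lintegral_withDensity_rpow hp hAm hA0 hAt hgm] at h
    simp only [setLIntegral_withDensity_rpow hAm hA0 hAt hgm measurableSet_Iic] at h
    exact h.trans (mul_le_mul' (mul_le_mul_right hH1 _) hg1)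
  have e₃ : (∫⁻ x, (A x * ∫⁻ τ in Ici x, g τ ∂μ) ^ q ∂ω) ^ (1 / q) ≤ C₃ * R * n := by
    have h := (h₃ μ (ω.withDensity fun t => A t ^ q)).1 (hne hH'1) g hgm
    rw [lintegral_withDensity_eq_lintegral_mul ω (hAm.pow_const _)
      ((measurable_setLIntegral_Ici' μ g).pow_const _)] at h
    simp only [Pi.mul_apply, ← ENNReal.mul_rpow_of_nonneg _ _ hq0.le] at h
    exact h.trans (mul_le_mul' (mul_le_mul_right hH'1 _) hg1)
  have e₄ : (∫⁻ x, (L ^ (1 / p') * n * A x) ^ q ∂ω) ^ (1 / q) ≤ 1 * R * n := by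
    simp only [ENNReal.mul_rpow_of_nonneg _ (A _) hq0.le]
    rw [lintegral_const_mul _ (hAm.pow_const _), ENNReal.mul_rpow_of_nonneg _ _ (by positivity),
      ← ENNReal.rpow_mul, mul_one_div_cancel hq0.ne', ENNReal.rpow_one, one_mul]
    calc L ^ (1 / p') * n * (∫⁻ x, A x ^ q ∂ω) ^ (1 / q)
        = (∫⁻ x, A x ^ q ∂ω) ^ (1 / q) * L ^ (1 / p') * n := by ring
      _ ≤ R * n := mul_le_mul_left le_add_self _
  have m₁ : Measurable (kernelOp σ k f) :=
    measurable_kernelOp (isOinarovKernel_intervalKernel _).measurable hf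
  have m₂ : Measurable fun x => ∫⁻ τ in Iic x, A τ * g τ ∂μ := measurable_setLIntegral_Iic' _ _
  have m₃ : Measurable fun x => A x * ∫⁻ τ in Ici x, g τ ∂μ :=
    hAm.mul (measurable_setLIntegral_Ici' _ _)
  have m₄ : Measurable fun x => L ^ (1 / p') * n * A x := hAm.const_mul _
  calc (∫⁻ x, (∫⁻ t in Iic x, supOp ρ σ f t ∂α) ^ q ∂ω) ^ (1 / q)
      ≤ (∫⁻ x, ((kernelOp σ k f + ((fun x => ∫⁻ τ in Iic x, A τ * g τ ∂μ) +
          fun x => A x * ∫⁻ τ in Ici x, g τ ∂μ)) + fun x => L ^ (1 / p') * n * A x) x ^ q ∂ω) ^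
          (1 / q) := by
        refine ENNReal.rpow_le_rpow (lintegral_mono fun x => ENNReal.rpow_le_rpow ?_ hq0.le)
          (by positivity)
        exact setLIntegral_supOp_le hp hα0 hφ hf x
    _ ≤ (C₁ * R * n + (C₂ * R * n + C₃ * R * n)) + 1 * R * n := by
        refine (ENNReal.lintegral_Lp_add_le (m₁.add (m₂.add m₃)).aemeasurable m₄.aemeasurable
          hq.le).trans (add_le_add ?_ e₄)
        refine (ENNReal.lintegral_Lp_add_le m₁.aemeasurable (m₂.add m₃).aemeasurable
          hq.le).trans (add_le_add e₁ ?_)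
        exact (ENNReal.lintegral_Lp_add_le m₂.aemeasurable m₃.aemeasurable
          hq.le).trans (add_le_add e₂ e₃)
    _ = _ := by ring

/-! ### Test functions for the supremum operator -/

/-- A geometric series over the dyadic scale, started where `2 ^ (k + 1)` exceeds `z`. -/
theorem exists_tsum_dyadic_le {β : ℝ} (hβ : 0 < β) :
    ∃ C : ℝ≥0∞, C ≠ ∞ ∧ ∀ z : ℝ≥0∞, z ≠ ∞ →
      ∑' k : ℤ, (if z ≤ 2 ^ ((k : ℝ) + 1) then (2 : ℝ≥0∞) ^ (-(k : ℝ) * β) * z ^ β else 0) ≤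
        C := by
  refine ⟨2 ^ β * ∑' j : ℕ, ((2 : ℝ≥0∞) ^ (-β)) ^ j, ENNReal.mul_ne_top (two_rpow_ne_top _)
    (tsum_geometric_ne_top (two_rpow_lt_one (by linarith))), fun z hz => ?_⟩
  by_cases h0 : z = 0
  · simp [h0, hβ]
  obtain ⟨m, hm1, hm2⟩ := ENNReal.exists_mem_Ioc_zpow h0 hz (y := 2) (by norm_num) (by norm_num)
  have hm1' : (2 : ℝ≥0∞) ^ (m : ℝ) < z := by rwa [ENNReal.rpow_intCast]
  have hm2' : z ≤ (2 : ℝ≥0∞) ^ ((m : ℝ) + 1) := by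
    rw [← ENNReal.rpow_intCast] at hm2; push_cast at hm2; exact hm2
  set F : ℤ → ℝ≥0∞ := fun k =>
    if z ≤ 2 ^ ((k : ℝ) + 1) then (2 : ℝ≥0∞) ^ (-(k : ℝ) * β) * z ^ β else 0 with hF
  have hsupp : Function.support F ⊆ range fun j : ℕ => m + (j : ℤ) := by
    intro k hk
    have hk1 : z ≤ 2 ^ ((k : ℝ) + 1) := by
      by_contra h
      exact hk (if_neg h)
    have hk2 : (m : ℝ) < (k : ℝ) + 1 := by
      by_contra! h
      exact absurd (hm1'.trans_le (hk1.trans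
        (ENNReal.rpow_le_rpow_of_exponent_le (by norm_num) h))) (lt_irrefl _)
    have hk3 : m < k + 1 := by exact_mod_cast hk2
    exact ⟨(k - m).toNat, by simp only; omega⟩
  have hinj : Function.Injective fun j : ℕ => m + (j : ℤ) := fun i j h => by simpa using h
  rw [← hinj.tsum_eq hsupp, ← ENNReal.tsum_mul_left]
  refine ENNReal.tsum_le_tsum fun j => ?_
  have hle : F (m + (j : ℤ)) ≤ (2 : ℝ≥0∞) ^ (-((m + (j : ℤ) : ℤ) : ℝ) * β) * z ^ β := by
    simp only [hF]
    split_ifs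
    · exact le_rfl
    · exact zero_le
  refine hle.trans ((mul_le_mul_right (ENNReal.rpow_le_rpow hm2' hβ.le) _).trans (le_of_eq ?_))
  rw [← ENNReal.rpow_natCast, ← ENNReal.rpow_mul, ← ENNReal.rpow_mul,
    ← ENNReal.rpow_add _ _ (by norm_num) (by norm_num),
    ← ENNReal.rpow_add _ _ (by norm_num) (by norm_num)]
  congr 1; push_cast; ring

/-- Every set of reals has a cofinal increasing sequence; the case distinction is over the empty
set. -/
theorem exists_monotone_seq_cofinal (E : Set ℝ) : ∃ s : ℕ → ℝ, Monotone s ∧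
    (E.Nonempty → (∀ n, s n ∈ E) ∧ ∀ e ∈ E, ∃ n, e ≤ s n) := by
  rcases E.eq_empty_or_nonempty with rfl | hE
  · exact ⟨fun _ => 0, monotone_const, fun h => absurd h not_nonempty_empty⟩
  obtain ⟨T, hT, hTc, hcof⟩ := exists_countable_cofinal E
  have hTn : T.Nonempty := by
    obtain ⟨e, he⟩ := hE
    obtain ⟨t, ht, -⟩ := hcof e he
    exact ⟨t, ht⟩
  obtain ⟨e, he⟩ := hTc.exists_eq_range hTn
  have heE : ∀ n, e n ∈ E := fun n => hT (he ▸ mem_range_self n)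
  refine ⟨partialSups e, (partialSups e).monotone, fun _ => ⟨fun n => ?_, fun x hx => ?_⟩⟩
  · induction n with
    | zero => simpa using heE 0
    | succ n ih =>
      rw [partialSups_add_one]
      rcases le_total (partialSups e n) (e (n + 1)) with h | h
      · rw [sup_eq_right.2 h]; exact heE _
      · rw [sup_eq_left.2 h]; exact ih
  · obtain ⟨t, ht, hle⟩ := hcof x hx
    rw [he] at ht
    obtain ⟨n, rfl⟩ := ht
    exact ⟨n, hle.trans (le_partialSups e n)⟩

theorem tailSup_mono {f g : ℝ → ℝ≥0∞} (h : ∀ t, f t ≤ g t) (t : ℝ) : tailSup f t ≤ tailSup g t :=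
  iSup_mono fun τ => iSup_mono fun _ => iSup_mono fun _ => h τ

theorem supOp_mono (ρ : ℝ → ℝ≥0∞) (σ : Measure ℝ) {f g : ℝ → ℝ≥0∞} (h : ∀ y, f y ≤ g y) (t : ℝ) :
    supOp ρ σ f t ≤ supOp ρ σ g t :=
  tailSup_mono (fun _ => mul_le_mul_right (lintegral_mono h) _) t

theorem supOp_const_mul (ρ : ℝ → ℝ≥0∞) (σ : Measure ℝ) {f : ℝ → ℝ≥0∞} (hf : Measurable f)
    (c : ℝ≥0∞) (t : ℝ) : supOp ρ σ (fun y => c * f y) t = c * supOp ρ σ f t := by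
  rw [mul_comm, supOp, supOp, ← tailSup_mul_const]
  congr 1; funext τ
  rw [lintegral_const_mul _ hf]; ring

theorem mul_setLIntegral_le_supOp {ρ : ℝ → ℝ≥0∞} {σ : Measure ℝ} {f : ℝ → ℝ≥0∞} {t τ : ℝ}
    (hτ : 0 < τ) (h : t ≤ τ) : ρ τ * ∫⁻ y in Iic τ, f y ∂σ ≤ supOp ρ σ f t :=
  le_tailSup (f := fun τ => ρ τ * ∫⁻ y in Iic τ, f y ∂σ) hτ h

theorem measurable_supOp (ρ : ℝ → ℝ≥0∞) (σ : Measure ℝ) (f : ℝ → ℝ≥0∞) :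
    Measurable (supOp ρ σ f) := measurable_tailSup _

/-- The operator dominates the product of the tail supremum with the primitive. -/
theorem tailSup_mul_le_supOp (ρ : ℝ → ℝ≥0∞) (σ : Measure ℝ) (f : ℝ → ℝ≥0∞) (t : ℝ) :
    tailSup ρ t * ∫⁻ y in Iic t, f y ∂σ ≤ supOp ρ σ f t := by
  rw [← tailSup_mul_const]
  exact iSup_mono fun τ => iSup_mono fun _ => iSup_mono fun h =>
    mul_le_mul_right (lintegral_mono_set (Iic_subset_Iic.2 h)) _

/-- If `φ(s)` is finite and larger than `c`, there is a function of norm at most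
`c ^ (-1 / p')` which is mapped to a function that is at least `1` up to `s`: a multiple of the
indicator function of `(-∞, τ]`, where `τ ≥ s` satisfies `c < ρ(τ) ^ p' σ(-∞, τ]`. -/
theorem exists_one_le_supOp {p p' : ℝ} (hp : p.HolderConjugate p') {ρ : ℝ → ℝ≥0∞} {σ : Measure ℝ}
    {s : ℝ} {c : ℝ≥0∞} (hs : scaleFun p' ρ σ s ≠ ∞) (hc : c < scaleFun p' ρ σ s) :
    ∃ κ : ℝ → ℝ≥0∞, Measurable κ ∧ ∫⁻ y, κ y ^ p ∂σ ≤ c ^ (-(p - 1)) ∧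
      ∀ t ≤ s, 1 ≤ supOp ρ σ κ t := by
  have hp0 := hp.pos
  have hp1 := hp.lt
  have hp'0 := hp.symm.pos
  obtain ⟨τ, hτ⟩ := lt_iSup_iff.1 hc
  obtain ⟨hτ0, hτ⟩ := lt_iSup_iff.1 hτ
  obtain ⟨hsτ, hτ⟩ := lt_iSup_iff.1 hτ
  set S := σ (Iic τ) with hS
  have hne : ρ τ ^ p' * S ≠ 0 := (zero_le.trans_lt hτ).ne'
  have hnt : ρ τ ^ p' * S ≠ ∞ := ((le_tailSup (f := fun τ => ρ τ ^ p' * σ (Iic τ)) hτ0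
    hsτ).trans_lt hs.lt_top).ne
  have hS0 : S ≠ 0 := right_ne_zero_of_mul hne
  have hρ0 : ρ τ ≠ 0 := fun h => hne (by rw [h, ENNReal.zero_rpow_of_pos hp'0, zero_mul])
  have hSt : S ≠ ∞ := fun h => hnt (by
    rw [h, ENNReal.mul_top]
    exact left_ne_zero_of_mul hne)
  have hρt : ρ τ ≠ ∞ := fun h => hnt (by
    rw [h, ENNReal.top_rpow_of_pos hp'0, ENNReal.top_mul hS0])
  have hρS0 : ρ τ * S ≠ 0 := mul_ne_zero hρ0 hS0
  have hρSt : ρ τ * S ≠ ∞ := ENNReal.mul_ne_top hρt hSt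
  refine ⟨(Iic τ).indicator fun _ => (ρ τ * S)⁻¹, measurable_const.indicator measurableSet_Iic,
    ?_, fun t ht => ?_⟩
  · have h1 : ∫⁻ y, (Iic τ).indicator (fun _ => (ρ τ * S)⁻¹) y ^ p ∂σ =
        ((ρ τ * S)⁻¹) ^ p * S := by
      rw [← setLIntegral_const (Iic τ) (((ρ τ * S)⁻¹) ^ p),
        ← lintegral_indicator measurableSet_Iic]
      refine lintegral_congr fun y => ?_
      by_cases hy : y ∈ Iic τ
      · simp [hy]
      · simp [hy, hp0]
    have h2 : ((ρ τ * S)⁻¹) ^ p * S = (ρ τ ^ p' * S) ^ (-(p - 1)) := by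
      rw [← ENNReal.rpow_neg_one, ← ENNReal.rpow_mul,
        ENNReal.mul_rpow_of_ne_top hρt hSt,
        ENNReal.mul_rpow_of_ne_top (ENNReal.rpow_ne_top_of_nonneg hp'0.le hρt) hSt,
        ← ENNReal.rpow_mul, mul_assoc]
      have h3 : S ^ (-1 * p) * S = S ^ (-(p - 1)) := by
        nth_rw 2 [← ENNReal.rpow_one S]
        rw [← ENNReal.rpow_add _ _ hS0 hSt]
        congr 1; ring
      rw [h3]
      congr 2
      have := hp.sub_one_mul_conj
      linarith
    rw [h1, h2, ENNReal.rpow_neg, ENNReal.rpow_neg]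
    exact ENNReal.inv_le_inv.2 (ENNReal.rpow_le_rpow hτ.le (by linarith))
  · refine le_trans (le_of_eq ?_) (mul_setLIntegral_le_supOp hτ0 (ht.trans hsτ))
    have h1 : ∫⁻ y in Iic τ, (Iic τ).indicator (fun _ => (ρ τ * S)⁻¹) y ∂σ = (ρ τ * S)⁻¹ * S := by
      rw [setLIntegral_indicator measurableSet_Iic, inter_self, setLIntegral_const]
    rw [h1, mul_left_comm, mul_comm, ENNReal.mul_inv_cancel hρS0 hρSt]

theorem scaleMeasure_Ioi_le (p' : ℝ) (ρ : ℝ → ℝ≥0∞) (σ : Measure ℝ) {t : ℝ} (ht : 0 < t) :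
    scaleMeasure p' ρ σ (Ioi t) ≤ scaleFun p' ρ σ t :=
  measure_le_of_forall_Iic_le (α := ℝᵒᵈ) (scaleMeasure p' ρ σ) _ _ fun _ hx =>
    le_self_add.trans (negStieltjes_Ici_add_le _ (tendsto_tailSup _) (ht.trans hx) hx)

/-- Hölder's inequality for the tail `∫_{τ > t} g d(-φ)`, in terms of a power weight of
`d(-φ) [τ, ∞)`. -/
theorem exists_setLIntegral_Ioi_le {p p' : ℝ} (hp : p.HolderConjugate p') :
    ∃ C : ℝ≥0∞, C ≠ ∞ ∧ ∀ (ρ : ℝ → ℝ≥0∞) (σ : Measure ℝ) (t : ℝ) (c : ℝ≥0∞) (g : ℝ → ℝ≥0∞),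
      Measurable g → 0 < t → scaleFun p' ρ σ t ≤ c → c ≠ ∞ →
      ∫⁻ τ in Ioi t, g τ ∂(scaleMeasure p' ρ σ) ≤ C * c ^ (1 / (2 * p')) *
        (∫⁻ τ in {τ | scaleMeasure p' ρ σ (Ici τ) ≤ c},
          g τ ^ p * scaleMeasure p' ρ σ (Ici τ) ^ ((p - 1) / 2) ∂(scaleMeasure p' ρ σ)) ^
          (1 / p) := by
  have hp0 := hp.pos
  have hp1 := hp.lt
  have hp'0 := hp.symm.pos
  obtain ⟨C, hC, h⟩ := exists_setLIntegral_rpow_neg_le (α := ℝᵒᵈ) (γ := 1 / 2) (by norm_num)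
    (by norm_num)
  refine ⟨C ^ (1 / p'), ENNReal.rpow_ne_top_of_nonneg (by positivity) hC,
    fun ρ σ t c g hg ht htc hc => ?_⟩
  set μ := scaleMeasure p' ρ σ with hμ
  set M : ℝ → ℝ≥0∞ := fun τ => μ (Ici τ) with hM
  have hMm : Measurable M := measurable_measure_Ici μ
  have hMle : ∀ τ ∈ Ioi t, M τ ≤ c := fun τ hτ =>
    (le_self_add.trans (negStieltjes_Ici_add_le _ (tendsto_tailSup _) (ht.trans hτ) hτ)).trans htc
  have hM0 : ∀ᵐ τ ∂μ, M τ ≠ 0 := ae_measure_Iic_ne_zero (α := ℝᵒᵈ) μ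
  have hneg : ∫⁻ τ in Ioi t, M τ ^ (-(1 / 2) : ℝ) ∂μ ≤ C * μ (Ioi t) ^ (1 - 1 / 2 : ℝ) :=
    h μ (Iio t : Set ℝᵒᵈ)
  calc ∫⁻ τ in Ioi t, g τ ∂μ
      = ∫⁻ τ in Ioi t, (g τ * M τ ^ (1 / (2 * p'))) * M τ ^ (-(1 / (2 * p'))) ∂μ := by
        refine lintegral_congr_ae ?_
        filter_upwards [ae_restrict_mem measurableSet_Ioi, ae_restrict_of_ae hM0] with τ hτ h0
        rw [mul_assoc, ← ENNReal.rpow_add _ _ h0 ((hMle τ hτ).trans_lt hc.lt_top).ne]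
        simp
    _ ≤ (∫⁻ τ in Ioi t, (g τ * M τ ^ (1 / (2 * p'))) ^ p ∂μ) ^ (1 / p) *
        (∫⁻ τ in Ioi t, (M τ ^ (-(1 / (2 * p')))) ^ p' ∂μ) ^ (1 / p') :=
        ENNReal.lintegral_mul_le_Lp_mul_Lq _ hp (hg.mul (hMm.pow_const _)).aemeasurable
          (hMm.pow_const _).aemeasurable
    _ ≤ (∫⁻ τ in {τ | M τ ≤ c}, g τ ^ p * M τ ^ ((p - 1) / 2) ∂μ) ^ (1 / p) *
        (C * c ^ (1 / 2 : ℝ)) ^ (1 / p') := by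
        refine mul_le_mul' (ENNReal.rpow_le_rpow ?_ (by positivity))
          (ENNReal.rpow_le_rpow ?_ (by positivity))
        · refine le_trans (le_of_eq (lintegral_congr fun τ => ?_))
            (lintegral_mono_set (s := Ioi t) hMle)
          rw [ENNReal.mul_rpow_of_nonneg _ _ hp0.le, ← ENNReal.rpow_mul,
            ← hp.div_conj_eq_sub_one]
          congr 2; field_simp
        · refine le_trans (le_of_eq (lintegral_congr fun τ => ?_))
            (hneg.trans (mul_le_mul_right ?_ _))
          · rw [← ENNReal.rpow_mul]
            congr 1; field_simp
          · rw [show (1 - 1 / 2 : ℝ) = 1 / 2 by norm_num]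
            exact ENNReal.rpow_le_rpow ((scaleMeasure_Ioi_le p' ρ σ ht).trans htc) (by norm_num)
    _ = _ := by
        rw [ENNReal.mul_rpow_of_nonneg _ _ (by positivity), ← ENNReal.rpow_mul, mul_comm]
        congr 3; field_simp

/-! ### Lower bound for the supremum operator -/

theorem iSup_rpow_le_tsum {ι : Type*} (x : ι → ℝ≥0∞) {p : ℝ} (hp : 0 < p) :
    (⨆ k, x k) ^ p ≤ ∑' k, x k ^ p := by
  have h := (ENNReal.orderIsoRpow p hp).map_iSup x
  simp only [ENNReal.orderIsoRpow_apply] at h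
  rw [h]
  exact iSup_le fun k => ENNReal.le_tsum (f := fun k => x k ^ p) k

/-- The part of `(0, ∞)` on which `2 ^ k < φ ≤ 2 ^ (k + 1)`. -/
def dyadicLayer (φ : ℝ → ℝ≥0∞) (k : ℤ) : Set ℝ :=
  {t | 0 < t ∧ (2 : ℝ≥0∞) ^ (k : ℝ) < φ t ∧ φ t ≤ 2 ^ ((k : ℝ) + 1)}

theorem measurableSet_dyadicLayer {φ : ℝ → ℝ≥0∞} (hφ : Measurable φ) (k : ℤ) :
    MeasurableSet (dyadicLayer φ k) :=
  measurableSet_Ioi.inter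
    ((measurableSet_lt measurable_const hφ).inter (measurableSet_le hφ measurable_const))

theorem exists_mem_dyadicLayer {φ : ℝ → ℝ≥0∞} {t : ℝ} (ht : 0 < t) (h0 : φ t ≠ 0)
    (hfin : φ t ≠ ∞) : ∃ k, t ∈ dyadicLayer φ k := by
  obtain ⟨k, hk1, hk2⟩ := ENNReal.exists_mem_Ioc_zpow h0 hfin (y := 2) (by norm_num) (by norm_num)
  refine ⟨k, ht, by rwa [ENNReal.rpow_intCast], ?_⟩
  rw [← ENNReal.rpow_intCast] at hk2
  push_cast at hk2
  exact hk2

theorem eq_of_mem_dyadicLayer {φ : ℝ → ℝ≥0∞} {t : ℝ} {k l : ℤ} (hk : t ∈ dyadicLayer φ k)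
    (hl : t ∈ dyadicLayer φ l) : k = l := by
  have key : ∀ m n : ℤ, t ∈ dyadicLayer φ m → t ∈ dyadicLayer φ n → m ≤ n := by
    intro m n hm hn
    by_contra! h
    have h1 : ((n : ℝ) + 1) ≤ (m : ℝ) := by exact_mod_cast h
    exact absurd ((hm.2.1.trans_le hn.2.2).trans_le
      (ENNReal.rpow_le_rpow_of_exponent_le (by norm_num) h1)) (lt_irrefl _)
  exact le_antisymm (key k l hk hl) (key l k hl hk)

/-- The tail integrals `∫_{τ > t} g d(-φ)` of a function `g` are dominated, on sets which
exhaust the half line, by the images under the operator of functions of comparable norm. On each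
dyadic layer of `φ` the test function is a multiple of one of those of `exists_one_le_supOp`. -/
theorem exists_setLIntegral_Ioi_le_supOp {p p' : ℝ} (hp : p.HolderConjugate p') :
    ∃ C : ℝ≥0∞, C ≠ ∞ ∧ ∀ (ρ : ℝ → ℝ≥0∞) (σ : Measure ℝ) (g : ℝ → ℝ≥0∞), Measurable g →
      (∀ t, 0 < t → scaleFun p' ρ σ t ≠ ∞) →
      ∃ (f : ℕ → ℝ → ℝ≥0∞) (D : ℕ → Set ℝ), (∀ n, Measurable (f n)) ∧
        (∀ n, ∫⁻ y, f n y ^ p ∂σ ≤ C * ∫⁻ τ, g τ ^ p ∂(scaleMeasure p' ρ σ)) ∧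
        (∀ n, MeasurableSet (D n)) ∧ Monotone D ∧ (∀ t, 0 < t → ∃ n, t ∈ D n) ∧
        ∀ n t, 0 < t → t ∈ D n →
          ∫⁻ τ in Ioi t, g τ ∂(scaleMeasure p' ρ σ) ≤ supOp ρ σ (f n) t := by
  have hp0 := hp.pos
  have hp1 := hp.lt
  have hp'0 := hp.symm.pos
  set β := (p - 1) / 2 with hβ
  have hβ0 : 0 < β := by rw [hβ]; linarith
  obtain ⟨C₁, hC₁, h₁⟩ := exists_setLIntegral_Ioi_le hp
  obtain ⟨C₂, hC₂, h₂⟩ := exists_tsum_dyadic_le hβ0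
  refine ⟨C₁ ^ p * 2 ^ β * C₂, ENNReal.mul_ne_top (ENNReal.mul_ne_top
    (ENNReal.rpow_ne_top_of_nonneg hp0.le hC₁) (two_rpow_ne_top _)) hC₂,
    fun ρ σ g hg hφ => ?_⟩
  set φ := scaleFun p' ρ σ with hφdef
  have hφm : Measurable φ := measurable_tailSup _
  set μ := scaleMeasure p' ρ σ with hμ
  set M : ℝ → ℝ≥0∞ := fun τ => μ (Ici τ) with hM
  have hMm : Measurable M := measurable_measure_Ici μ
  have hMt : ∀ᵐ τ ∂μ, M τ ≠ ∞ := by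
    exact (ae_pos_of_measure_Iic_zero (negStieltjes_Iic_zero _)).mono fun t ht =>
      negStieltjes_Ici_ne_top _ hφ ht
  -- a layer need not have a last point, hence the sequences `s k` of points of the layers
  choose s hsmono hs using fun k : ℤ => exists_monotone_seq_cofinal (dyadicLayer φ k)
  have hκ : ∀ (k : ℤ) (n : ℕ), ∃ κ : ℝ → ℝ≥0∞, Measurable κ ∧
      ∫⁻ y, κ y ^ p ∂σ ≤ ((2 : ℝ≥0∞) ^ (k : ℝ)) ^ (-(p - 1)) ∧
      ((dyadicLayer φ k).Nonempty → ∀ t ≤ s k n, 1 ≤ supOp ρ σ κ t) := by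
    intro k n
    by_cases hne : (dyadicLayer φ k).Nonempty
    · have hsk := (hs k hne).1 n
      obtain ⟨κ, hκ1, hκ2, hκ3⟩ := exists_one_le_supOp hp (hφ _ hsk.1) hsk.2.1
      exact ⟨κ, hκ1, hκ2, fun _ => hκ3⟩
    · exact ⟨fun _ => 0, measurable_const, by simp [hp0], fun h => absurd h hne⟩
  choose κ hκm hκp hκ1 using hκ
  -- `h k` is the bound for the tail integrals which start in the layer `k`
  set X : ℤ → ℝ≥0∞ := fun k => ∫⁻ τ in {τ | M τ ≤ 2 ^ ((k : ℝ) + 1)}, g τ ^ p * M τ ^ β ∂μ with hX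
  set h : ℤ → ℝ≥0∞ := fun k =>
    C₁ * ((2 : ℝ≥0∞) ^ ((k : ℝ) + 1)) ^ (1 / (2 * p')) * X k ^ (1 / p) with hh
  have hf : ∀ k n, Measurable fun y => h k * κ k n y := fun k n => (hκm k n).const_mul _
  -- on `D n` the `n`-th test function is large enough, as the points of the layer `k` in `D n` lie
  -- to the left of `s k n`
  refine ⟨fun n y => ⨆ k, h k * κ k n y, fun n => {t | ∀ k, t ∈ dyadicLayer φ k → t ≤ s k n},
    fun n => Measurable.iSup fun k => hf k n, fun n => ?_, fun n => ?_, fun m n hmn t ht k hk =>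
    (ht k hk).trans (hsmono k hmn), fun t ht => ?_, fun n t ht hD => ?_⟩
  · have hterm : ∀ k, ∫⁻ y, (h k * κ k n y) ^ p ∂σ ≤ C₁ ^ p * 2 ^ β * ∫⁻ τ, g τ ^ p *
        (if M τ ≤ 2 ^ ((k : ℝ) + 1) then (2 : ℝ≥0∞) ^ (-(k : ℝ) * β) * M τ ^ β else 0) ∂μ := by
      intro k
      have hk1 : h k ^ p = C₁ ^ p * 2 ^ (((k : ℝ) + 1) * β) * X k := by
        rw [hh]
        simp only
        rw [ENNReal.mul_rpow_of_nonneg _ _ hp0.le, ENNReal.mul_rpow_of_nonneg _ _ hp0.le,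
          ← ENNReal.rpow_mul, ← ENNReal.rpow_mul, ← ENNReal.rpow_mul, one_div_mul_cancel hp0.ne',
          ENNReal.rpow_one, hβ, ← hp.div_conj_eq_sub_one]
        congr 3; field_simp
      have hmS : MeasurableSet {τ | M τ ≤ (2 : ℝ≥0∞) ^ ((k : ℝ) + 1)} :=
        measurableSet_le hMm measurable_const
      have hint : ∫⁻ τ, g τ ^ p * (if M τ ≤ 2 ^ ((k : ℝ) + 1) then
          (2 : ℝ≥0∞) ^ (-(k : ℝ) * β) * M τ ^ β else 0) ∂μ = 2 ^ (-(k : ℝ) * β) * X k := by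
        have hgM : Measurable fun τ => g τ ^ p * M τ ^ β := (hg.pow_const _).mul (hMm.pow_const _)
        simp only [hX]
        rw [← lintegral_const_mul _ hgM, ← lintegral_indicator hmS]
        refine lintegral_congr fun τ => ?_
        by_cases hτ : M τ ≤ (2 : ℝ≥0∞) ^ ((k : ℝ) + 1)
        · rw [indicator_of_mem (show τ ∈ {τ | M τ ≤ (2 : ℝ≥0∞) ^ ((k : ℝ) + 1)} from hτ), if_pos hτ]
          ring
        · rw [indicator_of_notMem (show τ ∉ {τ | M τ ≤ (2 : ℝ≥0∞) ^ ((k : ℝ) + 1)} from hτ),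
            if_neg hτ, mul_zero]
      calc ∫⁻ y, (h k * κ k n y) ^ p ∂σ = h k ^ p * ∫⁻ y, κ k n y ^ p ∂σ := by
            simp only [ENNReal.mul_rpow_of_nonneg _ _ hp0.le]
            exact lintegral_const_mul _ ((hκm k n).pow_const _)
        _ ≤ h k ^ p * ((2 : ℝ≥0∞) ^ (k : ℝ)) ^ (-(p - 1)) := mul_le_mul_right (hκp k n) _
        _ = C₁ ^ p * 2 ^ β * (2 ^ (-(k : ℝ) * β) * X k) := by
            rw [hk1, ← ENNReal.rpow_mul]
            have : (2 : ℝ≥0∞) ^ (((k : ℝ) + 1) * β) * 2 ^ ((k : ℝ) * (-(p - 1))) =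
                2 ^ β * 2 ^ (-(k : ℝ) * β) := by
              rw [← ENNReal.rpow_add _ _ (by norm_num) (by norm_num),
                ← ENNReal.rpow_add _ _ (by norm_num) (by norm_num)]
              congr 1; rw [hβ]; ring
            calc _ = C₁ ^ p *
                  (2 ^ (((k : ℝ) + 1) * β) * 2 ^ ((k : ℝ) * (-(p - 1)))) * X k := by ring
              _ = _ := by rw [this]; ring
        _ = _ := by rw [hint]
    have hFm : ∀ k : ℤ, Measurable fun τ => g τ ^ p * (if M τ ≤ 2 ^ ((k : ℝ) + 1) then
        (2 : ℝ≥0∞) ^ (-(k : ℝ) * β) * M τ ^ β else 0) := fun k =>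
      (hg.pow_const _).mul (Measurable.ite (measurableSet_le hMm measurable_const)
        ((hMm.pow_const _).const_mul _) measurable_const)
    calc ∫⁻ y, (⨆ k, h k * κ k n y) ^ p ∂σ
        ≤ ∫⁻ y, ∑' k, (h k * κ k n y) ^ p ∂σ := lintegral_mono fun y => iSup_rpow_le_tsum _ hp0
      _ = ∑' k, ∫⁻ y, (h k * κ k n y) ^ p ∂σ :=
          lintegral_tsum fun k => ((hf k n).pow_const _).aemeasurable
      _ ≤ ∑' k : ℤ, C₁ ^ p * 2 ^ β * ∫⁻ τ, g τ ^ p * (if M τ ≤ 2 ^ ((k : ℝ) + 1) then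
          (2 : ℝ≥0∞) ^ (-(k : ℝ) * β) * M τ ^ β else 0) ∂μ := ENNReal.tsum_le_tsum hterm
      _ = C₁ ^ p * 2 ^ β * ∫⁻ τ, g τ ^ p * ∑' k : ℤ, (if M τ ≤ 2 ^ ((k : ℝ) + 1) then
          (2 : ℝ≥0∞) ^ (-(k : ℝ) * β) * M τ ^ β else 0) ∂μ := by
          rw [ENNReal.tsum_mul_left, ← lintegral_tsum fun k => (hFm k).aemeasurable]
          simp only [ENNReal.tsum_mul_left]
      _ ≤ C₁ ^ p * 2 ^ β * ∫⁻ τ, C₂ * g τ ^ p ∂μ := by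
          refine mul_le_mul_right (lintegral_mono_ae ?_) _
          filter_upwards [hMt] with τ hτ
          rw [mul_comm C₂]
          exact mul_le_mul_right (h₂ _ hτ) _
      _ = _ := by rw [lintegral_const_mul _ (hg.pow_const _)]; ring
  · simp only [ofPred_forall]
    exact MeasurableSet.iInter fun k =>
      (measurableSet_dyadicLayer hφm k).imp measurableSet_Iic
  · by_cases h0 : φ t = 0
    · exact ⟨0, fun k hk => absurd (zero_le.trans_lt hk.2.1) (by rw [h0]; exact lt_irrefl _)⟩
    · obtain ⟨k, hk⟩ := exists_mem_dyadicLayer ht h0 (hφ t ht)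
      obtain ⟨n, hn⟩ := (hs k ⟨t, hk⟩).2 t hk
      exact ⟨n, fun l hl => eq_of_mem_dyadicLayer hk hl ▸ hn⟩
  · by_cases h0 : φ t = 0
    · have hμ0 : μ (Ioi t) = 0 := le_antisymm (h0 ▸ scaleMeasure_Ioi_le p' ρ σ ht) zero_le
      rw [setLIntegral_measure_zero _ _ hμ0]
      exact zero_le
    · obtain ⟨k, hk⟩ := exists_mem_dyadicLayer ht h0 (hφ t ht)
      calc ∫⁻ τ in Ioi t, g τ ∂μ ≤ h k := h₁ ρ σ t _ g hg ht hk.2.2 (two_rpow_ne_top _)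
        _ ≤ h k * supOp ρ σ (κ k n) t :=
            le_mul_of_one_le_right zero_le (hκ1 k n ⟨t, hk⟩ t (hD k hk))
        _ = supOp ρ σ (fun y => h k * κ k n y) t := (supOp_const_mul ρ σ (hκm k n) _ t).symm
        _ ≤ _ := supOp_mono ρ σ (fun y => le_iSup (fun k => h k * κ k n y) k) t

/-- A bound for the operator is, up to a constant, a bound for the Hardy operators with respect
to `d(-φ)`. -/
theorem exists_rpow_lintegral_setLIntegral_Ioi_le {p p' : ℝ} (hp : p.HolderConjugate p') {q : ℝ}
    (hq : 0 < q) :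
    ∃ C : ℝ≥0∞, C ≠ ∞ ∧ ∀ (ρ : ℝ → ℝ≥0∞) (σ ω α : Measure ℝ) (N : ℝ≥0∞),
      α (Iic 0) = 0 → (∀ t, 0 < t → scaleFun p' ρ σ t ≠ ∞) → IsSupOpBound p q ρ σ ω α N →
      ∀ g : ℝ → ℝ≥0∞, Measurable g → ∫⁻ τ, g τ ^ p ∂(scaleMeasure p' ρ σ) ≠ ∞ →
      (∫⁻ x, (∫⁻ t in Iic x, ∫⁻ τ in Ioi t, g τ ∂(scaleMeasure p' ρ σ) ∂α) ^ q ∂ω) ^ (1 / q) ≤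
        C * N * (∫⁻ τ, g τ ^ p ∂(scaleMeasure p' ρ σ)) ^ (1 / p) := by
  have hp0 := hp.pos
  obtain ⟨C, hC, h⟩ := exists_setLIntegral_Ioi_le_supOp hp
  refine ⟨C ^ (1 / p), ENNReal.rpow_ne_top_of_nonneg (by positivity) hC,
    fun ρ σ ω α N hα0 hφ hN g hg hgfin => ?_⟩
  obtain ⟨f, D, hf, hfp, hDm, hDmono, hDex, hfD⟩ := h ρ σ g hg hφ
  set μ := scaleMeasure p' ρ σ with hμ
  set G : ℝ → ℝ≥0∞ := fun t => ∫⁻ τ in Ioi t, g τ ∂μ with hG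
  have hGm : Measurable G := by
    have : Antitone G := fun s t hst => lintegral_mono_set (Ioi_subset_Ioi hst)
    exact this.measurable
  have hpos := ae_pos_of_measure_Iic_zero hα0
  set P : ℕ → ℝ → ℝ≥0∞ := fun n x => ∫⁻ t in Iic x, (D n).indicator G t ∂α with hP
  have hPm : ∀ n, Measurable (P n) := fun n => measurable_setLIntegral_Iic' _ _
  have hDGmono : ∀ t, Monotone fun n => (D n).indicator G t := fun t m n hmn =>
    indicator_le_indicator_of_subset (hDmono hmn) (fun _ => zero_le) t
  have hbound : ∀ n, (∫⁻ x, P n x ^ q ∂ω) ^ (1 / q) ≤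
      C ^ (1 / p) * N * (∫⁻ τ, g τ ^ p ∂μ) ^ (1 / p) := by
    intro n
    calc (∫⁻ x, P n x ^ q ∂ω) ^ (1 / q)
        ≤ (∫⁻ x, (∫⁻ t in Iic x, supOp ρ σ (f n) t ∂α) ^ q ∂ω) ^ (1 / q) := by
          refine ENNReal.rpow_le_rpow (lintegral_mono fun x => ENNReal.rpow_le_rpow
            (lintegral_mono_ae (ae_restrict_of_ae ?_)) hq.le) (by positivity)
          filter_upwards [hpos] with t ht
          by_cases hD : t ∈ D n
          · rw [indicator_of_mem hD]; exact hfD n t ht hD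
          · rw [indicator_of_notMem hD]; exact zero_le
      _ ≤ N * (∫⁻ y, f n y ^ p ∂σ) ^ (1 / p) :=
          hN _ (hf n) ((hfp n).trans_lt (ENNReal.mul_ne_top hC hgfin).lt_top).ne
      _ ≤ N * (C * ∫⁻ τ, g τ ^ p ∂μ) ^ (1 / p) :=
          mul_le_mul_right (ENNReal.rpow_le_rpow (hfp n) (by positivity)) _
      _ = _ := by rw [ENNReal.mul_rpow_of_nonneg _ _ (by positivity)]; ring
  have hPlim : ∀ x, Tendsto (fun n => P n x) atTop (𝓝 (∫⁻ t in Iic x, G t ∂α)) := by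
    intro x
    refine lintegral_tendsto_of_tendsto_of_monotone
      (fun n => (hGm.indicator (hDm n)).aemeasurable) (ae_of_all _ hDGmono)
      (ae_restrict_of_ae ?_)
    filter_upwards [hpos] with t ht
    obtain ⟨n, hn⟩ := hDex t ht
    refine tendsto_const_nhds.congr' ?_
    filter_upwards [eventually_ge_atTop n] with m hm
    rw [indicator_of_mem (hDmono hm hn)]
  have hlim : Tendsto (fun n => ∫⁻ x, P n x ^ q ∂ω) atTop
      (𝓝 (∫⁻ x, (∫⁻ t in Iic x, G t ∂α) ^ q ∂ω)) :=
    lintegral_tendsto_of_tendsto_of_monotone (fun n => ((hPm n).pow_const _).aemeasurable)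
      (ae_of_all _ fun x m n hmn => ENNReal.rpow_le_rpow
        (lintegral_mono fun t => hDGmono t hmn) hq.le)
      (ae_of_all _ fun x => (ENNReal.continuous_rpow_const.tendsto _).comp (hPlim x))
  exact le_of_tendsto ((ENNReal.continuous_rpow_const.tendsto _).comp hlim)
    (Eventually.of_forall hbound)

/-- The bound which is obtained from the test function `1` on `(-∞, τ]`. -/
theorem scaleFun_rpow_mul_le {p p' q : ℝ} (hp : p.HolderConjugate p') (hq : 0 < q)
    {ρ : ℝ → ℝ≥0∞} {σ ω α : Measure ℝ} [SigmaFinite σ] {N : ℝ≥0∞}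
    (hN : IsSupOpBound p q ρ σ ω α N) (t : ℝ) :
    scaleFun p' ρ σ t ^ (1 / p') * (∫⁻ x in Iic t, α (Iic x) ^ q ∂ω) ^ (1 / q) ≤ N := by
  have hp'0 := hp.symm.pos
  rw [scaleFun, ← tailSup_rpow _ (by positivity), ← tailSup_mul_const]
  refine iSup_le fun τ => iSup_le fun hτ => iSup_le fun htτ => ?_
  set c := (∫⁻ x in Iic t, α (Iic x) ^ q ∂ω) ^ (1 / q) with hc
  have h1 := rpow_setLIntegral_mul_le hp (σ := σ) (g := fun _ => 1) measurable_const
    (E := Iic τ) measurableSet_Iic (c := ρ τ * c) (N := N) fun f hf hfin => ?_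
  · simp only [ENNReal.one_rpow, setLIntegral_one] at h1 ⊢
    rw [ENNReal.mul_rpow_of_nonneg _ _ (by positivity), ← ENNReal.rpow_mul,
      mul_one_div_cancel hp'0.ne', ENNReal.rpow_one]
    exact le_of_eq_of_le (by ring) h1
  · refine le_trans ?_ (hN f hf hfin)
    simp only [mul_one]
    rw [mul_left_comm, ← mul_assoc]
    refine mul_rpow_setLIntegral_le hq measurableSet_Iic (measurable_measure_Iic α) fun x hx => ?_
    rw [← setLIntegral_const]
    exact setLIntegral_mono' measurableSet_Iic fun s hs =>
      mul_setLIntegral_le_supOp hτ ((mem_Iic.1 hs).trans (hx.trans htτ))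

/-- The term of the limit at infinity is bounded by letting `t → ∞` in `scaleFun_rpow_mul_le`. -/
theorem rpow_mul_scaleLim_le {p p' q : ℝ} (hp : p.HolderConjugate p') (hq : 0 < q)
    {ρ : ℝ → ℝ≥0∞} {σ ω α : Measure ℝ} [SigmaFinite σ] {N : ℝ≥0∞}
    (hN : IsSupOpBound p q ρ σ ω α N) :
    (∫⁻ x, α (Iic x) ^ q ∂ω) ^ (1 / q) * scaleLim p' ρ σ ^ (1 / p') ≤ N := by
  have hp'0 := hp.symm.pos
  set I : ℕ → ℝ≥0∞ := fun n => ∫⁻ x in Iic (n : ℝ), α (Iic x) ^ q ∂ω with hI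
  have hmono : Monotone I := fun m n hmn =>
    lintegral_mono_set (Iic_subset_Iic.2 (by exact_mod_cast hmn))
  have hlim : Tendsto I atTop (𝓝 (∫⁻ x, α (Iic x) ^ q ∂ω)) := by
    have h1 : ∀ n : ℕ, I n = ω.withDensity (fun x => α (Iic x) ^ q) (Iic (n : ℝ)) := fun n =>
      (withDensity_apply _ measurableSet_Iic).symm
    have h2 : ∫⁻ x, α (Iic x) ^ q ∂ω = ω.withDensity (fun x => α (Iic x) ^ q) univ := by
      rw [withDensity_apply _ MeasurableSet.univ, setLIntegral_univ]
    have h3 : ⋃ n : ℕ, Iic (n : ℝ) = univ :=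
      eq_univ_of_forall fun x => mem_iUnion.2 (exists_nat_ge x)
    rw [h2, ← h3, funext h1]
    exact tendsto_measure_iUnion_atTop fun m n hmn => Iic_subset_Iic.2 (by exact_mod_cast hmn)
  have hprod : Tendsto (fun n => I n ^ (1 / q) * scaleLim p' ρ σ ^ (1 / p')) atTop
      (𝓝 ((∫⁻ x, α (Iic x) ^ q ∂ω) ^ (1 / q) * scaleLim p' ρ σ ^ (1 / p'))) :=
    tendsto_mul_of_monotone (fun m n hmn => ENNReal.rpow_le_rpow (hmono hmn) (by positivity))
      monotone_const ((ENNReal.continuous_rpow_const.tendsto _).comp hlim) tendsto_const_nhds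
  refine le_of_tendsto hprod (Eventually.of_forall fun n => ?_)
  refine le_trans ?_ (scaleFun_rpow_mul_le hp hq hN (n : ℝ))
  rw [mul_comm]
  exact mul_le_mul_left (ENNReal.rpow_le_rpow (limTailSup_le _ _) (by positivity)) _

/-- Necessity: every bound of the operator dominates the characterizing quantities. -/
theorem exists_charSum_le {p p' q : ℝ} (hp : p.HolderConjugate p') (hq : 1 < q)
    {O : Measure ℝ → Measure ℝ → (ℝ → ℝ → ℝ≥0∞) → ℝ≥0∞}
    {H : Measure ℝ → Measure ℝ → ℝ≥0∞} {H' : Measure ℝᵒᵈ → Measure ℝᵒᵈ → ℝ≥0∞}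
    (hO : IsOinarovFunctional p q O) (hH : IsHardyFunctional p q H)
    (hH' : IsHardyFunctional p q H') :
    ∃ C : ℝ≥0∞, C ≠ ∞ ∧ ∀ (ρ : ℝ → ℝ≥0∞) (σ ω α : Measure ℝ) (N : ℝ≥0∞) [SigmaFinite σ]
      [SigmaFinite ω] [SFinite α] [NullSingletonClass α], α (Iic 0) = 0 →
      (∀ x, α (Iic x) ≠ ∞) → (∀ t, 0 < t → scaleFun p' ρ σ t ≠ ∞) →
      IsSupOpBound p q ρ σ ω α N → charSum p' q O H H' ρ σ ω α ≤ C * N := by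
  have hp0 := hp.pos
  have hp1 := hp.lt
  have hp'0 := hp.symm.pos
  have hp'1 := hp.symm.lt
  have hq0 : 0 < q := by linarith
  obtain ⟨C₁, hC₁, h₁⟩ := hO
  obtain ⟨C₂, hC₂, h₂⟩ := hH
  obtain ⟨C₃, hC₃, h₃⟩ := exists_of_isHardyFunctional_dual hH'
  obtain ⟨C, hC, h⟩ := exists_rpow_lintegral_setLIntegral_Ioi_le hp hq0
  refine ⟨C₁ + C₂ * C + C₃ * C + 1, by finiteness, fun ρ σ ω α N _ _ _ _ hα0 hαt hφ hN => ?_⟩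
  set μ := scaleMeasure p' ρ σ with hμ
  set A : ℝ → ℝ≥0∞ := fun x => α (Iic x) with hA
  have hAm : Measurable A := measurable_measure_Iic α
  have : SigmaFinite μ := sigmaFinite_negStieltjes _ hφ
  have : SigmaFinite (μ.withDensity fun t => A t ^ p') :=
    SigmaFinite.withDensity_of_ne_top
      (ae_of_all _ fun t => ENNReal.rpow_ne_top_of_nonneg hp'0.le (hαt t))
  have : SigmaFinite (ω.withDensity fun t => A t ^ q) :=
    SigmaFinite.withDensity_of_ne_top
      (ae_of_all _ fun t => ENNReal.rpow_ne_top_of_nonneg hq0.le (hαt t))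
  have hrhs : (C₁ + C₂ * C + C₃ * C + 1) * N = C₁ * N + C₂ * (C * N) + C₃ * (C * N) + N := by ring
  rw [hrhs]
  refine add_le_add (add_le_add (add_le_add ?_ ?_) ?_) (rpow_mul_scaleLim_le hp hq0 hN)
  · refine (h₁ σ ω _ (isOinarovKernel_intervalKernel _)).2 N fun f hf hfin =>
      le_trans (ENNReal.rpow_le_rpow (lintegral_mono fun x => ENNReal.rpow_le_rpow ?_ hq0.le)
        (by positivity)) (hN f hf hfin)
    rw [kernelOp_eq_setLIntegral_tailSup hf]
    exact lintegral_mono fun t => tailSup_mul_le_supOp ρ σ f t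
  · refine (h₂ (μ.withDensity fun t => A t ^ p') ω).2 (C * N) fun f hf hfin => ?_
    -- the test function is `g = f A ^ (p' - 1)`
    have hp'p : (p' - 1) * p = p' := by
      have := hp.sub_one_mul_conj
      linarith
    have hgm : Measurable fun x => f x * A x ^ (p' - 1) := hf.mul (hAm.pow_const _)
    have e1 : ∫⁻ x, f x ^ p ∂(μ.withDensity fun t => A t ^ p') =
        ∫⁻ x, (f x * A x ^ (p' - 1)) ^ p ∂μ := by
      rw [lintegral_withDensity_eq_lintegral_mul μ (hAm.pow_const _) (hf.pow_const _)]
      refine lintegral_congr fun x => ?_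
      rw [Pi.mul_apply, ENNReal.mul_rpow_of_nonneg _ _ hp0.le, ← ENNReal.rpow_mul, hp'p, mul_comm]
    have e2 : ∀ x, ∫⁻ y in Iic x, f y ∂(μ.withDensity fun t => A t ^ p') =
        ∫⁻ y in Iic x, A y * (f y * A y ^ (p' - 1)) ∂μ := by
      intro x
      rw [setLIntegral_withDensity_eq_setLIntegral_mul μ (hAm.pow_const _) hf measurableSet_Iic]
      refine lintegral_congr fun y => ?_
      have : A y ^ p' = A y * A y ^ (p' - 1) := by
        conv_rhs => rw [← ENNReal.rpow_one (A y), ← ENNReal.rpow_mul, one_mul,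
          ← ENNReal.rpow_add_of_nonneg _ _ zero_le_one (by linarith)]
        congr 1; ring
      rw [Pi.mul_apply, this]; ring
    rw [e1] at hfin ⊢
    refine le_trans (ENNReal.rpow_le_rpow (lintegral_mono fun x => ENNReal.rpow_le_rpow ?_ hq0.le)
      (by positivity)) (h ρ σ ω α N hα0 hφ hN _ hgm hfin)
    rw [e2]
    exact setLIntegral_Iic_mul_le hgm x
  · refine (h₃ μ (ω.withDensity fun t => A t ^ q)).2 (C * N) fun f hf hfin => ?_
    refine le_trans (ENNReal.rpow_le_rpow ?_ (by positivity)) (h ρ σ ω α N hα0 hφ hN f hf hfin)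
    rw [lintegral_withDensity_eq_lintegral_mul ω (hAm.pow_const _)
      ((measurable_setLIntegral_Ici' μ f).pow_const _)]
    refine lintegral_mono fun x => ?_
    rw [Pi.mul_apply, ← ENNReal.mul_rpow_of_nonneg _ _ hq0.le]
    exact ENNReal.rpow_le_rpow (mul_setLIntegral_Ici_le hf x) hq0.le

/-! ### Measures on the half line -/

/-- The measure on the half line `(0, ∞)` with density `v`. -/
noncomputable def halfLine (v : ℝ → ℝ≥0∞) : Measure ℝ := (volume.restrict (Ioi 0)).withDensity v

instance (v : ℝ → ℝ≥0∞) : SFinite (halfLine v) := by unfold halfLine; infer_instance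

instance (v : ℝ → ℝ≥0∞) : NullSingletonClass (halfLine v) := withDensity_nullSingletonClass v

theorem sigmaFinite_halfLine {v : ℝ → ℝ≥0∞} (h : ∀ᵐ t ∂(volume.restrict (Ioi (0 : ℝ))), v t ≠ ∞) :
    SigmaFinite (halfLine v) :=
  SigmaFinite.withDensity_of_ne_top h

theorem Iic_inter_Ioi_zero (t : ℝ) : Iic t ∩ Ioi 0 = Ioc 0 t := by
  ext x; simp [and_comm]

section HalfLine

variable {v F : ℝ → ℝ≥0∞}

theorem lintegral_halfLine (hv : AEMeasurable v (volume.restrict (Ioi 0)))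
    (hF : AEMeasurable F (volume.restrict (Ioi 0))) :
    ∫⁻ x, F x ∂(halfLine v) = ∫⁻ x in Ioi 0, v x * F x :=
  lintegral_withDensity_eq_lintegral_mul₀ hv hF

theorem setLIntegral_halfLine (hv : AEMeasurable v (volume.restrict (Ioi 0)))
    (hF : AEMeasurable F (volume.restrict (Ioi 0))) {E : Set ℝ} (hE : MeasurableSet E) :
    ∫⁻ x in E, F x ∂(halfLine v) = ∫⁻ x in E ∩ Ioi 0, v x * F x := by
  rw [halfLine, setLIntegral_withDensity_eq_lintegral_mul₀ hv hF hE,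
    Measure.restrict_restrict hE]
  rfl

theorem setLIntegral_Iic_halfLine (hv : AEMeasurable v (volume.restrict (Ioi 0)))
    (hF : AEMeasurable F (volume.restrict (Ioi 0))) (t : ℝ) :
    ∫⁻ x in Iic t, F x ∂(halfLine v) = ∫⁻ x in Ioc 0 t, v x * F x := by
  rw [setLIntegral_halfLine hv hF measurableSet_Iic, Iic_inter_Ioi_zero]

theorem setLIntegral_Ici_halfLine (hv : AEMeasurable v (volume.restrict (Ioi 0)))
    (hF : AEMeasurable F (volume.restrict (Ioi 0))) {t : ℝ} (ht : 0 < t) :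
    ∫⁻ x in Ici t, F x ∂(halfLine v) = ∫⁻ x in Ioi t, v x * F x := by
  have hsub : Ici t ∩ Ioi 0 = Ici t := inter_eq_left.2 fun x hx => ht.trans_le hx
  rw [setLIntegral_halfLine hv hF measurableSet_Ici, hsub]
  exact setLIntegral_congr Ioi_ae_eq_Ici.symm

theorem halfLine_Iic (v : ℝ → ℝ≥0∞) (t : ℝ) : halfLine v (Iic t) = prim v t := by
  rw [halfLine, withDensity_apply _ measurableSet_Iic, Measure.restrict_restrict measurableSet_Iic,
    Iic_inter_Ioi_zero, prim]

theorem halfLine_Ici (v : ℝ → ℝ≥0∞) {t : ℝ} (ht : 0 < t) :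
    halfLine v (Ici t) = ∫⁻ x in Ioi t, v x := by
  have hsub : Ici t ∩ Ioi 0 = Ici t := inter_eq_left.2 fun x hx => ht.trans_le hx
  rw [halfLine, withDensity_apply _ measurableSet_Ici, Measure.restrict_restrict measurableSet_Ici,
    hsub]
  exact setLIntegral_congr Ioi_ae_eq_Ici.symm

theorem prim_of_nonpos (v : ℝ → ℝ≥0∞) {t : ℝ} (ht : t ≤ 0) : prim v t = 0 := by
  rw [prim, Ioc_eq_empty (not_lt.2 ht)]; simp

theorem ae_ne_top_of_setLIntegral (hv : AEMeasurable v (volume.restrict (Ioi 0)))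
    (h : ∀ x : ℝ, 0 < x → ∫⁻ t in Ioc 0 x, v t < ∞) :
    ∀ᵐ t ∂(volume.restrict (Ioi (0 : ℝ))), v t ≠ ∞ := by
  have hcov : Ioi (0 : ℝ) = ⋃ n : ℕ, Ioc (0 : ℝ) (n + 1) := by
    ext x
    simp only [mem_Ioi, mem_iUnion, mem_Ioc]
    refine ⟨fun hx => ?_, fun ⟨_, hx⟩ => hx.1⟩
    obtain ⟨n, hn⟩ := exists_nat_ge x
    exact ⟨n, hx, hn.trans (by linarith)⟩
  rw [hcov, ae_restrict_iUnion_iff]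
  intro n
  have hm : AEMeasurable v (volume.restrict (Ioc 0 ((n : ℝ) + 1))) :=
    hv.mono_measure (Measure.restrict_mono Ioc_subset_Ioi_self le_rfl)
  exact (ae_lt_top' hm (h _ (by positivity)).ne).mono fun t ht => ht.ne

end HalfLine

theorem IsWeight.prim_ne_zero {a : ℝ → ℝ≥0∞} (ha : IsWeight a) {t : ℝ} (ht : 0 < t) :
    prim a t ≠ 0 := (ha.pos t ht).ne'

theorem IsWeight.prim_ne_top {a : ℝ → ℝ≥0∞} (ha : IsWeight a) (t : ℝ) : prim a t ≠ ∞ := by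
  rcases le_or_gt t 0 with h | h
  · rw [prim_of_nonpos a h]; exact ENNReal.zero_ne_top
  · exact (ha.lt_top t h).ne

theorem IsWeight.ae_ne_top {a : ℝ → ℝ≥0∞} (ha : IsWeight a) :
    ∀ᵐ t ∂(volume.restrict (Ioi (0 : ℝ))), a t ≠ ∞ :=
  ae_ne_top_of_setLIntegral ha.aemeasurable ha.lt_top

theorem setLIntegral_prim_rpow_ne_zero {a w : ℝ → ℝ≥0∞} (ha : IsWeight a) (hw : IsWeight w)
    {q : ℝ} (hq : 0 < q) {t : ℝ} (ht : 0 < t) :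
    ∫⁻ x in Iic t, halfLine a (Iic x) ^ q ∂(halfLine w) ≠ 0 := by
  have hm : Measurable fun x => halfLine a (Iic x) ^ q := (measurable_measure_Iic _).pow_const _
  rw [← pos_iff_ne_zero, setLIntegral_pos_iff hm, pos_iff_ne_zero]
  intro h0
  have h1 : halfLine w (Iic t) = 0 := by
    refine le_antisymm ?_ zero_le
    calc halfLine w (Iic t)
        ≤ halfLine w ((Function.support fun x => halfLine a (Iic x) ^ q) ∩ Iic t) +
          halfLine w (Iic 0) := by
          refine (measure_mono fun x hx => ?_).trans (measure_union_le _ _)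
          rcases le_or_gt x 0 with h | h
          · exact Or.inr h
          · refine Or.inl ⟨?_, hx⟩
            rw [Function.mem_support, halfLine_Iic]
            exact fun h' => ha.prim_ne_zero h ((ENNReal.rpow_eq_zero_iff_of_pos hq).1 h')
      _ = 0 := by rw [h0, halfLine_Iic, prim_of_nonpos w le_rfl, add_zero]
  rw [halfLine_Iic] at h1
  exact hw.prim_ne_zero ht h1

/-! ### The substitution `h b = f σ` -/

/-- The density `σ = b ^ p' v ^ (1 - p')` satisfies `b ^ p = σ ^ (p - 1) v`. -/
theorem dualWeight_rpow_mul {p p' : ℝ} (hp : p.HolderConjugate p') {b v : ℝ → ℝ≥0∞} {t : ℝ}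
    (hb0 : b t ≠ 0) (hbt : b t ≠ ∞) (hv0 : v t ≠ 0) (hvt : v t ≠ ∞) :
    dualWeight p' b v t ≠ 0 ∧ dualWeight p' b v t ≠ ∞ ∧
      dualWeight p' b v t ^ (p - 1) * v t = b t ^ p := by
  have h1 : b t ^ p' ≠ ∞ := ENNReal.rpow_ne_top_of_ne_zero hb0 hbt
  have h2 : v t ^ (1 - p') ≠ ∞ := ENNReal.rpow_ne_top_of_ne_zero hv0 hvt
  refine ⟨mul_ne_zero (ENNReal.rpow_pos (pos_iff_ne_zero.2 hb0) hbt).ne'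
    (ENNReal.rpow_pos (pos_iff_ne_zero.2 hv0) hvt).ne', ENNReal.mul_ne_top h1 h2, ?_⟩
  have e1 : (p - 1) * p' = p := hp.sub_one_mul_conj
  have e2 : p' * (p - 1) = p := by linarith
  have e3 : (1 - p') * (p - 1) = -1 := by linarith
  rw [dualWeight, ENNReal.mul_rpow_of_ne_top h1 h2, ← ENNReal.rpow_mul, ← ENNReal.rpow_mul, e2, e3,
    mul_assoc, ENNReal.rpow_neg_one, ENNReal.inv_mul_cancel hv0 hvt, mul_one]

theorem aemeasurable_dualWeight {p' : ℝ} {b v : ℝ → ℝ≥0∞} (hb : IsWeight b) (hv : IsWeight v) :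
    AEMeasurable (dualWeight p' b v) (volume.restrict (Ioi 0)) :=
  (hb.aemeasurable.pow_const _).mul (hv.aemeasurable.pow_const _)

theorem supHardy_eq_supOp {p' : ℝ} {u : ℝ → ℝ≥0} {b v h f : ℝ → ℝ≥0∞}
    (hσ : AEMeasurable (dualWeight p' b v) (volume.restrict (Ioi 0))) (hf : Measurable f)
    (hhf : ∀ᵐ t ∂(volume.restrict (Ioi (0 : ℝ))), h t * b t = dualWeight p' b v t * f t) :
    supHardy u b h = supOp (ratio u b) (halfLine (dualWeight p' b v)) f := by
  rw [supHardy, supOp]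
  congr 1
  funext τ
  rw [setLIntegral_Iic_halfLine hσ hf.aemeasurable]
  congr 1
  exact lintegral_congr_ae
    (ae_mono (Measure.restrict_mono Ioc_subset_Ioi_self le_rfl) hhf)

theorem lebNorm_eq {p p' : ℝ} (hp : p.HolderConjugate p') {b v h f : ℝ → ℝ≥0∞}
    (hb : ∀ᵐ t ∂(volume.restrict (Ioi (0 : ℝ))), b t ≠ 0 ∧ b t ≠ ∞)
    (hv : ∀ᵐ t ∂(volume.restrict (Ioi (0 : ℝ))), v t ≠ 0 ∧ v t ≠ ∞)
    (hσ : AEMeasurable (dualWeight p' b v) (volume.restrict (Ioi 0))) (hf : Measurable f)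
    (hhf : ∀ᵐ t ∂(volume.restrict (Ioi (0 : ℝ))), h t * b t = dualWeight p' b v t * f t) :
    lebNorm p v h = (∫⁻ t, f t ^ p ∂(halfLine (dualWeight p' b v))) ^ (1 / p) := by
  have hp0 := hp.pos
  have hp1 := hp.lt
  rw [lebNorm, lintegral_halfLine hσ (hf.pow_const _).aemeasurable]
  congr 1
  refine lintegral_congr_ae ?_
  filter_upwards [hb, hv, hhf] with t hbt hvt ht
  obtain ⟨hs0, hst, hs⟩ := dualWeight_rpow_mul hp hbt.1 hbt.2 hvt.1 hvt.2
  set s := dualWeight p' b v t with hsdef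
  have hs1 : s ^ (p - 1) ≠ 0 := (ENNReal.rpow_pos (pos_iff_ne_zero.2 hs0) hst).ne'
  have hs2 : s ^ (p - 1) ≠ ∞ := ENNReal.rpow_ne_top_of_ne_zero hs0 hst
  rw [← ENNReal.mul_left_inj hs1 hs2]
  have h1 := congrArg (fun z => z ^ p) ht
  simp only [ENNReal.mul_rpow_of_nonneg _ _ hp0.le, ← hs] at h1
  have h2 : s ^ p = s * s ^ (p - 1) := by
    conv_rhs => rw [← ENNReal.rpow_one s, ← ENNReal.rpow_mul, one_mul,
      ← ENNReal.rpow_add_of_nonneg _ _ zero_le_one (by linarith)]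
    congr 1; ring
  calc h t ^ p * v t * s ^ (p - 1) = h t ^ p * (s ^ (p - 1) * v t) := by ring
    _ = s * s ^ (p - 1) * f t ^ p := by rw [h1, h2]
    _ = _ := by ring

theorem cesNorm_eq {q : ℝ} {w a F : ℝ → ℝ≥0∞} (hw : IsWeight w) (ha : IsWeight a)
    (hF : Measurable F) :
    cesNorm q w a F =
      (∫⁻ x, (∫⁻ t in Iic x, F t ∂(halfLine a)) ^ q ∂(halfLine w)) ^ (1 / q) := by
  rw [lintegral_halfLine hw.aemeasurable
    ((measurable_setLIntegral_Iic' (halfLine a) F).pow_const q).aemeasurable, cesNorm]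
  congr 1
  refine lintegral_congr fun x => ?_
  rw [setLIntegral_Iic_halfLine ha.aemeasurable hF.aemeasurable, mul_comm]
  simp only [mul_comm]

section Norm

variable {p p' q : ℝ} {u : ℝ → ℝ≥0} {a b v w : ℝ → ℝ≥0∞}

/-- The norm of the operator is the least of its bounds: it is a bound. -/
theorem isSupOpBound_opNorm (hp : p.HolderConjugate p') (hq : 0 < q) (ha : IsWeight a)
    (hw : IsWeight w) (hbm : AEMeasurable b (volume.restrict (Ioi 0)))
    (hb : ∀ᵐ t ∂(volume.restrict (Ioi (0 : ℝ))), b t ≠ 0 ∧ b t ≠ ∞)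
    (hv : ∀ᵐ t ∂(volume.restrict (Ioi (0 : ℝ))), v t ≠ 0 ∧ v t ≠ ∞)
    (hσ : AEMeasurable (dualWeight p' b v) (volume.restrict (Ioi 0))) :
    IsSupOpBound p q (ratio u b) (halfLine (dualWeight p' b v)) (halfLine w) (halfLine a)
      (opNorm p q u b a v w) := by
  intro f hf hfin
  have hp0 := hp.pos
  set σ := dualWeight p' b v with hσdef
  set n := (∫⁻ t, f t ^ p ∂(halfLine σ)) ^ (1 / p) with hn
  set c := (∫⁻ x, (∫⁻ t in Iic x, supOp (ratio u b) (halfLine σ) f t ∂(halfLine a)) ^ q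
    ∂(halfLine w)) ^ (1 / q) with hc
  have hnt : n ≠ ∞ := ENNReal.rpow_ne_top_of_nonneg (by positivity) hfin
  set h : ℝ → ℝ≥0∞ := fun t => σ t * f t / b t with hh
  have hhm : AEMeasurable h (volume.restrict (Ioi 0)) := (hσ.mul hf.aemeasurable).div hbm
  have hhf : ∀ᵐ t ∂(volume.restrict (Ioi (0 : ℝ))), h t * b t = σ t * f t := by
    filter_upwards [hb] with t ht
    exact ENNReal.div_mul_cancel ht.1 ht.2
  have hle : c / n ≤ opNorm p q u b a v w := by
    have h1 : cesNorm q w a (supHardy u b h) / lebNorm p v h ≤ opNorm p q u b a v w :=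
      le_iSup_of_le h (le_iSup (fun _ : AEMeasurable h (volume.restrict (Ioi 0)) =>
        cesNorm q w a (supHardy u b h) / lebNorm p v h) hhm)
    rwa [supHardy_eq_supOp hσ hf hhf, lebNorm_eq hp hb hv hσ hf hhf,
      cesNorm_eq hw ha (measurable_supOp _ _ _)] at h1
  by_cases hn0 : n = 0
  · -- here `f = 0` almost everywhere, and the left-hand side vanishes as well
    have h0 : ∫⁻ t, f t ^ p ∂(halfLine σ) = 0 :=
      (ENNReal.rpow_eq_zero_iff_of_pos (by positivity)).1 hn0
    have hf0 : f =ᵐ[halfLine σ] 0 := by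
      filter_upwards [(lintegral_eq_zero_iff (hf.pow_const _)).1 h0] with t ht
      exact (ENNReal.rpow_eq_zero_iff_of_pos hp0).1 ht
    have hT : ∀ t, supOp (ratio u b) (halfLine σ) f t = 0 := fun t => by
      have : ∀ τ, ∫⁻ y in Iic τ, f y ∂(halfLine σ) = 0 := fun τ => by
        rw [lintegral_congr_ae (ae_restrict_of_ae hf0)]; simp
      simp [supOp, tailSup, this]
    simp only [hT, lintegral_zero, ENNReal.zero_rpow_of_pos hq] at hc
    rw [hc, ENNReal.zero_rpow_of_pos (by positivity)]
    exact zero_le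
  · rwa [ENNReal.div_le_iff_le_mul (Or.inl hn0) (Or.inl hnt)] at hle

theorem opNorm_le_of_isSupOpBound (hp : p.HolderConjugate p') (ha : IsWeight a)
    (hw : IsWeight w) (hbm : AEMeasurable b (volume.restrict (Ioi 0)))
    (hb : ∀ᵐ t ∂(volume.restrict (Ioi (0 : ℝ))), b t ≠ 0 ∧ b t ≠ ∞)
    (hv : ∀ᵐ t ∂(volume.restrict (Ioi (0 : ℝ))), v t ≠ 0 ∧ v t ≠ ∞)
    (hσ : AEMeasurable (dualWeight p' b v) (volume.restrict (Ioi 0))) {K : ℝ≥0∞}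
    (hK : IsSupOpBound p q (ratio u b) (halfLine (dualWeight p' b v)) (halfLine w) (halfLine a)
      K) : opNorm p q u b a v w ≤ K := by
  have hp0 := hp.pos
  set σ := dualWeight p' b v with hσdef
  refine iSup_le fun h => iSup_le fun hh => ?_
  have hfm : AEMeasurable (fun t => h t * b t / σ t) (volume.restrict (Ioi 0)) :=
    (hh.mul hbm).div hσ
  set f := hfm.mk with hf
  have hhf : ∀ᵐ t ∂(volume.restrict (Ioi (0 : ℝ))), h t * b t = σ t * f t := by
    filter_upwards [hb, hv, hfm.ae_eq_mk] with t hbt hvt ht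
    obtain ⟨hs0, hst, -⟩ := dualWeight_rpow_mul hp hbt.1 hbt.2 hvt.1 hvt.2
    rw [hf, ← ht, ENNReal.mul_div_cancel hs0 hst]
  have hfmeas : Measurable f := hfm.measurable_mk
  rw [supHardy_eq_supOp hσ hfmeas hhf, lebNorm_eq hp hb hv hσ hfmeas hhf,
    cesNorm_eq hw ha (measurable_supOp _ _ _)]
  by_cases hfin : ∫⁻ t, f t ^ p ∂(halfLine σ) = ∞
  · rw [hfin, ENNReal.top_rpow_of_pos (by positivity), ENNReal.div_top]
    exact zero_le
  · exact ENNReal.div_le_of_le_mul (hK f hfmeas hfin)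

end Norm

/-! ### The case of infinite `φ` and the equivalence -/

theorem hardySup_eq_top {α : Type*} [Preorder α] [MeasurableSpace α] {p' q : ℝ} (hp' : 0 < p')
    (hq : 0 < q) {μ ν : Measure α} {t : α} (hμ : μ (Iic t) = ∞) (hν : ν (Ici t) ≠ 0) :
    hardySup p' q μ ν = ∞ := by
  refine top_le_iff.1 (le_trans (le_of_eq ?_)
    (le_iSup (fun x => μ (Iic x) ^ (1 / p') * ν (Ici x) ^ (1 / q)) t))
  rw [hμ, ENNReal.top_rpow_of_pos (by positivity), ENNReal.top_mul]
  exact fun h => hν ((ENNReal.rpow_eq_zero_iff_of_pos (by positivity)).1 h)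

section Infinite

variable {α : Type*} [LinearOrder α] [TopologicalSpace α] [OrderTopology α]
  [SecondCountableTopology α] [MeasurableSpace α] [BorelSpace α]

theorem hardyInt_eq_top {p p' r : ℝ} (hp : 0 < p) (hp' : 0 < p') (hr : 0 < r) {μ ν : Measure α}
    {t : α} (hμ : μ (Iic t) = ∞) (hν : ν (Ici t) ≠ 0) : hardyInt p p' r μ ν = ∞ := by
  have hm : Measurable fun x => ν (Ici x) := measurable_measure_Iic (α := αᵒᵈ) ν
  have h0 : ∀ᵐ x ∂ν, ν (Ici x) ≠ 0 := ae_measure_Iic_ne_zero (α := αᵒᵈ) ν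
  have hne : ∫⁻ x in Ici t, ν (Ici x) ^ (r / p) ∂ν ≠ 0 := by
    intro h
    have h1 := (lintegral_eq_zero_iff (hm.pow_const _)).1 h
    refine hν ?_
    rw [← Measure.restrict_apply_univ, Measure.measure_univ_eq_zero, ← ae_eq_bot,
      ← eventually_false_iff_eq_bot]
    filter_upwards [h1, ae_restrict_of_ae h0] with x hx hx0
    exact hx0 ((ENNReal.rpow_eq_zero_iff_of_pos (by positivity)).1 hx)
  have hint : ∫⁻ x, μ (Iic x) ^ (r / p') * ν (Ici x) ^ (r / p) ∂ν = ∞ := by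
    refine top_le_iff.1 ?_
    calc ∞ = ∞ * ∫⁻ x in Ici t, ν (Ici x) ^ (r / p) ∂ν := (ENNReal.top_mul hne).symm
      _ = ∫⁻ x in Ici t, ∞ * ν (Ici x) ^ (r / p) ∂ν :=
          (lintegral_const_mul _ (hm.pow_const _)).symm
      _ ≤ ∫⁻ x in Ici t, μ (Iic x) ^ (r / p') * ν (Ici x) ^ (r / p) ∂ν := by
          refine setLIntegral_mono' measurableSet_Ici fun x hx => mul_le_mul_left ?_ _
          rw [top_le_iff.1 (hμ ▸ monotone_measure_Iic μ hx : ∞ ≤ μ (Iic x)),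
            ENNReal.top_rpow_of_pos (by positivity)]
      _ ≤ _ := setLIntegral_le_lintegral _ _
  rw [hardyInt, hint, ENNReal.top_rpow_of_pos (by positivity)]

end Infinite

/-- The norm of the operator is equivalent to the sum of the characterizing quantities. If `φ`
takes the value `∞`, both are infinite. -/
theorem exists_opNorm_equiv_charSum {p p' q : ℝ} (hp : p.HolderConjugate p') (hq : 1 < q)
    {O : Measure ℝ → Measure ℝ → (ℝ → ℝ → ℝ≥0∞) → ℝ≥0∞}
    {H : Measure ℝ → Measure ℝ → ℝ≥0∞} {H' : Measure ℝᵒᵈ → Measure ℝᵒᵈ → ℝ≥0∞}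
    (hO : IsOinarovFunctional p q O) (hH : IsHardyFunctional p q H)
    (hH' : IsHardyFunctional p q H')
    (htop : ∀ (μ ν : Measure ℝ) (t : ℝ), μ (Ici t) = ∞ → ν (Iic t) ≠ 0 → H' μ ν = ∞) :
    ∃ C : ℝ≥0, 0 < C ∧ ∀ (u : ℝ → ℝ≥0) (a b v w : ℝ → ℝ≥0∞), IsWeight a → IsWeight b →
      IsWeight v → IsWeight w → (∀ᵐ t ∂(volume.restrict (Ioi (0 : ℝ))), 0 < b t) →
      (∀ x : ℝ, 0 < x → ∫⁻ t in Ioc 0 x, v t ^ (1 - p') < ∞) →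
      opNorm p q u b a v w ≤ C * charSum p' q O H H' (ratio u b)
        (halfLine (dualWeight p' b v)) (halfLine w) (halfLine a) ∧
      charSum p' q O H H' (ratio u b) (halfLine (dualWeight p' b v)) (halfLine w) (halfLine a) ≤
        C * opNorm p q u b a v w := by
  have hp'0 := hp.symm.pos
  have hp'1 := hp.symm.lt
  have hq0 : 0 < q := by linarith
  obtain ⟨C₁, hC₁, h₁⟩ := exists_isSupOpBound_charSum hp hq hO hH hH'
  obtain ⟨C₂, hC₂, h₂⟩ := exists_charSum_le hp hq hO hH hH'
  have hCt : C₁ + C₂ + 1 ≠ ∞ := by finiteness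
  have hC0 : C₁ + C₂ + 1 ≠ 0 := by simp
  refine ⟨(C₁ + C₂ + 1).toNNReal, ENNReal.toNNReal_pos hC0 hCt,
    fun u a b v w ha hb hv hw hb0 hvx => ?_⟩
  rw [ENNReal.coe_toNNReal hCt]
  have hbm := hb.aemeasurable
  have hb' : ∀ᵐ t ∂(volume.restrict (Ioi (0 : ℝ))), b t ≠ 0 ∧ b t ≠ ∞ :=
    (hb0.mono fun t ht => ht.ne').and hb.ae_ne_top
  have hv' : ∀ᵐ t ∂(volume.restrict (Ioi (0 : ℝ))), v t ≠ 0 ∧ v t ≠ ∞ := by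
    refine Eventually.and ?_ hv.ae_ne_top
    filter_upwards [ae_ne_top_of_setLIntegral (hv.aemeasurable.pow_const _) hvx] with t ht h0
    exact ht (by rw [h0, ENNReal.zero_rpow_of_neg (by linarith)])
  have hσ := aemeasurable_dualWeight (p' := p') hb hv
  set ρ := ratio u b with hρ
  set σ := halfLine (dualWeight p' b v) with hσdef
  set ω := halfLine w with hω
  set α := halfLine a with hα
  set N := opNorm p q u b a v w with hN
  set R := charSum p' q O H H' ρ σ ω α with hR
  have : SigmaFinite σ := sigmaFinite_halfLine <| by
    filter_upwards [hb', hv'] with t hbt hvt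
    exact (dualWeight_rpow_mul hp hbt.1 hbt.2 hvt.1 hvt.2).2.1
  have : SigmaFinite ω := sigmaFinite_halfLine hw.ae_ne_top
  have hα0 : α (Iic 0) = 0 := by rw [hα, halfLine_Iic, prim_of_nonpos a le_rfl]
  have hαp : ∀ x, 0 < x → α (Iic x) ≠ 0 := fun x hx => by
    rw [hα, halfLine_Iic]; exact ha.prim_ne_zero hx
  have hαt : ∀ x, α (Iic x) ≠ ∞ := fun x => by rw [hα, halfLine_Iic]; exact ha.prim_ne_top x
  have hbound : IsSupOpBound p q ρ σ ω α N := isSupOpBound_opNorm hp hq0 ha hw hbm hb' hv' hσ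
  have hI : ∀ t, 0 < t → ∫⁻ x in Iic t, α (Iic x) ^ q ∂ω ≠ 0 := fun t ht =>
    setLIntegral_prim_rpow_ne_zero ha hw hq0 ht
  have hpow : ∀ {z : ℝ≥0∞}, z ≠ 0 → z ^ (1 / q) ≠ 0 := fun hz h =>
    hz ((ENNReal.rpow_eq_zero_iff_of_pos (by positivity)).1 h)
  by_cases hφ : ∀ t, 0 < t → scaleFun p' ρ σ t ≠ ∞
  · refine ⟨?_, (h₂ ρ σ ω α N hα0 hαt hφ hbound).trans (mul_le_mul_left ?_ _)⟩
    · by_cases hRt : R = ∞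
      · rw [hRt, ENNReal.mul_top hC0]; exact le_top
      · refine (opNorm_le_of_isSupOpBound hp ha hw hbm hb' hv' hσ
          (h₁ ρ σ ω α hα0 hαp hαt hφ hRt)).trans (mul_le_mul_left ?_ _)
        exact le_self_add.trans le_self_add
    · exact le_add_self.trans le_self_add
  · push Not at hφ
    obtain ⟨t, ht, hφt⟩ := hφ
    have hNt : N = ∞ := by
      have h := scaleFun_rpow_mul_le hp hq0 hbound t
      rw [hφt, ENNReal.top_rpow_of_pos (by positivity), ENNReal.top_mul (hpow (hI t ht))] at h
      exact top_le_iff.1 h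
    -- `φ(t) = ∞` makes either `d(-φ) [t, ∞)` or the limit of `φ` infinite
    have hRt : R = ∞ := by
      have h : ∞ ≤ scaleMeasure p' ρ σ (Ici t) + scaleLim p' ρ σ := by
        rw [← hφt]
        exact le_negStieltjes_Ici_add (tailSup_antitone _) (tendsto_tailSup _) ht
      rcases ENNReal.add_eq_top.1 (top_le_iff.1 h) with h | h
      · have hν : ω.withDensity (fun x => α (Iic x) ^ q) (Iic t) ≠ 0 := by
          rw [withDensity_apply _ measurableSet_Iic]; exact hI t ht
        refine top_le_iff.1 (le_trans (le_of_eq ?_) (le_add_self.trans (le_self_add (α := ℝ≥0∞))))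
        exact (htop _ _ t h hν).symm
      · refine top_le_iff.1 (le_trans (le_of_eq ?_) (le_add_self (α := ℝ≥0∞)))
        rw [h, ENNReal.top_rpow_of_pos (by positivity), ENNReal.mul_top]
        exact hpow fun h0 => hI 1 one_pos
          (le_antisymm ((setLIntegral_le_lintegral _ _).trans h0.le) zero_le)
    rw [hNt, hRt, ENNReal.mul_top hC0]
    exact ⟨le_rfl, le_rfl⟩

/-! ### The quantities in terms of the weights -/

/-- The kernel `(y, x) ↦ ∫_y^x (sup_{τ ≥ s} ρ(τ)) a(s) ds`, for `y ≥ 0`. -/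
noncomputable abbrev supKernel (ρ a : ℝ → ℝ≥0∞) : ℝ → ℝ → ℝ≥0∞ :=
  intervalKernel ((halfLine a).withDensity (tailSup ρ))

section Translation

variable {p p' q q' r : ℝ} {ρ σ a w : ℝ → ℝ≥0∞}

theorem scaleMeasure_halfLine (p' : ℝ) (ρ σ : ℝ → ℝ≥0∞) :
    scaleMeasure p' ρ (halfLine σ) = dPhi p' ρ σ := by
  simp only [scaleMeasure, scaleFun, dPhi, phi, halfLine_Iic]

theorem scaleLim_halfLine (hp' : 0 < p') (ρ σ : ℝ → ℝ≥0∞) :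
    scaleLim p' ρ (halfLine σ) ^ (1 / p') =
      limTailSup fun τ => ρ τ * prim σ τ ^ (1 / p') := by
  rw [scaleLim, ← limTailSup_rpow _ (by positivity)]
  congr 1
  funext τ
  rw [halfLine_Iic, ENNReal.mul_rpow_of_nonneg _ _ (by positivity), ← ENNReal.rpow_mul,
    mul_one_div_cancel hp'.ne', ENNReal.rpow_one]

theorem supKernel_eq_kern (ha : AEMeasurable a (volume.restrict (Ioi 0))) {y : ℝ}
    (hy : 0 ≤ y) (x : ℝ) :
    supKernel ρ a y x = kern ρ a y x := by
  have hsub : Ioc y x ∩ Ioi 0 = Ioc y x := inter_eq_left.2 fun t ht => hy.trans_lt ht.1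
  rw [supKernel, intervalKernel, withDensity_apply _ measurableSet_Ioc,
    setLIntegral_halfLine ha (measurable_tailSup ρ).aemeasurable measurableSet_Ioc, hsub, kern]
  simp only [mul_comm]

theorem iSup_eq_iSup_pos {f g : ℝ → ℝ≥0∞} (h0 : ∀ t ≤ 0, f t = 0) (h : ∀ t, 0 < t → f t = g t) :
    ⨆ t, f t = ⨆ t ∈ Ioi (0 : ℝ), g t := by
  refine le_antisymm (iSup_le fun t => ?_) (iSup₂_le fun t ht => (h t ht).symm.le.trans
    (le_iSup f t))
  rcases le_or_gt t 0 with ht | ht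
  · rw [h0 t ht]; exact zero_le
  · rw [h t ht]; exact le_iSup₂ (f := fun t (_ : t ∈ Ioi (0 : ℝ)) => g t) t ht

theorem lintegral_halfLine_eq {f g : ℝ → ℝ≥0∞} (hw : AEMeasurable w (volume.restrict (Ioi 0)))
    (hf : Measurable f) (h : ∀ t, 0 < t → w t * f t = g t) :
    ∫⁻ t, f t ∂(halfLine w) = ∫⁻ t in Ioi 0, g t := by
  rw [lintegral_halfLine hw hf.aemeasurable]
  exact setLIntegral_congr_fun measurableSet_Ioi h

theorem measurable_supKernel (ρ a : ℝ → ℝ≥0∞) : Measurable (Function.uncurry (supKernel ρ a)) :=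
  (isOinarovKernel_intervalKernel _).measurable

theorem setLIntegral_kernel_left (ha : AEMeasurable a (volume.restrict (Ioi 0)))
    (hσ : AEMeasurable σ (volume.restrict (Ioi 0))) (t : ℝ) :
    ∫⁻ y in Iic t, supKernel ρ a y t ^ p' ∂(halfLine σ) =
      ∫⁻ x in Ioc 0 t, σ x * kern ρ a x t ^ p' := by
  rw [setLIntegral_Iic_halfLine hσ
    ((measurable_supKernel ρ a).of_uncurry_right.pow_const _).aemeasurable]
  exact setLIntegral_congr_fun measurableSet_Ioc fun y hy => by
    simp only [supKernel_eq_kern ha hy.1.le]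

theorem setLIntegral_kernel_right (ha : AEMeasurable a (volume.restrict (Ioi 0)))
    (hw : AEMeasurable w (volume.restrict (Ioi 0))) {t : ℝ} (ht : 0 < t) :
    ∫⁻ x in Ici t, supKernel ρ a t x ^ q ∂(halfLine w) =
      ∫⁻ y in Ioi t, kern ρ a t y ^ q * w y := by
  rw [setLIntegral_Ici_halfLine hw
    ((measurable_supKernel ρ a).of_uncurry_left.pow_const _).aemeasurable ht]
  exact lintegral_congr fun y => by rw [supKernel_eq_kern ha ht.le, mul_comm]

theorem oinarovSup_eq (hp' : 0 < p') (ha : AEMeasurable a (volume.restrict (Ioi 0)))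
    (hσ : AEMeasurable σ (volume.restrict (Ioi 0)))
    (hw : AEMeasurable w (volume.restrict (Ioi 0))) :
    oinarovSup p' q (halfLine σ) (halfLine w) (supKernel ρ a) =
      I₁ p' q ρ σ a w + I₂ p' q ρ σ a w := by
  refine congrArg₂ (· + ·) (iSup_eq_iSup_pos (fun t ht => ?_) fun t ht => ?_)
    (iSup_eq_iSup_pos (fun t ht => ?_) fun t ht => ?_)
  · rw [setLIntegral_measure_zero _ _ (by rw [halfLine_Iic, prim_of_nonpos σ ht]),
      ENNReal.zero_rpow_of_pos (by positivity), zero_mul]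
  · rw [setLIntegral_kernel_left ha hσ, halfLine_Ici w ht]
  · rw [halfLine_Iic, prim_of_nonpos σ ht, ENNReal.zero_rpow_of_pos (by positivity), zero_mul]
  · rw [setLIntegral_kernel_right ha hw ht, halfLine_Iic, prim]

theorem oinarovInt_eq (ha : AEMeasurable a (volume.restrict (Ioi 0)))
    (hσ : AEMeasurable σ (volume.restrict (Ioi 0)))
    (hw : AEMeasurable w (volume.restrict (Ioi 0))) :
    oinarovInt p p' q q' r (halfLine σ) (halfLine w) (supKernel ρ a) =
      J₁ q q' r ρ σ a w + J₂ p p' r ρ σ a w := by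
  refine congrArg₂ (fun x y : ℝ≥0∞ => x ^ (1 / r) + y ^ (1 / r))
    (lintegral_halfLine_eq hσ ?_ fun t ht => ?_) (lintegral_halfLine_eq hw ?_ fun t ht => ?_)
  · exact ((measurable_setLIntegral_Ici (G := fun t x => supKernel ρ a t x ^ q)
      ((measurable_supKernel ρ a).pow_const _)).pow_const _).mul
      ((measurable_measure_Iic _).pow_const _)
  · rw [setLIntegral_kernel_right ha hw ht, halfLine_Iic, prim]; ring
  · exact ((measurable_setLIntegral_Iic (G := fun t y => supKernel ρ a y t ^ p')
      (((measurable_supKernel ρ a).comp measurable_swap).pow_const _)).pow_const _).mul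
      ((measurable_measure_Ici _).pow_const _)
  · rw [setLIntegral_kernel_left ha hσ, halfLine_Ici w ht]; ring

theorem withDensity_dPhi_Iic (p' : ℝ) (ρ σ a : ℝ → ℝ≥0∞) (t : ℝ) :
    (dPhi p' ρ σ).withDensity (fun t => halfLine a (Iic t) ^ p') (Iic t) =
      ∫⁻ x in Ioc 0 t, prim a x ^ p' ∂(dPhi p' ρ σ) := by
  have hr : (dPhi p' ρ σ).restrict (Ioi 0) = dPhi p' ρ σ := by
    unfold dPhi negStieltjes
    rw [Measure.restrict_restrict measurableSet_Ioi, inter_self]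
  rw [withDensity_apply _ measurableSet_Iic]
  conv_lhs => rw [← hr]
  rw [Measure.restrict_restrict measurableSet_Iic, Iic_inter_Ioi_zero]
  simp only [halfLine_Iic]

theorem withDensity_halfLine_Iic (hw : AEMeasurable w (volume.restrict (Ioi 0))) (q t : ℝ) :
    (halfLine w).withDensity (fun t => halfLine a (Iic t) ^ q) (Iic t) =
      ∫⁻ y in Ioc 0 t, prim a y ^ q * w y := by
  rw [withDensity_apply _ measurableSet_Iic, setLIntegral_Iic_halfLine hw
    ((measurable_measure_Iic _).pow_const _).aemeasurable]
  simp only [halfLine_Iic, mul_comm]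

theorem hardySup_eq_I₄ (hp' : 0 < p') :
    hardySup p' q ((dPhi p' ρ σ).withDensity fun t => halfLine a (Iic t) ^ p') (halfLine w) =
      I₄ p' q ρ σ a w := by
  refine iSup_eq_iSup_pos (fun t ht => ?_) fun t ht => ?_
  · rw [withDensity_dPhi_Iic, Ioc_eq_empty (not_lt.2 ht)]
    simp [hp']
  · rw [withDensity_dPhi_Iic, halfLine_Ici w ht]

theorem hardySup_dual_eq_I₃ (hq : 0 < q) (hw : AEMeasurable w (volume.restrict (Ioi 0))) :
    hardySup (α := ℝᵒᵈ) p' q (dPhi p' ρ σ)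
      ((halfLine w).withDensity fun t => halfLine a (Iic t) ^ q) = I₃ p' q ρ σ a w := by
  refine iSup_eq_iSup_pos (f := fun t => dPhi p' ρ σ (Ici t) ^ (1 / p') *
    (halfLine w).withDensity (fun t => halfLine a (Iic t) ^ q) (Iic t) ^ (1 / q))
    (fun t ht => ?_) fun t ht => ?_
  · rw [withDensity_halfLine_Iic hw, Ioc_eq_empty (not_lt.2 ht)]
    simp [hq]
  · rw [withDensity_halfLine_Iic hw]

theorem hardyInt_eq_J₄ (hw : AEMeasurable w (volume.restrict (Ioi 0))) :
    hardyInt p p' r ((dPhi p' ρ σ).withDensity fun t => halfLine a (Iic t) ^ p') (halfLine w) =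
      J₄ p p' r ρ σ a w := by
  refine congrArg (fun x : ℝ≥0∞ => x ^ (1 / r)) (lintegral_halfLine_eq hw ?_ fun t ht => ?_)
  · exact ((measurable_measure_Iic _).pow_const _).mul ((measurable_measure_Ici _).pow_const _)
  · rw [withDensity_dPhi_Iic, halfLine_Ici w ht]; ring

theorem hardyInt_dual_eq_J₃ (hw : AEMeasurable w (volume.restrict (Ioi 0))) :
    hardyInt (α := ℝᵒᵈ) p p' r (dPhi p' ρ σ)
      ((halfLine w).withDensity fun t => halfLine a (Iic t) ^ q) = J₃ p q p' r ρ σ a w := by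
  have hA : Measurable fun t => halfLine a (Iic t) ^ q := (measurable_measure_Iic _).pow_const _
  have hm : Measurable fun x => dPhi p' ρ σ (Ici x) ^ (r / p') *
      (halfLine w).withDensity (fun t => halfLine a (Iic t) ^ q) (Iic x) ^ (r / p) :=
    ((measurable_measure_Ici _).pow_const _).mul ((measurable_measure_Iic _).pow_const _)
  have h1 : ∫⁻ x, dPhi p' ρ σ (Ici x) ^ (r / p') *
      (halfLine w).withDensity (fun t => halfLine a (Iic t) ^ q) (Iic x) ^ (r / p)
      ∂((halfLine w).withDensity fun t => halfLine a (Iic t) ^ q) =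
      ∫⁻ x in Ioi 0, (dPhi p' ρ σ (Ici x)) ^ (r / p') *
        (∫⁻ y in Ioc 0 x, prim a y ^ q * w y) ^ (r / p) * (prim a x ^ q * w x) := by
    rw [lintegral_withDensity_eq_lintegral_mul _ hA hm]
    refine lintegral_halfLine_eq hw (hA.mul hm) fun t ht => ?_
    rw [Pi.mul_apply, withDensity_halfLine_Iic hw, halfLine_Iic]; ring
  exact congrArg (fun x : ℝ≥0∞ => x ^ (1 / r)) h1

theorem rpow_mul_scaleLim_eq_I₅ (hp' : 0 < p') (hw : AEMeasurable w (volume.restrict (Ioi 0))) :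
    (∫⁻ x, halfLine a (Iic x) ^ q ∂(halfLine w)) ^ (1 / q) *
      scaleLim p' ρ (halfLine σ) ^ (1 / p') = I₅ p' q ρ σ a w := by
  rw [scaleLim_halfLine hp', I₅, lintegral_halfLine_eq hw (g := fun y => prim a y ^ q * w y)
    ((measurable_measure_Iic _).pow_const _) fun t _ => by rw [halfLine_Iic, mul_comm]]

theorem charSum_sup_eq (hp' : 0 < p') (hq : 0 < q)
    (ha : AEMeasurable a (volume.restrict (Ioi 0)))
    (hσ : AEMeasurable σ (volume.restrict (Ioi 0)))
    (hw : AEMeasurable w (volume.restrict (Ioi 0))) :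
    charSum p' q (oinarovSup p' q) (hardySup p' q) (hardySup p' q) ρ (halfLine σ) (halfLine w)
      (halfLine a) = I₁ p' q ρ σ a w + I₂ p' q ρ σ a w + I₃ p' q ρ σ a w + I₄ p' q ρ σ a w +
        I₅ p' q ρ σ a w := by
  rw [charSum, scaleMeasure_halfLine, oinarovSup_eq hp' ha hσ hw, hardySup_eq_I₄ hp',
    hardySup_dual_eq_I₃ hq hw, rpow_mul_scaleLim_eq_I₅ hp' hw]
  ring

theorem charSum_int_eq (hp' : 0 < p') (ha : AEMeasurable a (volume.restrict (Ioi 0)))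
    (hσ : AEMeasurable σ (volume.restrict (Ioi 0)))
    (hw : AEMeasurable w (volume.restrict (Ioi 0))) :
    charSum p' q (oinarovInt p p' q q' r) (hardyInt p p' r) (hardyInt p p' r) ρ (halfLine σ)
      (halfLine w) (halfLine a) = J₁ q q' r ρ σ a w + J₂ p p' r ρ σ a w +
        J₃ p q p' r ρ σ a w + J₄ p p' r ρ σ a w + I₅ p' q ρ σ a w := by
  rw [charSum, scaleMeasure_halfLine, oinarovInt_eq ha hσ hw, hardyInt_eq_J₄ hw,
    hardyInt_dual_eq_J₃ hw, rpow_mul_scaleLim_eq_I₅ hp' hw]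
  ring

end Translation

end Cesaro

theorem mainTheorem2 (p q p' q' : ℝ) (hp : 1 < p) (hq : 1 < q)
    (hp' : 1 / p + 1 / p' = 1) (hq' : 1 / q + 1 / q' = 1) :
    ∃ C : ℝ≥0, 0 < C ∧
      ∀ (u : ℝ → ℝ≥0) (a b v w : ℝ → ℝ≥0∞),
        Cesaro.IsWeight (fun t => (u t : ℝ≥0∞)) → ContinuousOn u (Ioi 0) →
        Cesaro.IsWeight a → Cesaro.IsWeight b → Cesaro.IsWeight v → Cesaro.IsWeight w →
        (∀ᵐ t ∂(volume.restrict (Ioi (0 : ℝ))), 0 < b t) →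
        (∀ x : ℝ, 0 < x → 0 < ∫⁻ t in Ioc 0 x, v t ^ (1 - p') ∧
          ∫⁻ t in Ioc 0 x, v t ^ (1 - p') < ∞) →
        let ρ := Cesaro.ratio u b
        let σ := Cesaro.dualWeight p' b v
        let N := Cesaro.opNorm p q u b a v w
        (p ≤ q →
          let R := Cesaro.I₁ p' q ρ σ a w + Cesaro.I₂ p' q ρ σ a w + Cesaro.I₃ p' q ρ σ a w +
            Cesaro.I₄ p' q ρ σ a w + Cesaro.I₅ p' q ρ σ a w
          N ≤ C * R ∧ R ≤ C * N) ∧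
        (q < p → ∀ r : ℝ, 1 / r = 1 / q - 1 / p →
          let R := Cesaro.J₁ q q' r ρ σ a w + Cesaro.J₂ p p' r ρ σ a w +
            Cesaro.J₃ p q p' r ρ σ a w + Cesaro.J₄ p p' r ρ σ a w + Cesaro.I₅ p' q ρ σ a w
          N ≤ C * R ∧ R ≤ C * N) := by
  have hpc : p.HolderConjugate p' := Real.holderConjugate_iff.2 ⟨hp, by simpa using hp'⟩
  have hqc : q.HolderConjugate q' := Real.holderConjugate_iff.2 ⟨hq, by simpa using hq'⟩
  have hp'0 := hpc.symm.pos
  rcases le_or_gt p q with hpq | hqp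
  · obtain ⟨C, hC, h⟩ := Cesaro.exists_opNorm_equiv_charSum hpc hq
      (Cesaro.isOinarovFunctional_oinarovSup hpc hpq) (Cesaro.isHardyFunctional_hardySup hpc hpq)
      (Cesaro.isHardyFunctional_hardySup hpc hpq)
      fun μ ν t hμ hν => Cesaro.hardySup_eq_top (α := ℝᵒᵈ) hp'0 hqc.pos hμ hν
    refine ⟨C, hC, fun u a b v w _ _ ha hb hv hw hb0 hvx => ⟨fun _ => ?_,
      fun hqp => absurd hqp (not_lt.2 hpq)⟩⟩
    have h1 := h u a b v w ha hb hv hw hb0 fun x hx => (hvx x hx).2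
    rwa [Cesaro.charSum_sup_eq hp'0 hqc.pos ha.aemeasurable
      (Cesaro.aemeasurable_dualWeight hb hv) hw.aemeasurable] at h1
  · obtain ⟨s, hs⟩ : ∃ s : ℝ, 1 / s = 1 / q - 1 / p := ⟨1 / (1 / q - 1 / p), by simp⟩
    have hs0 := (Cesaro.exponent_relations hpc hqc hqp hs).1
    obtain ⟨C, hC, h⟩ := Cesaro.exists_opNorm_equiv_charSum hpc hq
      (Cesaro.isOinarovFunctional_oinarovInt hpc hqc hqp hs)
      (Cesaro.isHardyFunctional_hardyInt hpc hqc hqp hs)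
      (Cesaro.isHardyFunctional_hardyInt hpc hqc hqp hs)
      fun μ ν t hμ hν => Cesaro.hardyInt_eq_top (α := ℝᵒᵈ) hpc.pos hp'0 hs0 hμ hν
    refine ⟨C, hC, fun u a b v w _ _ ha hb hv hw hb0 hvx => ⟨fun hpq =>
      absurd hqp (not_lt.2 hpq), fun _ r hr => ?_⟩⟩
    obtain rfl : s = r := by rw [← hr] at hs; simpa using hs
    have h1 := h u a b v w ha hb hv hw hb0 fun x hx => (hvx x hx).2
    rwa [Cesaro.charSum_int_eq hp'0 ha.aemeasurable
      (Cesaro.aemeasurable_dualWeight hb hv) hw.aemeasurable] at h1
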